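/- All transfer functions are scalar real rational functions; $\mathbb{R}\mathcal{H}_\infty$ is the set of proper ones without poles in $\{\mathrm{Re}\,s\ge 0\}$, and $\mathbb{C}_+=\{\mathrm{Re}\,s>0\}$. A function in $\mathbb{R}\mathcal{H}_\infty$ without zeros in $\mathbb{C}_+$ is called minimum phase (or outer); the minimum phase part of $G\in\mathbb{R}\mathcal{H}_\infty$, $G\neq 0$, is $G_m=L_G^{-1}G$ with $L_G(s)=\prod \frac{\bar z}{z}\frac{z-s}{\bar z+s}$ over the zeros $z\in\mathbb{C}_+$ of $G$, counted with multiplicity. Consider the loop $u=K_1r+K_2y$, $u_c=Fu+Hn$, $y=Pu_c$, where $r$ is a white Gaussian noise $w$ of spectral density $\sigma^2$ ($\sigma>0$) passed through the integrator $1/s$, and $n$ is a white Gaussian noise of spectral density $\gamma^2$ ($\gamma\ge 0$) uncorrelated with $w$. Suppose that $P(s)=P_o(s)/s^{k}$ with $k\ge1$, $P_o$ proper and without zero at $s=0$; that $F\in\mathbb{R}\mathcal{H}_\infty$, and that $H$ is minimum phase; and that the zeros of $P$ and of $F$ in $\mathbb{C}_+$, together denoted $z_i$ ($i=1,\dots,n_z+n_f$),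 are simple and pairwise distinct. Let $PF=NM^{-1}=\tilde M^{-1}\tilde N$, $P=N_0M^{-1}$ be factorizations over $\mathbb{R}\mathcal{H}_\infty$ with the double Bezout identity $$\begin{bmatrix}\tilde X&-\tilde Y\\-\tilde N&\tilde M\end{bmatrix}\begin{bmatrix}M&Y\\N&X\end{bmatrix}=I,$$ all entries being in $\mathbb{R}\mathcal{H}_\infty$, and let $$\mathcal{K}_s=\{[K_1\ K_2]=(\tilde X-R\tilde N)^{-1}[Q\ \ \tilde Y-R\tilde M]: Q,R\in\mathbb{R}\mathcal{H}_\infty,\ \tilde X-R\tilde N\neq0\}$$ be the set of stabilizing compensators. For $0\le\epsilon\le1$ let $J=E[(1-\epsilon)(r(t)-y(t))^2+\epsilon u_c(t)^2]$ in the stationary regime ($J=\infty$ if a signal of non-zero weight has no finite power), and $J^*=\inf_{\mathcal{K}_s}J$; suppose that $J<\infty$ for some compensator in $\mathcal{K}_s$. Let $N_m,C_{FM},N_{0m},M_m$ be the minimum phase parts of $N,FM,N_0,M$, and let $$\begin{bmatrix}\sqrt{1-\epsilon}\,N_m\\ \sqrt{\epsilon}\,C_{FM}\end{bmatrix}=\Theta_i\Theta_o,\qquad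 \begin{bmatrix}\sqrt{1-\epsilon}\,N_{0m}\\ \sqrt{\epsilon}\,M_m\end{bmatrix}=\Delta_i\Delta_o$$ be inner-outer factorizations over $\mathbb{R}\mathcal{H}_\infty$. Put $f(s)=(1-\epsilon)\sigma^2N_m(s)\Theta_o^{-1}(s)\Theta_o^{-1}(0)N_m(0)$, let $s_i$ ($i=1,\dots,N_s$) be the zeros of $f$ in $\mathbb{C}_+$ counted with multiplicity, $\hat L(s)=\prod_{k=1}^{n_z+n_f}\frac{s-z_k}{s+\bar z_k}$, and $$\tilde r_i=\mathrm{Res}_{s=z_i}\ \Delta_o(z_i)M^{-1}(z_i)H(z_i)\hat L^{-1}(s).$$ Then the integral below converges absolutely and, for every $t$, $$J^*=2(1-\epsilon)\sigma^2\left[\sum_{i=1}^{n_z+n_f}\frac{\mathrm{Re}\,z_i}{|z_i|^2}+\sum_{i=1}^{N_s}\frac{\mathrm{Re}\,s_i}{|s_i|^2}-\frac1\pi\int_0^\infty\frac{1}{\omega^2}\log\left|\frac{f(j\omega)}{f(0)}\right|d\omega\right]+\gamma^2\sum_{i,j=1}^{n_z+n_f}\frac{\overline{\tilde r_i}\,\tilde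 r_j}{\bar z_i+z_j},$$ where for $\epsilon=1$ the first term is $0$ (then $f=0$, and its sum and integral are read as $0$). -/

import Mathlib

open MeasureTheory ProbabilityTheory Filter Topology
open scoped ENNReal ComplexConjugate

noncomputable section

namespace Tracking

/-- The value at `s : ℂ` of a real rational transfer function (junk value `0` at poles). -/
def evalC (G : RatFunc ℝ) (s : ℂ) : ℂ := G.eval (algebraMap ℝ ℂ) s

/-- The real value at `s = 0` of a real rational transfer function. -/
def evalZero (G : RatFunc ℝ) : ℝ := G.eval (RingHom.id ℝ) 0

/-- A proper rational function. -/
def IsProper (G : RatFunc ℝ) : Prop := G.num.natDegree ≤ G.denom.natDegree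

/-- The class of stable proper real rational transfer functions: no pole in the closed right
half-plane. -/
def RHInf (G : RatFunc ℝ) : Prop :=
  IsProper G ∧ ∀ s : ℂ, 0 ≤ s.re → Polynomial.aeval s G.denom ≠ 0

open Classical in
/-- The nonminimum phase zeros: the zeros in the open right half-plane, with multiplicity. -/
def nmpZeros (G : RatFunc ℝ) : Multiset ℂ := (G.num.aroots ℂ).filter (fun s => 0 < s.re)

/-- Minimum phase: stable, proper, without zeros in the open right half-plane. For a scalar
rational function this is also the notion of an outer function. -/
def IsMinimumPhase (G : RatFunc ℝ) : Prop :=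
  RHInf G ∧ ∀ s : ℂ, 0 < s.re → evalC G s ≠ 0

/-- `Gm` is the minimum phase part of `G`, that is `G = L * Gm` with the allpass factor
`L(s) = ∏ (z̄ / z) (z - s) / (z̄ + s)` over the nonminimum phase zeros `z` of `G`. -/
def IsMinimumPhasePart (G Gm : RatFunc ℝ) : Prop :=
  IsMinimumPhase Gm ∧ ∀ s : ℂ, 0 ≤ s.re →
    evalC G s =
      ((nmpZeros G).map (fun z => conj z / z * ((z - s) / (conj z + s)))).prod * evalC Gm s

/-- `[a; b] = [θ₁; θ₂] * θo` is an inner-outer factorization of a column of two entries. -/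
structure IsInnerOuter (a b θ₁ θ₂ θo : RatFunc ℝ) : Prop where
  inner_stable₁ : RHInf θ₁
  inner_stable₂ : RHInf θ₂
  inner_isometry : ∀ ω : ℝ,
    ‖evalC θ₁ (ω * Complex.I)‖ ^ 2 + ‖evalC θ₂ (ω * Complex.I)‖ ^ 2 = 1
  outer : IsMinimumPhase θo
  fst_eq : a = θ₁ * θo
  snd_eq : b = θ₂ * θo

/-- Coprime factorizations `P F = N M⁻¹ = M̃⁻¹ Ñ`, `P = N₀ M⁻¹` over the stable proper rational
functions, with the double Bezout identity. -/
structure IsCoprimeFactorization (P F N N₀ M Nt Mt X Y Xt Yt : RatFunc ℝ) : Prop where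
  stable_N : RHInf N
  stable_N₀ : RHInf N₀
  stable_M : RHInf M
  stable_Nt : RHInf Nt
  stable_Mt : RHInf Mt
  stable_X : RHInf X
  stable_Y : RHInf Y
  stable_Xt : RHInf Xt
  stable_Yt : RHInf Yt
  right_eq : P * F = N / M
  left_eq : P * F = Nt / Mt
  plant_eq : P = N₀ / M
  bezout : !![Xt, -Yt; -Nt, Mt] * !![M, Y; N, X] = 1

/-- The stabilizing two-parameter compensators
`[K₁ K₂] = (X̃ - R Ñ)⁻¹ [Q, Ỹ - R M̃]`, with `Q, R` stable and proper. -/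
def stabilizing (Nt Mt Xt Yt : RatFunc ℝ) : Set (RatFunc ℝ × RatFunc ℝ) :=
  {K | ∃ Q R : RatFunc ℝ, RHInf Q ∧ RHInf R ∧ Xt - R * Nt ≠ 0 ∧
    K = (Q / (Xt - R * Nt), (Yt - R * Mt) / (Xt - R * Nt))}

section Stochastic

variable {Ω : Type*} [MeasurableSpace Ω]

/-- White Gaussian noise of spectral density `c ^ 2` on the time axis `ℝ`: a linear map
`φ ↦ ∫ φ(τ) dW(τ)` on `L²(ℝ)` such that the integral of `φ` is a centred Gaussian variable with
variance `c ^ 2 ‖φ‖²`. -/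
def IsWhiteNoise (μ : Measure Ω) (c : ℝ)
    (W : Lp ℝ 2 (volume : Measure ℝ) →ₗ[ℝ] Lp ℝ 2 μ) : Prop :=
  ∀ φ, μ.map (W φ) = gaussianReal 0 (Real.toNNReal (c ^ 2 * ‖φ‖ ^ 2))

/-- The two noises are uncorrelated. -/
def Uncorrelated {μ : Measure Ω} (W V : Lp ℝ 2 (volume : Measure ℝ) →ₗ[ℝ] Lp ℝ 2 μ) : Prop :=
  ∀ φ ψ, ∫ x, W φ x * V ψ x ∂μ = 0

/-- `g` is a causal square integrable impulse response with transfer function `G`: its Laplace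
transform is `G` on the open right half-plane. -/
structure IsImpulseResponse (G : RatFunc ℝ) (g : ℝ → ℝ) : Prop where
  memLp : MemLp g 2 volume
  causal : ∀ t < 0, g t = 0
  laplace : ∀ s : ℂ, 0 < s.re →
    ∫ t in Set.Ioi (0 : ℝ), (g t : ℂ) * Complex.exp (-s * t) = evalC G s

theorem IsImpulseResponse.memLp_shift {G : RatFunc ℝ} {g : ℝ → ℝ} (h : IsImpulseResponse G g)
    (t : ℝ) : MemLp (fun τ => g (t - τ)) 2 volume :=
  h.memLp.comp_measurePreserving (Measure.measurePreserving_sub_left volume t)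

/-- The stationary output at time `t`, `∫ g(t - τ) dW(τ)`, of the filter with impulse response
`g` driven by the noise `W`. -/
def output {μ : Measure Ω} (W : Lp ℝ 2 (volume : Measure ℝ) →ₗ[ℝ] Lp ℝ 2 μ)
    {G : RatFunc ℝ} {g : ℝ → ℝ} (h : IsImpulseResponse G g) (t : ℝ) : Lp ℝ 2 μ :=
  W ((h.memLp_shift t).toLp)

/-- `E[x(t)²]` for the signal `x` that is the sum of the outputs of `G` driven by `W` and of `G'`
driven by `V`. The impulse responses are unique up to null sets, so the infimum only says that the
value is `∞` if one of them does not exist (the signal then has no finite power). -/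
def meanSquare {μ : Measure Ω} (W V : Lp ℝ 2 (volume : Measure ℝ) →ₗ[ℝ] Lp ℝ 2 μ)
    (G G' : RatFunc ℝ) (t : ℝ) : ℝ≥0∞ :=
  ⨅ (g : ℝ → ℝ) (g' : ℝ → ℝ) (h : IsImpulseResponse G g) (h' : IsImpulseResponse G' g'),
    ∫⁻ x, ENNReal.ofReal ((output W h t x + output V h' t x) ^ 2) ∂μ

/-- The performance index `E[(1 - ε) (r(t) - y(t))² + ε u_c(t)²]` of the loop
`u = K₁ r + K₂ y`, `u_c = F u + H n`, `y = P u_c`, where the reference `r` is the white noise `w`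
passed through the integrator `1 / s`, and `n` is the channel noise. -/
def performance {μ : Measure Ω} (w n : Lp ℝ 2 (volume : Measure ℝ) →ₗ[ℝ] Lp ℝ 2 μ)
    (ε : ℝ) (P F H : RatFunc ℝ) (K : RatFunc ℝ × RatFunc ℝ) (t : ℝ) : ℝ≥0∞ :=
  ENNReal.ofReal (1 - ε) *
      meanSquare w n ((1 - (1 - P * F * K.2)⁻¹ * (P * F * K.1)) / RatFunc.X)
        (-((1 - P * F * K.2)⁻¹ * (P * H))) t +
    ENNReal.ofReal ε *
      meanSquare w n ((1 - F * K.2 * P)⁻¹ * (F * K.1) / RatFunc.X)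
        ((1 - F * K.2 * P)⁻¹ * H) t

/-- The optimal performance over a set `S` of compensators. -/
def optimalPerformance {μ : Measure Ω} (w n : Lp ℝ 2 (volume : Measure ℝ) →ₗ[ℝ] Lp ℝ 2 μ)
    (ε : ℝ) (P F H : RatFunc ℝ) (S : Set (RatFunc ℝ × RatFunc ℝ)) (t : ℝ) : ℝ≥0∞ :=
  ⨅ K ∈ S, performance w n ε P F H K t

end Stochastic

/-- `f(s) = (1 - ε) σ² N_m(s) Θ_o(s)⁻¹ Θ_o(0)⁻¹ N_m(0)`. -/
def fFun (ε σ : ℝ) (Nm Θo : RatFunc ℝ) : RatFunc ℝ :=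
  RatFunc.C ((1 - ε) * σ ^ 2) * Nm * Θo⁻¹ * RatFunc.C ((evalZero Θo)⁻¹ * evalZero Nm)

/-- The integrand `log |f(jω) / f(0)| / ω²`. -/
def logGain (f : RatFunc ℝ) (ω : ℝ) : ℝ :=
  Real.log ‖evalC f (ω * Complex.I) / evalC f 0‖ / ω ^ 2

/-- The residue of `φ` at a point that is at most a simple pole. -/
def simpleResidue (φ : ℂ → ℂ) (z : ℂ) : ℂ :=
  limUnder (𝓝[≠] z) (fun s => (s - z) * φ s)

/-- The allpass factor `L̂(s) = ∏ (s - z) / (s + z̄)`. -/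
def allpassHat (Z : Finset ℂ) (s : ℂ) : ℂ := ∏ z ∈ Z, (s - z) / (s + conj z)

/-- `r̃_z = Res_{s = z} Δ_o(z) M(z)⁻¹ H(z) L̂(s)⁻¹`. -/
def rTilde (Δo M H : RatFunc ℝ) (Z : Finset ℂ) (z : ℂ) : ℂ :=
  simpleResidue (fun s => evalC Δo z * (evalC M z)⁻¹ * evalC H z * (allpassHat Z s)⁻¹) z

end Tracking

end

/-! The Bezout identity makes the sensitivity `1 / (1 - P F K₂)` equal to `M (X̃ - R Ñ)`. The error
`r - y` is therefore `(1 - N Q) / s` driven by `w` plus `-N₀ H (X̃ - R Ñ)` driven by `n`, and `u_c`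
is `F M Q / s` driven by `w` plus `M H (X̃ - R Ñ)` driven by `n`. White noise acts as a multiple of
an isometry, so Plancherel turns each mean square into squared `H₂` norms, and a signal of non-zero
weight has finite power exactly when its transfer functions are stable and strictly proper. Hence `J
= σ² T(Q) + γ² S(R)` (`performance_split`), and `Q` and `R` are optimized independently.

Tracking: on the imaginary axis `|Θ_o|² = (1-ε)|N|² + ε|F M|²`, and the integrator in the plant
forces `M(0) = 0`. So `c = Θ_o(0) / N(0)` satisfies `c² = 1 - ε`, and completing the square gives
`T(Q) = ‖(Θ_o Q - c)/s‖²` plus a cross term `∫ Re g(jω) / ω² dω` with `g(0) = 0`. Cauchy's theorem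
evaluates that integral as `π g'(0)`, which does not depend on `Q` (`reference_cost_eq`); the
constant is `(1-ε) Re (Θ_o'/Θ_o - N'/N)(0)`. The remaining square can be made arbitrarily small,
since multiples of an outer function are dense in `H₂` (`exists_normSqTwo_sub_mul_lt`).

To read the constant as in the statement, differentiate `f Θ_o L_N = κ N` logarithmically at `0`.
The allpass factor `L_N` contributes `-2 ∑ Re z / |z|²`, and `f'(0)/f(0)` is the log-gain integral
up to the factor `2/π` (`integral_logGain`). This applies because for `ε < 1` the function `f` is a
constant multiple of `Θ₁` and is minimum phase; the sum over the `s_i` is thus empty. Factoring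
numerator and denominator reduces the log-gain integral to `∫₀^∞ log|1 + w²x²| / x² dx = π Re w` for
`Re w ≥ 0`.

Noise: `S(R)` is the squared norm of `Δ_o H (X̃ - R Ñ)`, whose values at the zeros `z` of `Ñ` do not
depend on `R`; Bezout gives `X̃(z) = M(z)⁻¹` there. Such a function is a fixed interpolant plus the
allpass factor times some `g` in `H₂`; the two pieces are orthogonal, and density makes `g`
arbitrarily small. The norm of the interpolant is a quadratic form in its residues whose matrix is
the Gram matrix `1 / (z̄ + z')` of the Szegő kernels (`exists_noise_cost`). -/

namespace Tracking

/-- A real polynomial as a rational function. -/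
local notation "ρ" => algebraMap (Polynomial ℝ) (RatFunc ℝ)

/-! ### Evaluation and the ring of stable proper rational functions -/

theorem evalC_eq (G : RatFunc ℝ) (s : ℂ) :
    evalC G s = Polynomial.aeval s G.num / Polynomial.aeval s G.denom := rfl

theorem evalC_div_of_ne_zero (p q : Polynomial ℝ) {s : ℂ} (h : Polynomial.aeval s q ≠ 0) :
    evalC (ρ p / ρ q) s = Polynomial.aeval s p / Polynomial.aeval s q := by
  have hq : q ≠ 0 := by rintro rfl; simp at h
  have hd : Polynomial.aeval s (ρ p / ρ q).denom ≠ 0 := fun h0 =>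
    h (Polynomial.eval₂_eq_zero_of_dvd_of_eval₂_eq_zero _ _ (RatFunc.denom_div_dvd p q) h0)
  rw [evalC_eq, div_eq_div_iff hd h, ← map_mul, ← map_mul,
    (RatFunc.num_mul_eq_mul_denom_iff hq).2 rfl]

@[simp] theorem evalC_C (c : ℝ) (s : ℂ) : evalC (RatFunc.C c) s = c := by simp [evalC]
@[simp] theorem evalC_zero (s : ℂ) : evalC 0 s = 0 := by simp [evalC]
@[simp] theorem evalC_one (s : ℂ) : evalC 1 s = 1 := by simp [evalC]

theorem isProper_iff_degree {G : RatFunc ℝ} : IsProper G ↔ G.num.degree ≤ G.denom.degree := by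
  rw [IsProper, Polynomial.natDegree_le_iff_degree_le,
    ← Polynomial.degree_eq_natDegree G.denom_ne_zero]

/-- The fraction need not be in lowest terms: the reduced denominator divides `q`, and
cross-multiplication shows that the difference of degrees survives reduction. -/
theorem rhInf_div {p q : Polynomial ℝ} (hq : ∀ s : ℂ, 0 ≤ s.re → Polynomial.aeval s q ≠ 0)
    (hd : p.degree ≤ q.degree) : RHInf (ρ p / ρ q) := by
  have hq0 : q ≠ 0 := by rintro rfl; simpa using hq 0 (by simp)
  refine ⟨?_, fun s hs h0 => hq s hs
    (Polynomial.eval₂_eq_zero_of_dvd_of_eval₂_eq_zero _ _ (RatFunc.denom_div_dvd p q) h0)⟩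
  rw [isProper_iff_degree]
  set G := ρ p / ρ q
  have h : G.num * q = p * G.denom := (RatFunc.num_mul_eq_mul_denom_iff hq0).2 rfl
  by_cases hp : p = 0
  · simp [G, hp]
  have h2 := congrArg Polynomial.degree h
  have hn : G.num ≠ 0 := by
    intro h0
    rw [h0, zero_mul] at h
    exact mul_ne_zero hp G.denom_ne_zero h.symm
  rw [Polynomial.degree_mul, Polynomial.degree_mul, Polynomial.degree_eq_natDegree hp,
    Polynomial.degree_eq_natDegree hq0, Polynomial.degree_eq_natDegree hn,
    Polynomial.degree_eq_natDegree G.denom_ne_zero] at h2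
  rw [Polynomial.degree_eq_natDegree hp, Polynomial.degree_eq_natDegree hq0] at hd
  rw [Polynomial.degree_eq_natDegree hn, Polynomial.degree_eq_natDegree G.denom_ne_zero]
  norm_cast at *
  omega

namespace RHInf

variable {G G' : RatFunc ℝ} {s : ℂ}

theorem degree_le (h : RHInf G) : G.num.degree ≤ G.denom.degree := isProper_iff_degree.1 h.1

theorem evalC_mul (h : RHInf G) (h' : RHInf G') (hs : 0 ≤ s.re) :
    evalC (G * G') s = evalC G s * evalC G' s :=
  RatFunc.eval_mul _ _ (h.2 s hs) (h'.2 s hs)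

theorem evalC_add (h : RHInf G) (h' : RHInf G') (hs : 0 ≤ s.re) :
    evalC (G + G') s = evalC G s + evalC G' s :=
  RatFunc.eval_add _ _ (h.2 s hs) (h'.2 s hs)

theorem mul (h : RHInf G) (h' : RHInf G') : RHInf (G * G') := by
  have e : G * G' = ρ (G.num * G'.num) / ρ (G.denom * G'.denom) := by
    rw [map_mul, map_mul, ← div_mul_div_comm, RatFunc.num_div_denom, RatFunc.num_div_denom]
  rw [e]
  refine rhInf_div (fun s hs => ?_) ?_
  · rw [_root_.map_mul]
    exact mul_ne_zero (h.2 s hs) (h'.2 s hs)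
  · rw [Polynomial.degree_mul, Polynomial.degree_mul]
    exact add_le_add h.degree_le h'.degree_le

theorem add (h : RHInf G) (h' : RHInf G') : RHInf (G + G') := by
  have e : G + G' = ρ (G.num * G'.denom + G.denom * G'.num) / ρ (G.denom * G'.denom) := by
    have h1 : ρ G.denom ≠ 0 := by simpa using G.denom_ne_zero
    have h2 : ρ G'.denom ≠ 0 := by simpa using G'.denom_ne_zero
    rw [map_mul, map_add, map_mul, map_mul, ← div_add_div _ _ h1 h2, RatFunc.num_div_denom,
      RatFunc.num_div_denom]
  rw [e]
  refine rhInf_div (fun s hs => ?_) ?_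
  · rw [_root_.map_mul]
    exact mul_ne_zero (h.2 s hs) (h'.2 s hs)
  · refine (Polynomial.degree_add_le _ _).trans (max_le ?_ ?_)
    · rw [Polynomial.degree_mul, Polynomial.degree_mul]
      exact add_le_add h.degree_le le_rfl
    · rw [Polynomial.degree_mul, Polynomial.degree_mul]
      exact add_le_add le_rfl h'.degree_le

theorem const (c : ℝ) : RHInf (RatFunc.C c) := by
  refine ⟨by simp [IsProper], fun s _ => by simp⟩

theorem zero : RHInf 0 := by simpa using const 0
theorem one : RHInf 1 := by simpa using const 1

theorem neg (h : RHInf G) : RHInf (-G) := by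
  have := (const (-1)).mul h
  simpa using this

theorem evalC_neg (h : RHInf G) (hs : 0 ≤ s.re) : evalC (-G) s = -evalC G s := by
  have := (const (-1)).evalC_mul h hs
  rw [evalC_C] at this
  simpa using this

theorem sub (h : RHInf G) (h' : RHInf G') : RHInf (G - G') := by
  rw [sub_eq_add_neg]; exact h.add h'.neg

theorem evalC_sub (h : RHInf G) (h' : RHInf G') (hs : 0 ≤ s.re) :
    evalC (G - G') s = evalC G s - evalC G' s := by
  rw [sub_eq_add_neg, h.evalC_add h'.neg hs, h'.evalC_neg hs, sub_eq_add_neg]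

theorem differentiableAt (h : RHInf G) (hs : 0 ≤ s.re) : DifferentiableAt ℂ (evalC G) s :=
  (Polynomial.differentiableAt_aeval _).div (Polynomial.differentiableAt_aeval _) (h.2 s hs)

theorem differentiableOn (h : RHInf G) : DifferentiableOn ℂ (evalC G) {s | 0 ≤ s.re} :=
  fun _ hs => (h.differentiableAt hs).differentiableWithinAt

theorem continuous_axis (h : RHInf G) : Continuous fun ω : ℝ => evalC G (ω * Complex.I) := by
  refine continuous_iff_continuousAt.2 fun ω => ?_
  have h1 : ContinuousAt (evalC G) (ω * Complex.I) := (h.differentiableAt (by simp)).continuousAt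
  exact ContinuousAt.comp (f := fun ω : ℝ => (ω : ℂ) * Complex.I) h1 (by fun_prop)

/-- Properness bounds the function outside a large disc; compactness of the half-disc does the rest.
-/
theorem exists_bound (h : RHInf G) : ∃ C : ℝ, 0 < C ∧ ∀ s : ℂ, 0 ≤ s.re → ‖evalC G s‖ ≤ C := by
  have hO := Polynomial.isBigO_cobounded_of_degree_le
    (P := G.num.map (algebraMap ℝ ℂ)) (Q := G.denom.map (algebraMap ℝ ℂ))
    (by simpa using h.degree_le)
  obtain ⟨c, hc⟩ := hO.bound
  obtain ⟨r, hr⟩ := (Filter.hasBasis_cobounded_norm (E := ℂ)).eventually_iff.1 hc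
  have hK : IsCompact (Metric.closedBall (0 : ℂ) r ∩ {s | 0 ≤ s.re}) :=
    (isCompact_closedBall 0 r).inter_right (isClosed_le continuous_const Complex.continuous_re)
  obtain ⟨c', hc'⟩ := hK.exists_bound_of_continuousOn
    (f := evalC G) (h.differentiableOn.continuousOn.mono Set.inter_subset_right)
  refine ⟨max (max c c') 1, by positivity, fun s hs => ?_⟩
  rcases le_total ‖s‖ r with hsr | hsr
  · exact (hc' s ⟨by simpa using hsr, hs⟩).trans ((le_max_right _ _).trans (le_max_left _ _))
  · have h1 := hr.2 hsr
    simp only [Polynomial.eval_map_algebraMap] at h1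
    rw [evalC_eq, norm_div, div_le_iff₀ (norm_pos_iff.2 (h.2 s hs))]
    exact h1.trans (mul_le_mul_of_nonneg_right ((le_max_left _ _).trans (le_max_left _ _))
      (norm_nonneg _))

end RHInf

/-! ### Conjugation symmetry and strictly proper stable functions -/

theorem aeval_conj (p : Polynomial ℝ) (s : ℂ) :
    Polynomial.aeval (conj s) p = conj (Polynomial.aeval s p) := by
  have := Polynomial.aeval_algHom_apply Complex.conjAe.toAlgHom s p
  simpa using this

theorem evalC_conj (G : RatFunc ℝ) (s : ℂ) : evalC G (conj s) = conj (evalC G s) := by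
  simp [evalC_eq, aeval_conj]

theorem evalC_zero_eq (G : RatFunc ℝ) : evalC G 0 = evalZero G := by
  simp [evalC, evalZero, RatFunc.eval, Polynomial.eval₂_at_zero]

theorem X_add_one_eq : (RatFunc.X + 1 : RatFunc ℝ) = ρ (Polynomial.X + 1) := by simp

theorem aeval_X_add_one_ne {s : ℂ} (hs : 0 ≤ s.re) :
    Polynomial.aeval s (Polynomial.X + 1 : Polynomial ℝ) ≠ 0 := by
  intro h
  have := congrArg Complex.re h
  simp at this
  linarith

theorem add_one_ne {s : ℂ} (hs : 0 ≤ s.re) : s + 1 ≠ 0 := by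
  simpa using aeval_X_add_one_ne hs

theorem X_add_one_ne_zero : (RatFunc.X + 1 : RatFunc ℝ) ≠ 0 := by
  rw [X_add_one_eq]
  exact (map_ne_zero_iff _ (RatFunc.algebraMap_injective ℝ)).2
    (by simpa using Polynomial.X_add_C_ne_zero (1 : ℝ))

theorem rhInf_inv_X_add_one : RHInf ((RatFunc.X + 1)⁻¹) := by
  have := rhInf_div (p := 1) (q := Polynomial.X + 1) (fun s hs => aeval_X_add_one_ne hs)
    (by rw [show (Polynomial.X + 1 : Polynomial ℝ) = Polynomial.X + Polynomial.C 1 by simp,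
      Polynomial.degree_X_add_C]; simp)
  rwa [map_one, ← X_add_one_eq, one_div] at this

theorem evalC_inv_X_add_one {s : ℂ} (hs : 0 ≤ s.re) : evalC ((RatFunc.X + 1)⁻¹) s = (s + 1)⁻¹ := by
  have := evalC_div_of_ne_zero 1 (Polynomial.X + 1) (aeval_X_add_one_ne hs)
  rw [map_one, ← X_add_one_eq, one_div] at this
  simpa using this

theorem rhInf_X_div_X_add_one : RHInf (RatFunc.X / (RatFunc.X + 1)) := by
  have := RHInf.one.sub rhInf_inv_X_add_one
  convert this using 1
  field_simp [X_add_one_ne_zero]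
  ring

theorem evalC_X_div_X_add_one {s : ℂ} (hs : 0 ≤ s.re) :
    evalC (RatFunc.X / (RatFunc.X + 1)) s = s / (s + 1) := by
  have := evalC_div_of_ne_zero Polynomial.X (Polynomial.X + 1) (aeval_X_add_one_ne hs)
  rw [← X_add_one_eq] at this
  simpa using this

/-- Stable strictly proper rational functions. -/
def RHTwo (G : RatFunc ℝ) : Prop := RHInf (G * (RatFunc.X + 1))

namespace RHTwo

variable {G G' : RatFunc ℝ} {s : ℂ}

theorem rhInf (h : RHTwo G) : RHInf G := by
  have := RHInf.mul h rhInf_inv_X_add_one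
  rwa [mul_assoc, mul_inv_cancel₀ X_add_one_ne_zero, mul_one] at this

theorem evalC_eq (h : RHTwo G) (hs : 0 ≤ s.re) :
    evalC G s = evalC (G * (RatFunc.X + 1)) s / (s + 1) := by
  have := RHInf.evalC_mul h rhInf_inv_X_add_one hs
  rwa [mul_assoc, mul_inv_cancel₀ X_add_one_ne_zero, mul_one, evalC_inv_X_add_one hs,
    ← div_eq_mul_inv] at this

theorem add (h : RHTwo G) (h' : RHTwo G') : RHTwo (G + G') := by
  have := RHInf.add h h'
  rwa [← add_mul] at this

theorem neg (h : RHTwo G) : RHTwo (-G) := by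
  have := RHInf.neg h
  rwa [← neg_mul] at this

theorem sub (h : RHTwo G) (h' : RHTwo G') : RHTwo (G - G') := by
  have := RHInf.sub h h'
  rwa [← sub_mul] at this

theorem mul_left (h : RHInf G) (h' : RHTwo G') : RHTwo (G * G') := by
  have := RHInf.mul h h'
  rwa [← mul_assoc] at this

theorem mul_right (h : RHTwo G) (h' : RHInf G') : RHTwo (G * G') := by
  rw [mul_comm]; exact mul_left h' h

theorem zero : RHTwo 0 := by simpa [RHTwo] using RHInf.zero

theorem exists_bound (h : RHTwo G) :
    ∃ C : ℝ, 0 < C ∧ ∀ s : ℂ, 0 ≤ s.re → ‖evalC G s‖ ≤ C / ‖s + 1‖ := by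
  obtain ⟨C, hC, hb⟩ := RHInf.exists_bound h
  refine ⟨C, hC, fun s hs => ?_⟩
  rw [h.evalC_eq hs, norm_div]
  exact div_le_div_of_nonneg_right (hb s hs) (norm_nonneg _)

end RHTwo

theorem rhTwo_inv_X_add_one : RHTwo ((RatFunc.X + 1)⁻¹) := by
  rw [RHTwo, inv_mul_cancel₀ X_add_one_ne_zero]; exact RHInf.one

theorem norm_axis_add_one_sq (ω : ℝ) : ‖(ω : ℂ) * Complex.I + 1‖ ^ 2 = 1 + ω ^ 2 := by
  rw [← Complex.normSq_eq_norm_sq, Complex.normSq_apply]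
  simp; ring

/-- A stable function vanishing at the origin is divisible by `s`. -/
theorem rhTwo_div_X {G : RatFunc ℝ} (h : RHInf G) (h0 : evalC G 0 = 0) : RHTwo (G / RatFunc.X) := by
  have hd := h.2 0 (by simp)
  have hn : Polynomial.aeval (0 : ℂ) G.num = 0 := by
    rw [evalC_eq, div_eq_zero_iff] at h0
    exact h0.resolve_right hd
  have hX : Polynomial.X ∣ G.num := by
    rw [Polynomial.X_dvd_iff, Polynomial.coeff_zero_eq_eval_zero]
    have h1 : Polynomial.aeval ((0 : ℝ) : ℂ) G.num = ((G.num.eval 0 : ℝ) : ℂ) := by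
      rw [← Complex.coe_algebraMap, Polynomial.aeval_algebraMap_apply]; simp
    rw [Complex.ofReal_zero, hn] at h1
    exact_mod_cast h1.symm
  obtain ⟨p, hp⟩ := hX
  have e : G / RatFunc.X * (RatFunc.X + 1) = ρ (p * (Polynomial.X + 1)) / ρ G.denom := by
    have hX0 := RatFunc.X_ne_zero (K := ℝ)
    have h1 : ρ G.denom ≠ 0 := by simpa using G.denom_ne_zero
    conv_lhs => rw [← RatFunc.num_div_denom G, hp]
    rw [map_mul, map_mul, RatFunc.algebraMap_X, ← X_add_one_eq]
    field_simp
  rw [RHTwo, e]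
  refine rhInf_div h.2 (le_trans ?_ h.degree_le)
  rw [hp, Polynomial.degree_mul, Polynomial.degree_mul, Polynomial.degree_X, add_comm,
    show (Polynomial.X + 1 : Polynomial ℝ) = Polynomial.X + Polynomial.C 1 by simp,
    Polynomial.degree_X_add_C]

theorem RHTwo.rhInf_mul_X {D : RatFunc ℝ} (h : RHTwo D) : RHInf (D * RatFunc.X) := by
  have := RHInf.mul h rhInf_X_div_X_add_one
  rwa [mul_assoc, mul_div_cancel₀ _ X_add_one_ne_zero] at this

theorem RHTwo.evalC_mul_X {D : RatFunc ℝ} (h : RHTwo D) {s : ℂ} (hs : 0 ≤ s.re) :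
    evalC (D * RatFunc.X) s = evalC D s * s := by
  have := RHInf.evalC_mul h rhInf_X_div_X_add_one hs
  rw [mul_assoc, mul_div_cancel₀ _ X_add_one_ne_zero, evalC_X_div_X_add_one hs] at this
  rw [this, h.evalC_eq hs]
  ring

theorem RHTwo.evalC_div_X {G : RatFunc ℝ} (h : RHTwo (G / RatFunc.X)) {s : ℂ} (hs : 0 ≤ s.re) :
    evalC G s = evalC (G / RatFunc.X) s * s := by
  rw [← h.evalC_mul_X hs, div_mul_cancel₀ _ RatFunc.X_ne_zero]

theorem RHTwo.rhInf_of_div_X {G : RatFunc ℝ} (h : RHTwo (G / RatFunc.X)) : RHInf G := by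
  have := h.rhInf_mul_X
  rwa [div_mul_cancel₀ _ RatFunc.X_ne_zero] at this

/-! ### Cauchy's theorem on the imaginary axis and the `H₂` norm -/

theorem integrable_const_div_one_add_sq (C : ℝ) : Integrable fun ω : ℝ => C / (1 + ω ^ 2) := by
  simpa [div_eq_mul_inv] using integrable_inv_one_add_sq.const_mul C

theorem norm_axis_le {f : ℂ → ℂ} {C : ℝ}
    (hb : ∀ s : ℂ, 0 ≤ s.re → ‖f s‖ ≤ C / ‖s + 1‖ ^ 2) (ω : ℝ) :
    ‖f (ω * Complex.I)‖ ≤ C / (1 + ω ^ 2) := by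
  have := hb (ω * Complex.I) (by simp)
  rwa [norm_axis_add_one_sq] at this

theorem continuous_axis_of_differentiableOn {f : ℂ → ℂ}
    (hf : DifferentiableOn ℂ f {s | 0 ≤ s.re}) : Continuous fun ω : ℝ => f (ω * Complex.I) := by
  rw [← continuousOn_univ]
  exact hf.continuousOn.comp (Continuous.continuousOn (by fun_prop)) (fun ω _ => by simp)

theorem integrable_axis {f : ℂ → ℂ} {C : ℝ} (hf : DifferentiableOn ℂ f {s | 0 ≤ s.re})
    (hb : ∀ s : ℂ, 0 ≤ s.re → ‖f s‖ ≤ C / ‖s + 1‖ ^ 2) :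
    Integrable fun ω : ℝ => f (ω * Complex.I) :=
  (integrable_const_div_one_add_sq C).mono'
    (continuous_axis_of_differentiableOn hf).aestronglyMeasurable
    (Eventually.of_forall (norm_axis_le hb))

/-- Cauchy's theorem for the right half-plane. -/
theorem integral_axis_eq_zero {f : ℂ → ℂ} {C : ℝ} (hf : DifferentiableOn ℂ f {s | 0 ≤ s.re})
    (hb : ∀ s : ℂ, 0 ≤ s.re → ‖f s‖ ≤ C / ‖s + 1‖ ^ 2) :
    ∫ ω : ℝ, f (ω * Complex.I) = 0 := by
  have hC : 0 ≤ C := by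
    have := (norm_nonneg _).trans (hb 0 (by simp))
    simpa using this
  have hlim := intervalIntegral_tendsto_integral (integrable_axis hf hb)
    (tendsto_neg_atTop_atBot.comp tendsto_id) tendsto_id (a := fun R : ℝ => -R)
  refine tendsto_nhds_unique hlim ?_
  -- The other three sides of the rectangle with corners `-iR` and `R + iR` have total length `4R`,
  -- and `|f| ≤ C / R²` on each of them.
  refine squeeze_zero_norm' (a := fun R : ℝ => 4 * C / R) ?_
    (tendsto_const_nhds.div_atTop tendsto_id)
  filter_upwards [eventually_gt_atTop 0] with R hR
  have hrect := Complex.integral_boundary_rect_eq_zero_of_differentiableOn f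
    (-(R * Complex.I)) (R + R * Complex.I) (hf.mono (by
      intro s hs
      have := hs.1
      simp [Set.uIcc_of_le hR.le] at this
      exact this.1))
  have hbd : ∀ s : ℂ, 0 ≤ s.re → R ≤ ‖s + 1‖ → ‖f s‖ ≤ C / R ^ 2 := fun s hs h =>
    (hb s hs).trans (div_le_div_of_nonneg_left hC (by positivity)
      (pow_le_pow_left₀ hR.le h 2))
  have him : ∀ x y : ℝ, |y| ≤ ‖(x + y * Complex.I : ℂ) + 1‖ := fun x y => by
    simpa using Complex.abs_im_le_norm ((x + y * Complex.I : ℂ) + 1)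
  have hre : ∀ y : ℝ, R ≤ ‖(R + y * Complex.I : ℂ) + 1‖ := fun y => by
    have := (le_abs_self _).trans (Complex.abs_re_le_norm ((R + y * Complex.I : ℂ) + 1))
    simp at this
    linarith
  have b1 := intervalIntegral.norm_integral_le_of_norm_le_const (a := (0 : ℝ)) (b := R)
    (f := fun x : ℝ => f (x + (-R : ℝ) * Complex.I)) (C := C / R ^ 2) (fun x hx => by
      rw [Set.uIoc_of_le hR.le] at hx
      exact hbd _ (by simpa using hx.1.le) ((le_abs_self R).trans (by simpa using him x (-R))))
  have b2 := intervalIntegral.norm_integral_le_of_norm_le_const (a := (0 : ℝ)) (b := R)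
    (f := fun x : ℝ => f (x + R * Complex.I)) (C := C / R ^ 2) (fun x hx => by
      rw [Set.uIoc_of_le hR.le] at hx
      exact hbd _ (by simpa using hx.1.le) ((le_abs_self R).trans (by simpa using him x R)))
  have b3 := intervalIntegral.norm_integral_le_of_norm_le_const (a := -R) (b := R)
    (f := fun y : ℝ => f (R + y * Complex.I)) (C := C / R ^ 2) (fun y _ =>
      hbd _ (by simpa using hR.le) (hre y))
  have ea : |R - 0| = R := by rw [sub_zero, abs_of_pos hR]
  have eb : |R - -R| = 2 * R := by rw [abs_of_pos (by linarith)]; ring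
  rw [ea] at b1 b2
  rw [eb] at b3
  simp only [Complex.neg_re, Complex.mul_re, Complex.ofReal_re, Complex.I_re, mul_zero,
    Complex.ofReal_im, Complex.I_im, mul_one, sub_self, neg_zero, Complex.add_re, add_zero,
    Complex.neg_im, Complex.mul_im, zero_add, Complex.add_im, Complex.ofReal_zero, smul_eq_mul]
    at hrect
  set I1 := ∫ x in (0 : ℝ)..R, f (x + (-R : ℝ) * Complex.I)
  set I2 := ∫ x in (0 : ℝ)..R, f (x + R * Complex.I)
  set I3 := ∫ y in (-R)..R, f (R + y * Complex.I)
  change ‖∫ y in (-R)..R, f (y * Complex.I)‖ ≤ _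
  set I4 := ∫ y in (-R)..R, f (y * Complex.I)
  have e4 : Complex.I * I4 = I1 - I2 + Complex.I * I3 := by linear_combination -hrect
  have n4 : ‖I4‖ = ‖I1 - I2 + Complex.I * I3‖ := by rw [← e4]; simp
  have n5 : ‖I1 - I2 + Complex.I * I3‖ ≤ ‖I1‖ + ‖I2‖ + ‖I3‖ := by
    refine (norm_add_le _ _).trans (add_le_add (norm_sub_le _ _) ?_)
    simp
  rw [n4]
  refine n5.trans ((add_le_add (add_le_add b1 b2) b3).trans_eq ?_)
  field_simp
  ring

theorem RHTwo.exists_mul_bound {G G' : RatFunc ℝ} (h : RHTwo G) (h' : RHTwo G') :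
    ∃ C, ∀ s : ℂ, 0 ≤ s.re → ‖evalC G s * evalC G' s‖ ≤ C / ‖s + 1‖ ^ 2 := by
  obtain ⟨C, hC, hb⟩ := h.exists_bound
  obtain ⟨C', hC', hb'⟩ := h'.exists_bound
  refine ⟨C * C', fun s hs => ?_⟩
  rw [norm_mul, pow_two, ← div_mul_div_comm]
  exact mul_le_mul (hb s hs) (hb' s hs) (norm_nonneg _) (by positivity)

theorem RHTwo.integrable_mul {G G' : RatFunc ℝ} (h : RHTwo G) (h' : RHTwo G') :
    Integrable fun ω : ℝ => evalC G (ω * Complex.I) * evalC G' (ω * Complex.I) := by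
  obtain ⟨C, hb⟩ := h.exists_mul_bound h'
  exact integrable_axis (h.rhInf.differentiableOn.mul h'.rhInf.differentiableOn) hb

/-- The source of every orthogonality below: on the axis one factor will be the conjugate of an
antistable function, so this says that `H₂` is orthogonal to its reflection. -/
theorem RHTwo.integral_mul {G G' : RatFunc ℝ} (h : RHTwo G) (h' : RHTwo G') :
    ∫ ω : ℝ, evalC G (ω * Complex.I) * evalC G' (ω * Complex.I) = 0 := by
  obtain ⟨C, hb⟩ := h.exists_mul_bound h'
  exact integral_axis_eq_zero (h.rhInf.differentiableOn.mul h'.rhInf.differentiableOn) hb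

theorem RHTwo.integrable_norm_sq {G : RatFunc ℝ} (h : RHTwo G) :
    Integrable fun ω : ℝ => ‖evalC G (ω * Complex.I)‖ ^ 2 := by
  simpa [pow_two] using (h.integrable_mul h).norm

/-- The squared `H₂` norm, computed on the imaginary axis. -/
noncomputable def normSqTwo (G : RatFunc ℝ) : ℝ :=
  (2 * Real.pi)⁻¹ * ∫ ω : ℝ, ‖evalC G (ω * Complex.I)‖ ^ 2

theorem normSqTwo_nonneg (G : RatFunc ℝ) : 0 ≤ normSqTwo G :=
  mul_nonneg (by positivity) (integral_nonneg fun _ => by positivity)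

theorem normSqTwo_neg (G : RatFunc ℝ) (h : RHInf G) : normSqTwo (-G) = normSqTwo G := by
  unfold normSqTwo
  congr 2
  ext ω
  rw [h.evalC_neg (by simp), norm_neg]

/-- If `g` is stable with `g(0) = 0` and `g(s) = s q(s)`, then
`∫ Re g(jω) / ω² dω = π q(0)`. -/
theorem integral_re_div_sq {g : RatFunc ℝ} (hg : RHInf g) (h0 : evalC g 0 = 0) :
    Integrable (fun ω : ℝ => (evalC g (ω * Complex.I)).re / ω ^ 2) ∧
    ∫ ω : ℝ, (evalC g (ω * Complex.I)).re / ω ^ 2 = Real.pi * (evalC (g / RatFunc.X) 0).re := by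
  have hq : RHTwo (g / RatFunc.X) := rhTwo_div_X hg h0
  set q := g / RatFunc.X with hqdef
  have hgq : ∀ s : ℂ, 0 ≤ s.re → evalC g s = evalC q s * s := fun s hs => hq.evalC_div_X hs
  have hq0 : evalC q 0 = evalZero q := evalC_zero_eq q
  set c := evalZero q
  -- Subtracting `c / (s + 1)` removes the value of `q` at `0`, so `k / s` has no pole on the axis
  -- and integrates to zero by Cauchy. The subtracted term contributes `c / (1 + ω²)` to the
  -- integrand, hence `π c`.
  have hk : RHTwo (q - RatFunc.C c * (RatFunc.X + 1)⁻¹) :=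
    hq.sub (RHTwo.mul_left (RHInf.const c) rhTwo_inv_X_add_one)
  set k := q - RatFunc.C c * (RatFunc.X + 1)⁻¹ with hkdef
  have hkev : ∀ s : ℂ, 0 ≤ s.re → evalC k s = evalC q s - c * (s + 1)⁻¹ := fun s hs => by
    rw [hkdef, hq.rhInf.evalC_sub ((RHInf.const c).mul rhInf_inv_X_add_one) hs,
      (RHInf.const c).evalC_mul rhInf_inv_X_add_one hs, evalC_inv_X_add_one hs, evalC_C]
  have hk0 : evalC k 0 = 0 := by rw [hkev 0 (by simp), hq0]; simp
  have hk0' : evalC (k * (RatFunc.X + 1)) 0 = 0 := by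
    have := hk.evalC_eq (s := 0) (by simp)
    rw [hk0] at this
    simpa using this.symm
  have hh : RHTwo (k * (RatFunc.X + 1) / RatFunc.X) := rhTwo_div_X hk hk0'
  have hint := hh.integrable_mul rhTwo_inv_X_add_one
  have hzero := hh.integral_mul rhTwo_inv_X_add_one
  have hpt : ∀ ω : ℝ, ω ≠ 0 → (evalC g (ω * Complex.I)).re / ω ^ 2 =
      -(evalC (k * (RatFunc.X + 1) / RatFunc.X) (ω * Complex.I) *
        evalC (RatFunc.X + 1)⁻¹ (ω * Complex.I)).re + c / (1 + ω ^ 2) := fun ω hω => by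
    have hs : 0 ≤ ((ω : ℂ) * Complex.I).re := by simp
    have hne := add_one_ne hs
    have e1 := hh.evalC_div_X hs
    have e2 := hk.evalC_eq hs
    rw [hkev _ hs, e1] at e2
    rw [evalC_inv_X_add_one hs, hgq _ hs]
    set H := evalC (k * (RatFunc.X + 1) / RatFunc.X) (ω * Complex.I)
    set q' := evalC q (ω * Complex.I)
    have hω' : (ω : ℂ) ≠ 0 := by exact_mod_cast hω
    have e3 : H * ((ω : ℂ) * Complex.I + 1)⁻¹ =
        (q' - c * ((ω : ℂ) * Complex.I + 1)⁻¹) * (-(Complex.I * (ω : ℂ)⁻¹)) := by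
      rw [e2]; field_simp; simp
    have e4 : ((ω : ℂ) * Complex.I + 1)⁻¹ = (1 - ω * Complex.I) * ((1 + ω ^ 2 : ℝ) : ℂ)⁻¹ := by
      have h2 : ((1 + ω ^ 2 : ℝ) : ℂ) ≠ 0 := by
        have : (1 + ω ^ 2 : ℝ) ≠ 0 := by positivity
        exact_mod_cast this
      field_simp
      push_cast
      linear_combination (ω : ℂ) ^ 2 * Complex.I_sq
    rw [e3, e4, ← Complex.ofReal_inv, ← Complex.ofReal_inv]
    have h1 : (1 + ω ^ 2 : ℝ) ≠ 0 := by positivity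
    obtain ⟨d, hd⟩ : ∃ d : ℝ, d = (1 + ω ^ 2)⁻¹ := ⟨_, rfl⟩
    obtain ⟨b, hb⟩ : ∃ b : ℝ, b = ω⁻¹ := ⟨_, rfl⟩
    have hb1 : b * ω = 1 := by rw [hb]; field_simp
    rw [div_eq_mul_inv, div_eq_mul_inv, ← inv_pow, ← hd, ← hb]
    simp only [Complex.mul_re, Complex.mul_im, Complex.sub_re, Complex.sub_im, Complex.ofReal_re,
      Complex.ofReal_im, Complex.I_re, Complex.I_im, Complex.neg_re, Complex.neg_im,
      Complex.one_re, Complex.one_im]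
    linear_combination (-q'.im * b + c * d) * hb1
  have hae : (fun ω : ℝ => (evalC g (ω * Complex.I)).re / ω ^ 2) =ᵐ[volume] fun ω : ℝ =>
      -(evalC (k * (RatFunc.X + 1) / RatFunc.X) (ω * Complex.I) *
        evalC (RatFunc.X + 1)⁻¹ (ω * Complex.I)).re + c / (1 + ω ^ 2) := by
    filter_upwards [compl_mem_ae_iff.2 (measure_singleton (0 : ℝ))] with ω hω
    exact hpt ω (by simpa using hω)
  have hI1 : Integrable fun ω : ℝ =>
      -(evalC (k * (RatFunc.X + 1) / RatFunc.X) (ω * Complex.I) *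
        evalC (RatFunc.X + 1)⁻¹ (ω * Complex.I)).re := hint.re.neg
  have hI2 := integrable_const_div_one_add_sq c
  have hre : ∫ ω : ℝ, (evalC (k * (RatFunc.X + 1) / RatFunc.X) (ω * Complex.I) *
        evalC (RatFunc.X + 1)⁻¹ (ω * Complex.I)).re = 0 := by
    have := integral_re hint
    simp only [RCLike.re_eq_complex_re] at this
    rw [this, hzero, Complex.zero_re]
  refine ⟨(hI1.add hI2).congr hae.symm, ?_⟩
  rw [integral_congr_ae hae, integral_add hI1 hI2, integral_neg, hre, hq0, Complex.ofReal_re]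
  simp only [div_eq_mul_inv]
  rw [integral_const_mul, integral_univ_inv_one_add_sq]
  ring

/-! ### Integrals of Szegő kernels -/

theorem exists_bound_inv_add {p : ℂ} (hp : 0 < p.re) :
    ∃ C, 0 < C ∧ ∀ s : ℂ, 0 ≤ s.re → ‖(s + p)⁻¹‖ ≤ C / ‖s + 1‖ := by
  refine ⟨1 + ‖1 - p‖ / p.re, by positivity, fun s hs => ?_⟩
  have hsp : p.re ≤ ‖s + p‖ := by
    have := (le_abs_self _).trans (Complex.abs_re_le_norm (s + p))
    simp at this; linarith
  have h1 : 0 < ‖s + 1‖ := norm_pos_iff.2 (add_one_ne hs)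
  have h2 : 0 < ‖s + p‖ := hp.trans_le hsp
  rw [norm_inv, inv_le_iff_one_le_mul₀' h2, mul_div_assoc', one_le_div h1]
  have h3 : ‖s + 1‖ ≤ ‖s + p‖ + ‖1 - p‖ := by
    have := norm_add_le (s + p) (1 - p)
    rwa [show s + p + (1 - p) = s + 1 by ring] at this
  have h4 : ‖1 - p‖ ≤ ‖s + p‖ * (‖1 - p‖ / p.re) := by
    rw [mul_div_assoc', le_div_iff₀ hp, mul_comm]
    exact mul_le_mul_of_nonneg_right hsp (norm_nonneg _)
  linarith

theorem add_ne_zero_of_re {s p : ℂ} (hs : 0 ≤ s.re) (hp : 0 < p.re) : s + p ≠ 0 := fun h => by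
  have := congrArg Complex.re h
  simp at this; linarith

/-- A single simple fraction is not absolutely integrable on the axis; subtracting the reference
fraction `1 / (s + 1)` gives quadratic decay, so Cauchy's theorem applies. -/
theorem integral_inv_mul_inv {p : ℂ} (hp : 0 < p.re) :
    Integrable (fun ω : ℝ => ((ω : ℂ) * Complex.I + p)⁻¹ - ((ω : ℂ) * Complex.I + 1)⁻¹) ∧
    ∫ ω : ℝ, (((ω : ℂ) * Complex.I + p)⁻¹ - ((ω : ℂ) * Complex.I + 1)⁻¹) = 0 := by
  obtain ⟨C, hC, hb⟩ := exists_bound_inv_add hp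
  have hd : DifferentiableOn ℂ (fun s : ℂ => (s + p)⁻¹ - (s + 1)⁻¹) {s | 0 ≤ s.re} := by
    intro s hs
    have h1 := add_ne_zero_of_re hs hp
    have h2 := add_one_ne hs
    exact (((differentiableAt_id.add_const p).inv h1).sub
      ((differentiableAt_id.add_const 1).inv h2)).differentiableWithinAt
  have hbd : ∀ s : ℂ, 0 ≤ s.re → ‖(s + p)⁻¹ - (s + 1)⁻¹‖ ≤ (‖1 - p‖ * C) / ‖s + 1‖ ^ 2 := by
    intro s hs
    have h1 := add_ne_zero_of_re hs hp
    have h2 := add_one_ne hs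
    rw [show (s + p)⁻¹ - (s + 1)⁻¹ = (1 - p) * (s + p)⁻¹ * (s + 1)⁻¹ by field_simp; ring,
      norm_mul, norm_mul, norm_inv (s + 1), mul_assoc, mul_div_assoc]
    refine mul_le_mul_of_nonneg_left ?_ (norm_nonneg _)
    have := mul_le_mul_of_nonneg_right (hb s hs) (by positivity : 0 ≤ ‖s + 1‖⁻¹)
    refine this.trans_eq ?_
    ring
  exact ⟨integrable_axis hd hbd, integral_axis_eq_zero hd hbd⟩

/-- The Gram matrix of the Szegő kernels of the half-plane. -/
theorem integral_szego {p q : ℂ} (hp : 0 < p.re) (hq : 0 < q.re) :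
    Integrable (fun ω : ℝ => ((ω : ℂ) * Complex.I + p)⁻¹ * (-(ω * Complex.I) + q)⁻¹) ∧
    ∫ ω : ℝ, ((ω : ℂ) * Complex.I + p)⁻¹ * (-(ω * Complex.I) + q)⁻¹ = 2 * Real.pi / (p + q) := by
  have h1 := integral_inv_mul_inv hp
  have h2 := integral_inv_mul_inv hq
  have h2' := h2.1.comp_neg
  have h2'' := h2.2
  rw [← integral_neg_eq_self] at h2''
  have hpq : p + q ≠ 0 := add_ne_zero_of_re hp.le hq
  -- Partial fractions with both terms renormalized by `1 / (s + 1)` and `1 / (-s + 1)`. The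
  -- compensating sum is `2 / (1 + ω²)`, and it alone carries the integral, `2π`.
  have e : (fun ω : ℝ => ((ω : ℂ) * Complex.I + p)⁻¹ * (-(ω * Complex.I) + q)⁻¹) = fun ω : ℝ =>
      (p + q)⁻¹ * ((((ω : ℂ) * Complex.I + p)⁻¹ - ((ω : ℂ) * Complex.I + 1)⁻¹) +
        ((((-ω : ℝ) : ℂ) * Complex.I + q)⁻¹ - (((-ω : ℝ) : ℂ) * Complex.I + 1)⁻¹) +
        ((2 / (1 + ω ^ 2) : ℝ) : ℂ)) := by
    ext ω
    have a1 : (ω : ℂ) * Complex.I + p ≠ 0 := add_ne_zero_of_re (by simp) hp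
    have a2 : -((ω : ℂ) * Complex.I) + q ≠ 0 := add_ne_zero_of_re (by simp) hq
    have a3 : (ω : ℂ) * Complex.I + 1 ≠ 0 := add_one_ne (by simp)
    have a4 : -((ω : ℂ) * Complex.I) + 1 ≠ 0 := add_one_ne (by simp)
    have a5 : ((2 / (1 + ω ^ 2) : ℝ) : ℂ) =
        ((ω : ℂ) * Complex.I + 1)⁻¹ + (-((ω : ℂ) * Complex.I) + 1)⁻¹ := by
      have h2 : (1 + (ω : ℂ) ^ 2) ≠ 0 := by
        have : (1 + ω ^ 2 : ℝ) ≠ 0 := by positivity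
        exact_mod_cast this
      push_cast
      rw [inv_add_inv a3 a4, div_eq_div_iff h2 (mul_ne_zero a3 a4)]
      linear_combination -2 * (ω : ℂ) ^ 2 * Complex.I_sq
    rw [a5, Complex.ofReal_neg, neg_mul]
    rw [show ((ω : ℂ) * Complex.I + p)⁻¹ - ((ω : ℂ) * Complex.I + 1)⁻¹ +
      ((-((ω : ℂ) * Complex.I) + q)⁻¹ - (-((ω : ℂ) * Complex.I) + 1)⁻¹) +
      (((ω : ℂ) * Complex.I + 1)⁻¹ + (-((ω : ℂ) * Complex.I) + 1)⁻¹) =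
      ((ω : ℂ) * Complex.I + p)⁻¹ + (-((ω : ℂ) * Complex.I) + q)⁻¹ by ring]
    rw [inv_add_inv a1 a2]
    field_simp
    ring
  have h3 : Integrable fun ω : ℝ => ((2 / (1 + ω ^ 2) : ℝ) : ℂ) :=
    (integrable_const_div_one_add_sq 2).ofReal
  have h12 : Integrable fun ω : ℝ =>
      (((ω : ℂ) * Complex.I + p)⁻¹ - ((ω : ℂ) * Complex.I + 1)⁻¹) +
        ((((-ω : ℝ) : ℂ) * Complex.I + q)⁻¹ - (((-ω : ℝ) : ℂ) * Complex.I + 1)⁻¹) := h1.1.add h2'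
  rw [e]
  refine ⟨(h12.add h3).const_mul _, ?_⟩
  rw [integral_const_mul, integral_add h12 h3, integral_add h1.1 h2', h1.2, h2'',
    integral_complex_ofReal]
  simp only [div_eq_mul_inv]
  rw [integral_const_mul, integral_univ_inv_one_add_sq]
  push_cast
  ring

/-! ### Plancherel's theorem -/

section Plancherel

open FourierTransform SchwartzMap

/-- Both functions are locally integrable and agree as distributions: the `L²` transform because it
is compatible with tempered distributions, the integral transform by Fubini against a test function.
-/
theorem fourier_toLp_ae_eq {f : ℝ → ℂ} (h1 : Integrable f) (h2 : MemLp f 2 volume) :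
    ((𝓕 (h2.toLp f) : Lp ℂ 2 (volume : Measure ℝ)) : ℝ → ℂ) =ᵐ[volume] 𝓕 f := by
  have hc : Continuous (𝓕 f) :=
    VectorFourier.fourierIntegral_continuous Real.continuous_fourierChar
      (L := innerₗ ℝ) continuous_inner h1
  refine ae_eq_of_integral_contDiff_smul_eq ((Lp.memLp _).locallyIntegrable one_le_two)
    hc.locallyIntegrable fun g hg hgc => ?_
  have hg₁ : HasCompactSupport (Complex.ofRealCLM ∘ g) := hgc.comp_left rfl
  have hg₂ : ContDiff ℝ (⊤ : ℕ∞) (Complex.ofRealCLM ∘ g) := by fun_prop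
  set φ := hg₁.toSchwartzMap hg₂ with hφ
  have hφx : ∀ x, φ x = (g x : ℂ) := fun x => rfl
  have e1 := congrArg (fun T => T φ) (Lp.fourier_toTemperedDistribution_eq (h2.toLp f))
  simp only [TemperedDistribution.fourier_apply, Lp.toTemperedDistribution_apply] at e1
  have e2 : ∫ x, (𝓕 φ) x • (h2.toLp f) x = ∫ x, (𝓕 φ) x • f x :=
    integral_congr_ae (by filter_upwards [h2.coeFn_toLp] with x hx; rw [hx])
  have e3 : ∫ x, (𝓕 φ) x • f x = ∫ x, φ x • (𝓕 f) x := by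
    simpa using! VectorFourier.integral_fourierIntegral_smul_eq_flip (L := innerₗ ℝ)
      Real.continuous_fourierChar continuous_inner φ.integrable h1
  rw [e2, e3] at e1
  simp only [hφx, Complex.coe_smul] at e1
  exact e1.symm

theorem norm_toLp_sq {α E : Type*} [MeasurableSpace α] {μ : Measure α} [NormedAddCommGroup E]
    {f : α → E} (h : MemLp f 2 μ) : ‖h.toLp f‖ ^ 2 = ∫ x, ‖f x‖ ^ 2 ∂μ := by
  rw [Lp.norm_toLp, MemLp.eLpNorm_eq_integral_rpow_norm (by simp) (by simp) h,
    ENNReal.toReal_ofReal (by positivity)]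
  simp only [ENNReal.toReal_ofNat, Real.rpow_ofNat]
  rw [← Real.rpow_natCast, ← Real.rpow_mul (integral_nonneg fun _ => by positivity)]
  simp

/-- Plancherel's theorem for integrable square integrable functions. -/
theorem integral_norm_fourier_sq {f : ℝ → ℂ} (h1 : Integrable f) (h2 : MemLp f 2 volume) :
    ∫ ξ, ‖𝓕 f ξ‖ ^ 2 = ∫ x, ‖f x‖ ^ 2 := by
  rw [← norm_toLp_sq h2, ← Lp.norm_fourier_eq]
  have h3 : ∫ ξ, ‖𝓕 f ξ‖ ^ 2 = ∫ ξ, ‖(𝓕 (h2.toLp f) : Lp ℂ 2 (volume : Measure ℝ)) ξ‖ ^ 2 :=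
    integral_congr_ae (by filter_upwards [fourier_toLp_ae_eq h1 h2] with x hx; rw [hx])
  rw [h3]
  have h4 := norm_toLp_sq (Lp.memLp (𝓕 (h2.toLp f) : Lp ℂ 2 (volume : Measure ℝ)))
  rw [Lp.toLp_coeFn] at h4
  exact h4.symm

end Plancherel

/-! ### Square integrable impulse responses have stable strictly proper transfer functions -/

section Laplace

theorem integrableOn_exp_two_mul {a : ℝ} (ha : 0 < a) :
    IntegrableOn (fun t : ℝ => Real.exp (-2 * a * t)) (Set.Ioi 0) :=
  integrableOn_exp_mul_Ioi (by linarith) 0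

theorem integral_exp_two_mul {a : ℝ} (ha : 0 < a) :
    ∫ t in Set.Ioi (0 : ℝ), Real.exp (-2 * a * t) = (2 * a)⁻¹ := by
  rw [integral_exp_mul_Ioi (by linarith) 0]
  simp [mul_comm]

/-- The inequality of arithmetic and geometric means with a free weight `c`, used in place of
Cauchy–Schwarz. -/
theorem norm_mul_exp_le (z s : ℂ) (t : ℝ) {c : ℝ} (hc : 0 < c) :
    ‖z * Complex.exp (-s * t)‖ ≤ c / 2 * ‖z‖ ^ 2 + (2 * c)⁻¹ * Real.exp (-2 * s.re * t) := by
  have h1 : ‖Complex.exp (-s * t)‖ = Real.exp (-s.re * t) := by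
    rw [Complex.norm_exp]; simp
  have h2 : Real.exp (-2 * s.re * t) = Real.exp (-s.re * t) ^ 2 := by
    rw [← Real.exp_nat_mul]; congr 1; push_cast; ring
  rw [norm_mul, h1, h2]
  set x := ‖z‖
  set y := Real.exp (-s.re * t)
  have h3 : c / 2 * x ^ 2 + (2 * c)⁻¹ * y ^ 2 - x * y = (2 * c)⁻¹ * (c * x - y) ^ 2 := by
    field_simp; ring
  have h4 : 0 ≤ (2 * c)⁻¹ * (c * x - y) ^ 2 := by positivity
  linarith

theorem integrableOn_mul_exp {g : ℝ → ℂ} (hg : MemLp g 2 volume) {s : ℂ} (hs : 0 < s.re) :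
    IntegrableOn (fun t : ℝ => g t * Complex.exp (-s * t)) (Set.Ioi 0) := by
  have h2 : Integrable fun t => ‖g t‖ ^ 2 := (memLp_two_iff_integrable_sq_norm hg.1).1 hg
  refine Integrable.mono' ((h2.const_mul (1 / 2)).integrableOn.add
    ((integrableOn_exp_two_mul hs).const_mul ((2 * 1)⁻¹))) ?_
    (Eventually.of_forall fun t => norm_mul_exp_le (g t) s t one_pos)
  exact hg.1.restrict.mul (Continuous.aestronglyMeasurable (by fun_prop))

theorem norm_laplace_le {g : ℝ → ℂ} (hg : MemLp g 2 volume) {s : ℂ} (hs : 0 < s.re) :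
    ‖∫ t in Set.Ioi (0 : ℝ), g t * Complex.exp (-s * t)‖ ≤
      (1 / 2 * (∫ t, ‖g t‖ ^ 2) + 1 / 4) / √s.re := by
  have h2 : Integrable fun t => ‖g t‖ ^ 2 := (memLp_two_iff_integrable_sq_norm hg.1).1 hg
  have hr : 0 < √s.re := Real.sqrt_pos.2 hs
  -- This weight gives both terms of the bound the same order `1 / √Re s`.
  set c := (√s.re)⁻¹ with hc
  have hc0 : 0 < c := by positivity
  have hI1 := (h2.const_mul (c / 2)).integrableOn (s := Set.Ioi (0 : ℝ))
  have hI2 := (integrableOn_exp_two_mul hs).const_mul ((2 * c)⁻¹)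
  refine (norm_integral_le_of_norm_le (hI1.add hI2)
    (Eventually.of_forall fun t => norm_mul_exp_le (g t) s t hc0)).trans ?_
  simp only [Pi.add_apply]
  rw [integral_add hI1 hI2, integral_const_mul, integral_const_mul, integral_exp_two_mul hs]
  have h3 : ∫ t in Set.Ioi (0 : ℝ), ‖g t‖ ^ 2 ≤ ∫ t, ‖g t‖ ^ 2 :=
    setIntegral_le_integral h2 (Eventually.of_forall fun _ => by positivity)
  have h4 : (2 * c)⁻¹ * (2 * s.re)⁻¹ = 1 / 4 / √s.re := by
    rw [hc]
    nth_rewrite 2 [← Real.mul_self_sqrt hs.le]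
    field_simp
    ring
  rw [h4, add_div]
  have h5 := mul_le_mul_of_nonneg_left h3 (by positivity : 0 ≤ c / 2)
  have h6 : c / 2 * (∫ t, ‖g t‖ ^ 2) = 1 / 2 * (∫ t, ‖g t‖ ^ 2) / √s.re := by rw [hc]; ring
  linarith

/-- A rational function that grows at most like `1 / √Re s` on the right half-plane is stable. -/
theorem denom_ne_zero_of_bound {G : RatFunc ℝ} {K : ℝ}
    (hb : ∀ s : ℂ, 0 < s.re → ‖evalC G s‖ ≤ K / √s.re) {s : ℂ} (hs : 0 ≤ s.re) :
    Polynomial.aeval s G.denom ≠ 0 := by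
  intro h0
  have hnum : Polynomial.aeval s G.num ≠ 0 := by
    intro h1
    obtain ⟨a, b, hab⟩ := G.isCoprime_num_denom
    have := congrArg (Polynomial.aeval s) hab
    simp [h0, h1] at this
  have hK : 0 ≤ K := by
    have := (norm_nonneg _).trans (hb 1 (by simp))
    simpa using this
  have hpath : Tendsto (fun x : ℝ => s + x) (𝓝[>] 0) (𝓝[≠] s) := by
    refine tendsto_nhdsWithin_iff.2 ⟨?_, ?_⟩
    · have : Tendsto (fun x : ℝ => s + (x : ℂ)) (𝓝 0) (𝓝 (s + ((0 : ℝ) : ℂ))) :=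
        Continuous.tendsto (by fun_prop) 0
      simpa using this.mono_left nhdsWithin_le_nhds
    · filter_upwards [self_mem_nhdsWithin] with x hx
      simpa using (ne_of_gt hx : x ≠ 0)
  have hfin : ∀ᶠ w in 𝓝[≠] s, Polynomial.aeval w G.denom ≠ 0 := by
    have hd0 : G.denom.map (algebraMap ℝ ℂ) ≠ 0 := by simpa using G.denom_ne_zero
    have hf : ((G.denom.map (algebraMap ℝ ℂ)).roots.toFinset \ {s} : Set ℂ).Finite :=
      (Finset.finite_toSet _).sdiff
    filter_upwards [mem_nhdsWithin_of_mem_nhds (hf.isClosed.isOpen_compl.mem_nhds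
      (by simp : s ∈ _)), self_mem_nhdsWithin] with w hw hws h
    exact hw ⟨by simpa [hd0, Polynomial.eval_map_algebraMap, G.denom_ne_zero] using h, hws⟩
  have hO : (fun w => Polynomial.aeval w G.denom) =O[𝓝 s] fun w => w - s := by
    have := (Polynomial.differentiableAt_aeval (𝕜 := ℂ) (x := s) G.denom).isBigO_sub
    simpa [h0] using this
  obtain ⟨D, hD⟩ := hO.bound
  -- Approach the supposed pole horizontally from the right. The denominator is `O(x)` while `G` is
  -- at most `K / √x`, so the numerator is `O(√x)` and vanishes at the pole, against coprimality.
  have hev : ∀ᶠ x : ℝ in 𝓝[>] 0,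
      ‖Polynomial.aeval (s + x) G.num‖ ≤ K * D * √x := by
    filter_upwards [hpath.eventually hfin, hpath.eventually (hD.filter_mono nhdsWithin_le_nhds),
      self_mem_nhdsWithin] with x hx1 hx2 hx3
    have hx : 0 < x := hx3
    have hre : x ≤ (s + x).re := by simp [hs]
    have h1 := hb (s + x) (hx.trans_le hre)
    rw [evalC_eq, norm_div, div_le_iff₀ (norm_pos_iff.2 hx1)] at h1
    have h2 : ‖s + x - s‖ = x := by
      rw [add_sub_cancel_left, Complex.norm_real, Real.norm_of_nonneg hx.le]
    rw [h2] at hx2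
    have hsx : 0 < √x := Real.sqrt_pos.2 hx
    have h3 : K / √(s + x).re ≤ K / √x :=
      div_le_div_of_nonneg_left hK hsx (Real.sqrt_le_sqrt hre)
    calc _ ≤ K / √(s + x).re * ‖Polynomial.aeval (s + x) G.denom‖ := h1
      _ ≤ K / √x * (D * x) := mul_le_mul h3 hx2 (norm_nonneg _) (by positivity)
      _ = K * D * √x := by
        nth_rewrite 2 [← Real.mul_self_sqrt hx.le]
        field_simp
  have hl : Tendsto (fun x : ℝ => ‖Polynomial.aeval (s + x) G.num‖) (𝓝[>] 0)
      (𝓝 ‖Polynomial.aeval s G.num‖) :=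
    ((Polynomial.continuous_aeval (A := ℂ) G.num).norm.tendsto s).comp
      (hpath.mono_right nhdsWithin_le_nhds)
  have hr : Tendsto (fun x : ℝ => K * D * √x) (𝓝[>] 0) (𝓝 0) := by
    have : Tendsto (fun x : ℝ => K * D * √x) (𝓝 0) (𝓝 (K * D * √0)) :=
      Continuous.tendsto (by fun_prop) 0
    simpa using this.mono_left nhdsWithin_le_nhds
  have := le_of_tendsto_of_tendsto hl hr hev
  exact hnum (norm_le_zero_iff.1 this)

theorem aeval_ofReal (p : Polynomial ℝ) (x : ℝ) :
    Polynomial.aeval (x : ℂ) p = ((p.eval x : ℝ) : ℂ) := by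
  rw [← Complex.coe_algebraMap, Polynomial.aeval_algebraMap_apply]; simp

/-- On the positive real axis the bound tends to zero, whereas a numerator of at least the degree of
the denominator would keep `|G|` away from zero. -/
theorem degree_lt_of_bound {G : RatFunc ℝ} {K : ℝ}
    (hb : ∀ s : ℂ, 0 < s.re → ‖evalC G s‖ ≤ K / √s.re) : G.num.degree < G.denom.degree := by
  by_contra! hdeg
  have hn0 : G.num ≠ 0 := by
    intro h
    rw [h, Polynomial.degree_zero, le_bot_iff, Polynomial.degree_eq_bot] at hdeg
    exact G.denom_ne_zero hdeg
  obtain ⟨C, hC⟩ := (Polynomial.isBigO_atTop_of_degree_le _ _ hdeg).bound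
  have hK : 0 ≤ K := by
    have := (norm_nonneg _).trans (hb 1 (by simp))
    simpa using this
  have hnr := Polynomial.eventually_atTop_not_isRoot G.num hn0
  have hdr := Polynomial.eventually_atTop_not_isRoot G.denom G.denom_ne_zero
  have hs : ∀ᶠ x : ℝ in atTop, K * C < √x := Real.tendsto_sqrt_atTop.eventually_gt_atTop _
  obtain ⟨x, h1, h2, h3, h4, h5⟩ :=
    (hC.and (hnr.and (hdr.and (hs.and (eventually_gt_atTop 0))))).exists
  have hx := hb (x : ℂ) (by simpa using h5)
  rw [evalC_eq, aeval_ofReal, aeval_ofReal, ← Complex.ofReal_div, Complex.norm_real, norm_div,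
    Complex.ofReal_re] at hx
  have hd : 0 < ‖G.denom.eval x‖ := norm_pos_iff.2 h3
  have hn : 0 < ‖G.num.eval x‖ := norm_pos_iff.2 h2
  rw [div_le_div_iff₀ hd (Real.sqrt_pos.2 h5)] at hx
  have h6 : ‖G.num.eval x‖ * √x ≤ ‖G.num.eval x‖ * (K * C) := by
    refine hx.trans ((mul_le_mul_of_nonneg_left h1 hK).trans_eq (by ring))
  exact absurd (le_of_mul_le_mul_left h6 hn) (not_le.2 h4)

theorem rhTwo_of_bound {G : RatFunc ℝ} {K : ℝ}
    (hb : ∀ s : ℂ, 0 < s.re → ‖evalC G s‖ ≤ K / √s.re) : RHTwo G := by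
  have e : G * (RatFunc.X + 1) = algebraMap (Polynomial ℝ) (RatFunc ℝ)
      (G.num * (Polynomial.X + 1)) / algebraMap (Polynomial ℝ) (RatFunc ℝ) G.denom := by
    rw [map_mul, ← X_add_one_eq, mul_div_right_comm, RatFunc.num_div_denom]
  rw [RHTwo, e]
  refine rhInf_div (fun s hs => denom_ne_zero_of_bound hb hs) ?_
  have h := degree_lt_of_bound hb
  rw [show (Polynomial.X + 1 : Polynomial ℝ) = Polynomial.X + Polynomial.C 1 by simp,
    Polynomial.degree_mul, Polynomial.degree_X_add_C]
  rcases eq_or_ne G.num 0 with h0 | h0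
  · simp [h0]
  · rw [Polynomial.degree_eq_natDegree h0, Polynomial.degree_eq_natDegree G.denom_ne_zero] at *
    norm_cast at *

theorem RHTwo.degree_lt {G : RatFunc ℝ} (h : RHTwo G) : G.num.degree < G.denom.degree := by
  obtain ⟨C, hC, hb⟩ := h.exists_bound
  refine degree_lt_of_bound (K := C) fun s hs => (hb s hs.le).trans ?_
  refine div_le_div_of_nonneg_left hC.le (Real.sqrt_pos.2 hs) ?_
  have h1 : s.re + 1 ≤ ‖s + 1‖ := by
    have := (le_abs_self _).trans (Complex.abs_re_le_norm (s + 1))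
    simpa using this
  refine le_trans ?_ h1
  rw [Real.sqrt_le_left (by linarith)]
  nlinarith

variable {G : RatFunc ℝ} {g : ℝ → ℝ}

theorem IsImpulseResponse.memLp_ofReal (h : IsImpulseResponse G g) :
    MemLp (fun t => (g t : ℂ)) 2 volume := h.memLp.ofReal

/-- This is why finite power forces stability and strict properness. -/
theorem IsImpulseResponse.rhTwo (h : IsImpulseResponse G g) : RHTwo G :=
  rhTwo_of_bound fun s hs => by
    rw [← h.laplace s hs]
    exact norm_laplace_le h.memLp_ofReal hs

/-- The exponentially damped impulse response. -/
noncomputable def damped (g : ℝ → ℝ) (a : ℝ) (t : ℝ) : ℂ := (g t : ℂ) * Complex.exp (-(a : ℂ) * t)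

theorem norm_damped (g : ℝ → ℝ) (a t : ℝ) : ‖damped g a t‖ = |g t| * Real.exp (-a * t) := by
  rw [damped, norm_mul, Complex.norm_real, Complex.norm_exp]
  simp

theorem norm_damped_le (h : IsImpulseResponse G g) {a : ℝ} (ha : 0 < a) (t : ℝ) :
    ‖damped g a t‖ ≤ ‖g t‖ := by
  rw [norm_damped, Real.norm_eq_abs]
  rcases lt_or_ge t 0 with ht | ht
  · simp [h.causal t ht]
  · refine mul_le_of_le_one_right (abs_nonneg _) (Real.exp_le_one_iff.2 ?_)
    nlinarith

theorem aestronglyMeasurable_damped (h : IsImpulseResponse G g) (a : ℝ) :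
    AEStronglyMeasurable (damped g a) volume :=
  h.memLp_ofReal.1.mul (Continuous.aestronglyMeasurable (by fun_prop))

theorem memLp_damped (h : IsImpulseResponse G g) {a : ℝ} (ha : 0 < a) :
    MemLp (damped g a) 2 volume :=
  h.memLp.of_le (aestronglyMeasurable_damped h a) (Eventually.of_forall (norm_damped_le h ha))

theorem integrable_damped (h : IsImpulseResponse G g) {a : ℝ} (ha : 0 < a) :
    Integrable (damped g a) := by
  have h1 : IntegrableOn (damped g a) (Set.Ici 0) := by
    rw [integrableOn_Ici_iff_integrableOn_Ioi]
    exact integrableOn_mul_exp h.memLp_ofReal (s := a) (by simpa using ha)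
  refine (integrableOn_iff_integrable_of_support_subset fun t ht => ?_).1 h1
  by_contra hneg
  simp only [Set.mem_Ici, not_le] at hneg
  exact ht (by simp [damped, h.causal t hneg])

open FourierTransform in
theorem fourier_damped (h : IsImpulseResponse G g) {a : ℝ} (ha : 0 < a) (ξ : ℝ) :
    𝓕 (damped g a) ξ = evalC G (a + (2 * Real.pi * ξ : ℝ) * Complex.I) := by
  rw [Real.fourier_real_eq_integral_exp_smul, ← h.laplace _ (by simpa using ha),
    ← integral_Ici_eq_integral_Ioi, ← setIntegral_eq_integral_of_forall_compl_eq_zero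
      (s := Set.Ici (0 : ℝ))]
  · refine setIntegral_congr_fun measurableSet_Ici fun t _ => ?_
    simp only [smul_eq_mul, damped]
    rw [mul_left_comm, ← Complex.exp_add]
    congr 2
    push_cast
    ring
  · intro t ht
    simp only [Set.mem_Ici, not_le] at ht
    simp [damped, h.causal t ht]

-- The response damped by `e^{-at}` is also integrable, so Plancherel applies to it and computes its
-- norm on the line `Re s = a`. Both sides pass to the limit `a → 0` by dominated convergence, the
-- decay bound of `G` being uniform in `a`.
open FourierTransform in
theorem IsImpulseResponse.integral_sq (h : IsImpulseResponse G g) :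
    ∫ t, g t ^ 2 = normSqTwo G := by
  have hG := h.rhTwo
  obtain ⟨C, hC, hb⟩ := hG.exists_bound
  set a : ℕ → ℝ := fun n => 1 / ((n : ℝ) + 1) with ha_def
  have ha : ∀ n, 0 < a n := fun n => by positivity
  have ha0 : Tendsto a atTop (𝓝 0) := tendsto_one_div_add_atTop_nhds_zero_nat
  have hpl : ∀ n, ∫ ξ : ℝ, ‖evalC G (a n + (2 * Real.pi * ξ : ℝ) * Complex.I)‖ ^ 2 =
      ∫ t, ‖damped g (a n) t‖ ^ 2 := fun n => by
    rw [← integral_norm_fourier_sq (integrable_damped h (ha n)) (memLp_damped h (ha n))]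
    simp only [fourier_damped h (ha n)]
  have hR : Tendsto (fun n => ∫ t, ‖damped g (a n) t‖ ^ 2) atTop (𝓝 (∫ t, g t ^ 2)) := by
    refine tendsto_integral_of_dominated_convergence (fun t => g t ^ 2)
      (fun n => (aestronglyMeasurable_damped h _).norm.pow 2)
      ((memLp_two_iff_integrable_sq h.memLp.1).1 h.memLp)
      (fun n => Eventually.of_forall fun t => ?_) (Eventually.of_forall fun t => ?_)
    · rw [Real.norm_of_nonneg (by positivity), ← sq_abs (g t)]
      exact pow_le_pow_left₀ (norm_nonneg _) (norm_damped_le h (ha n) t) 2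
    · have : Tendsto (fun n => (|g t| * Real.exp (-a n * t)) ^ 2) atTop
          (𝓝 ((|g t| * Real.exp (-0 * t)) ^ 2)) :=
        ((Continuous.tendsto (f := fun x : ℝ => (|g t| * Real.exp (-x * t)) ^ 2)
          (by fun_prop) 0).comp ha0)
      simpa [norm_damped] using this
  have hL : Tendsto (fun n => ∫ ξ : ℝ, ‖evalC G (a n + (2 * Real.pi * ξ : ℝ) * Complex.I)‖ ^ 2)
      atTop (𝓝 (∫ ξ : ℝ, ‖evalC G ((2 * Real.pi * ξ : ℝ) * Complex.I)‖ ^ 2)) := by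
    refine tendsto_integral_of_dominated_convergence
      (fun ξ : ℝ => C ^ 2 / (1 + (2 * Real.pi * ξ) ^ 2)) (fun n => ?_) ?_
      (fun n => Eventually.of_forall fun ξ => ?_) (Eventually.of_forall fun ξ => ?_)
    · refine Continuous.aestronglyMeasurable (Continuous.pow (Continuous.norm ?_) 2)
      refine continuous_iff_continuousAt.2 fun ξ => ?_
      exact ContinuousAt.comp (f := fun ξ : ℝ => (a n + (2 * Real.pi * ξ : ℝ) * Complex.I : ℂ))
        (hG.rhInf.differentiableAt (by simp [(ha n).le])).continuousAt (by fun_prop)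
    · exact (integrable_const_div_one_add_sq (C ^ 2)).comp_mul_left' (by positivity)
    · have h1 := hb (a n + (2 * Real.pi * ξ : ℝ) * Complex.I) (by simp [(ha n).le])
      have h2 : ‖((2 * Real.pi * ξ : ℝ) : ℂ) * Complex.I + 1‖ ≤
          ‖(a n + (2 * Real.pi * ξ : ℝ) * Complex.I : ℂ) + 1‖ := by
        refine (sq_le_sq₀ (norm_nonneg _) (norm_nonneg _)).1 ?_
        rw [norm_axis_add_one_sq, ← Complex.normSq_eq_norm_sq, Complex.normSq_apply]
        simp
        nlinarith [ha n]
      rw [Real.norm_of_nonneg (by positivity), ← norm_axis_add_one_sq, ← div_pow]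
      refine pow_le_pow_left₀ (norm_nonneg _) (h1.trans ?_) 2
      exact div_le_div_of_nonneg_left hC.le
        (norm_pos_iff.2 (add_one_ne (by simp))) h2
    · refine Tendsto.pow (Tendsto.norm ?_) 2
      have h1 : ContinuousAt (evalC G) ((2 * Real.pi * ξ : ℝ) * Complex.I) :=
        (hG.rhInf.differentiableAt (by simp)).continuousAt
      refine h1.tendsto.comp ?_
      have h2 : Tendsto (fun x : ℝ => (x + (2 * Real.pi * ξ : ℝ) * Complex.I : ℂ)) (𝓝 0)
          (𝓝 (((0 : ℝ) : ℂ) + (2 * Real.pi * ξ : ℝ) * Complex.I)) :=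
        Continuous.tendsto (by fun_prop) 0
      simpa [Function.comp_def] using h2.comp ha0
  simp only [hpl] at hL
  have e := tendsto_nhds_unique hR hL
  rw [e, normSqTwo]
  have := Measure.integral_comp_mul_left
    (fun ω : ℝ => ‖evalC G (ω * Complex.I)‖ ^ 2) (2 * Real.pi)
  rw [this, abs_of_pos (by positivity), smul_eq_mul]

end Laplace

/-! ### Partial fractions with poles in the left half-plane -/

section PartialFractions

/-- The open right half-plane. -/
abbrev RHP := {s : ℂ // 0 < s.re}

theorem RHP.sub_ne {p : ℂ} (hp : p.re < 0) (s : RHP) : (s : ℂ) - p ≠ 0 := fun h => by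
  have := congrArg Complex.re h
  have hs := s.2
  simp at this; linarith

/-- The functions `(s - p)⁻ᵏ⁻¹` with a pole in the open left half-plane. -/
noncomputable def poleTerm (x : {p : ℂ // p.re < 0} × ℕ) : RHP → ℂ :=
  fun s => ((s - x.1 : ℂ) ^ (x.2 + 1))⁻¹

/-- The span of the simple fractions with poles in the open left half-plane. -/
noncomputable def fractionSpan : Submodule ℂ (RHP → ℂ) := Submodule.span ℂ (Set.range poleTerm)

theorem inv_sub_mem_fractionSpan {p : ℂ} (hp : p.re < 0) :
    (fun s : RHP => (s - p : ℂ)⁻¹) ∈ fractionSpan := by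
  have : poleTerm (⟨p, hp⟩, 0) ∈ fractionSpan := Submodule.subset_span ⟨_, rfl⟩
  unfold poleTerm at this
  simpa using this

/-- A repeated pole only raises the exponent; a different pole is split off by the resolvent
identity, which lowers the exponent and allows induction. -/
theorem mul_inv_mem_fractionSpan {p : ℂ} (hp : p.re < 0) {Φ : RHP → ℂ} (hΦ : Φ ∈ fractionSpan) :
    (fun s : RHP => Φ s * (s - p : ℂ)⁻¹) ∈ fractionSpan := by
  induction hΦ using Submodule.span_induction with
  | mem Φ h =>
    obtain ⟨⟨⟨q, hq⟩, k⟩, rfl⟩ := h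
    rcases eq_or_ne p q with rfl | hpq
    · have : poleTerm (⟨p, hp⟩, k + 1) ∈ fractionSpan := Submodule.subset_span ⟨_, rfl⟩
      convert this using 1
      ext s
      simp only [poleTerm]
      rw [← mul_inv, ← pow_succ]
    · have key : ∀ m : ℕ, (fun s : RHP => ((s - q : ℂ) ^ m)⁻¹ * (s - p : ℂ)⁻¹) ∈ fractionSpan := by
        intro m
        induction m with
        | zero => simpa using inv_sub_mem_fractionSpan hp
        | succ m ih =>
          have h1 : poleTerm (⟨q, hq⟩, m) ∈ fractionSpan := Submodule.subset_span ⟨_, rfl⟩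
          convert fractionSpan.smul_mem (q - p)⁻¹ (fractionSpan.sub_mem h1 ih) using 1
          ext s
          have a1 := RHP.sub_ne hp s
          have a2 := RHP.sub_ne hq s
          have a3 : q - p ≠ 0 := sub_ne_zero.2 hpq.symm
          simp only [poleTerm, Pi.smul_apply, Pi.sub_apply, smul_eq_mul]
          field_simp
          ring
      exact key (k + 1)
  | zero =>
    simp only [Pi.zero_apply, zero_mul]
    exact fractionSpan.zero_mem
  | add Φ Ψ _ _ h1 h2 =>
    convert fractionSpan.add_mem h1 h2 using 1
    ext s; simp [add_mul]
  | smul c Φ _ h =>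
    convert fractionSpan.smul_mem c h using 1
    ext s; simp [mul_assoc]

/-- Induction on the poles: division by `X - p` writes the numerator as `u(p) + (X - p) q`. The
second part loses the pole `p`, the first is a constant over the full product. -/
theorem div_prod_mem_fractionSpan (S : Multiset ℂ) (hS : ∀ p ∈ S, p.re < 0) :
    ∀ u : Polynomial ℂ, u.degree < Multiset.card S →
    (fun s : RHP => u.eval (s : ℂ) / (S.map fun p => (s - p : ℂ)).prod) ∈ fractionSpan := by
  induction S using Multiset.induction_on with
  | empty =>
    intro u hu
    have : u = 0 := by simpa [Polynomial.degree_eq_bot] using hu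
    simp only [this, Polynomial.eval_zero, zero_div]
    exact fractionSpan.zero_mem
  | cons p S ih =>
    intro u hu
    have hp := hS p (Multiset.mem_cons_self p S)
    have ih' := ih fun q hq => hS q (Multiset.mem_cons_of_mem hq)
    set q := u /ₘ (Polynomial.X - Polynomial.C p) with hq
    have hu' : u = Polynomial.C (u.eval p) + (Polynomial.X - Polynomial.C p) * q := by
      conv_lhs => rw [← Polynomial.modByMonic_add_div u (Polynomial.X - Polynomial.C p)]
      rw [Polynomial.modByMonic_X_sub_C_eq_C_eval]
    have hqd : q.degree < Multiset.card S := by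
      rcases eq_or_ne q 0 with h0 | h0
      · rw [h0, Polynomial.degree_zero]; exact WithBot.bot_lt_coe _
      · have h1 : q.natDegree = u.natDegree - 1 := by
          rw [hq, Polynomial.natDegree_divByMonic _ (Polynomial.monic_X_sub_C p)]; simp
        have hu0 : u ≠ 0 := by rintro rfl; simp [hq] at h0
        have h2 : 1 ≤ u.natDegree := by
          by_contra! h
          rw [Polynomial.eq_C_of_natDegree_eq_zero (by omega : u.natDegree = 0)] at hq
          apply h0
          rw [hq, Polynomial.divByMonic_eq_zero_iff (Polynomial.monic_X_sub_C p),
            Polynomial.degree_X_sub_C]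
          exact Polynomial.degree_C_le.trans_lt (by norm_num)
        rw [Polynomial.degree_eq_natDegree hu0, Multiset.card_cons] at hu
        rw [Polynomial.degree_eq_natDegree h0]
        norm_cast at *
        omega
    have hone : (fun s : RHP => ((S.map fun p => (s - p : ℂ)).prod)⁻¹ * (s - p : ℂ)⁻¹) ∈
        fractionSpan := by
      rcases Multiset.empty_or_exists_mem S with h | ⟨x, hx⟩
      · simpa [h] using inv_sub_mem_fractionSpan hp
      · have := ih' 1 (by
          rw [Polynomial.degree_one]
          exact_mod_cast Multiset.card_pos_iff_exists_mem.2 ⟨x, hx⟩)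
        simpa using mul_inv_mem_fractionSpan hp this
    convert fractionSpan.add_mem (ih' q hqd) (fractionSpan.smul_mem (u.eval p) hone) using 1
    ext s
    have a1 := RHP.sub_ne hp s
    have a2 : (S.map fun p => (s - p : ℂ)).prod ≠ 0 := by
      refine Multiset.prod_ne_zero fun h => ?_
      obtain ⟨r, hr, h0⟩ := Multiset.mem_map.1 h
      exact RHP.sub_ne (hS r (Multiset.mem_cons_of_mem hr)) s h0
    conv_lhs => rw [hu']
    simp only [Multiset.map_cons, Multiset.prod_cons, Polynomial.eval_add, Polynomial.eval_C,
      Polynomial.eval_mul, Polynomial.eval_sub, Polynomial.eval_X, Pi.add_apply, Pi.smul_apply,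
      smul_eq_mul]
    field_simp
    ring

theorem RHTwo.mem_fractionSpan {G : RatFunc ℝ} (h : RHTwo G) :
    (fun s : RHP => evalC G s) ∈ fractionSpan := by
  have hm : (G.denom.map (algebraMap ℝ ℂ)).Monic := (RatFunc.monic_denom G).map _
  have hsp := IsAlgClosed.splits (G.denom.map (algebraMap ℝ ℂ))
  have hcard : Multiset.card (G.denom.map (algebraMap ℝ ℂ)).roots = G.denom.natDegree := by
    rw [← hsp.natDegree_eq_card_roots, Polynomial.natDegree_map]
  have := div_prod_mem_fractionSpan (G.denom.map (algebraMap ℝ ℂ)).roots (fun p hp => by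
      by_contra! hre
      refine h.rhInf.2 p hre ?_
      have := (Polynomial.mem_roots'.1 hp).2
      rwa [Polynomial.IsRoot, Polynomial.eval_map_algebraMap] at this)
    (G.num.map (algebraMap ℝ ℂ)) (by
      rw [hcard, Polynomial.degree_map, ← Polynomial.degree_eq_natDegree G.denom_ne_zero]
      exact h.degree_lt)
  convert this using 1
  ext s
  rw [Tracking.evalC_eq, Polynomial.eval_map_algebraMap]
  congr 1
  rw [← Polynomial.eval_map_algebraMap]
  conv_lhs => rw [hsp.eq_prod_roots_of_monic hm]
  rw [Polynomial.eval_multiset_prod, Multiset.map_map]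
  simp

end PartialFractions

/-! ### Existence of impulse responses -/

section Existence

theorem integrableOn_pow_mul_cexp (k : ℕ) {r : ℂ} (hr : 0 < r.re) :
    IntegrableOn (fun t : ℝ => (t : ℂ) ^ k * Complex.exp (-r * t)) (Set.Ioi 0) := by
  have h := integrableOn_rpow_mul_exp_neg_mul_rpow (p := 1) (s := k) (b := r.re)
    (by have : (0 : ℝ) ≤ k := Nat.cast_nonneg k
        linarith) one_pos hr
  refine Integrable.mono' h (Continuous.aestronglyMeasurable (by fun_prop)) ?_
  refine (ae_restrict_iff' measurableSet_Ioi).2 (Eventually.of_forall fun t ht => le_of_eq ?_)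
  have ht0 : (0 : ℝ) < t := ht
  rw [norm_mul, norm_pow, Complex.norm_real, Real.norm_of_nonneg ht0.le, Complex.norm_exp]
  simp

theorem tendsto_pow_mul_cexp (k : ℕ) {r : ℂ} (hr : 0 < r.re) :
    Tendsto (fun t : ℝ => (t : ℂ) ^ k * Complex.exp (-r * t)) atTop (𝓝 0) := by
  rw [tendsto_zero_iff_norm_tendsto_zero]
  have h := tendsto_rpow_mul_exp_neg_mul_atTop_nhds_zero k r.re hr
  refine h.congr' ?_
  filter_upwards [eventually_gt_atTop 0] with t ht
  rw [norm_mul, norm_pow, Complex.norm_real, Real.norm_of_nonneg ht.le, Complex.norm_exp]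
  simp

theorem integral_pow_mul_cexp (k : ℕ) {r : ℂ} (hr : 0 < r.re) :
    ∫ t in Set.Ioi (0 : ℝ), (t : ℂ) ^ k * Complex.exp (-r * t) = k.factorial / r ^ (k + 1) := by
  have hr0 : r ≠ 0 := by rintro rfl; simp at hr
  induction k with
  | zero =>
    have := integral_exp_mul_complex_Ioi (a := -r) (by simpa using hr) 0
    simp only [pow_zero, one_mul, this]
    simp
  | succ k ih =>
    have hd : ∀ t : ℝ, HasDerivAt (fun t : ℝ => (t : ℂ) ^ (k + 1) * Complex.exp (-r * t))
        ((k + 1) * ((t : ℂ) ^ k * Complex.exp (-r * t)) -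
          r * ((t : ℂ) ^ (k + 1) * Complex.exp (-r * t))) t := fun t => by
      have h1 : HasDerivAt (fun t : ℂ => t ^ (k + 1) * Complex.exp (-r * t))
          (((k + 1 : ℕ) : ℂ) * (t : ℂ) ^ k * Complex.exp (-r * t) +
            (t : ℂ) ^ (k + 1) * (Complex.exp (-r * t) * (-r))) (t : ℂ) := by
        have h2 : HasDerivAt (fun t : ℂ => -r * t) (-r) (t : ℂ) := by
          simpa using (hasDerivAt_id (t : ℂ)).const_mul (-r)
        simpa using! (hasDerivAt_pow (k + 1) (t : ℂ)).mul h2.cexp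
      convert h1.comp_ofReal using 1
      push_cast
      ring
    have hI1 := (integrableOn_pow_mul_cexp k hr).const_mul ((k : ℂ) + 1)
    have hI2 := (integrableOn_pow_mul_cexp (k + 1) hr).const_mul r
    have hF := integral_Ioi_of_hasDerivAt_of_tendsto (a := 0)
      (hd 0).continuousAt.continuousWithinAt (fun t _ => hd t) (hI1.sub hI2)
      (tendsto_pow_mul_cexp (k + 1) hr)
    rw [integral_sub hI1 hI2, integral_const_mul, integral_const_mul, ih] at hF
    simp at hF
    have hF' := sub_eq_zero.1 hF
    rw [Nat.factorial_succ]
    have e : ∫ t in Set.Ioi (0 : ℝ), (t : ℂ) ^ (k + 1) * Complex.exp (-r * t) =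
        ((k : ℂ) + 1) * (k.factorial / r ^ (k + 1)) / r := by
      rw [eq_div_iff hr0, mul_comm, hF']
      simp
    rw [e]
    push_cast
    field_simp
    ring

/-- The response of `(s - p)⁻ᵏ⁻¹` is `tᵏ e^{pt} / k!` on `t > 0`; linearity of the Laplace transform
covers the span. -/
theorem exists_causal_of_mem_fractionSpan {Φ : RHP → ℂ} (hΦ : Φ ∈ fractionSpan) :
    ∃ g : ℝ → ℂ, MemLp g 2 volume ∧ (∀ t < 0, g t = 0) ∧ ∀ s : RHP,
      ∫ t in Set.Ioi (0 : ℝ), g t * Complex.exp (-s * t) = Φ s := by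
  induction hΦ using Submodule.span_induction with
  | mem Φ h =>
    obtain ⟨⟨⟨p, hp⟩, k⟩, rfl⟩ := h
    have hp' : 0 < (-p).re := by simpa using hp
    refine ⟨(Set.Ioi 0).indicator fun t : ℝ =>
      (k.factorial : ℂ)⁻¹ * ((t : ℂ) ^ k * Complex.exp (- -p * t)), ?_, ?_, ?_⟩
    · rw [memLp_indicator_iff_restrict measurableSet_Ioi]
      refine MemLp.const_mul ?_ _
      rw [memLp_two_iff_integrable_sq_norm (Continuous.aestronglyMeasurable (by fun_prop))]
      have h2 := (integrableOn_pow_mul_cexp (2 * k) (r := 2 * -p)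
        (by simp; linarith)).norm
      refine h2.congr (Eventually.of_forall fun t => ?_)
      simp only
      rw [← norm_pow, mul_pow, ← pow_mul, ← Complex.exp_nat_mul, mul_comm k 2]
      congr 3
      push_cast
      ring
    · intro t ht
      rw [Set.indicator_of_notMem]
      simpa using ht.le
    · intro s
      have hr : 0 < ((s : ℂ) - p).re := by
        have := s.2
        simp; linarith
      have e : ∀ t ∈ Set.Ioi (0 : ℝ), (Set.Ioi 0).indicator (fun t : ℝ =>
          (k.factorial : ℂ)⁻¹ * ((t : ℂ) ^ k * Complex.exp (- -p * t))) t *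
          Complex.exp (-s * t) =
          (k.factorial : ℂ)⁻¹ * ((t : ℂ) ^ k * Complex.exp (-((s : ℂ) - p) * t)) := fun t ht => by
        rw [Set.indicator_of_mem ht, mul_assoc, mul_assoc, ← Complex.exp_add]
        congr 3
        ring
      rw [setIntegral_congr_fun measurableSet_Ioi e, integral_const_mul,
        integral_pow_mul_cexp k hr, poleTerm]
      have : (k.factorial : ℂ) ≠ 0 := by exact_mod_cast k.factorial_ne_zero
      field_simp
  | zero => exact ⟨0, MemLp.zero, by simp, by simp⟩
  | add Φ Ψ _ _ h1 h2 =>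
    obtain ⟨g, hg1, hg2, hg3⟩ := h1
    obtain ⟨f, hf1, hf2, hf3⟩ := h2
    refine ⟨g + f, hg1.add hf1, fun t ht => by simp [hg2 t ht, hf2 t ht], fun s => ?_⟩
    simp only [Pi.add_apply, add_mul]
    rw [integral_add (integrableOn_mul_exp hg1 s.2) (integrableOn_mul_exp hf1 s.2), hg3, hf3]
  | smul c Φ _ h =>
    obtain ⟨g, hg1, hg2, hg3⟩ := h
    refine ⟨c • g, hg1.const_smul c, fun t ht => by simp [hg2 t ht], fun s => ?_⟩
    simp only [Pi.smul_apply, smul_eq_mul, mul_assoc]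
    rw [integral_const_mul, hg3]

/-- Partial fractions give a complex response. As `G` has real coefficients, the conjugate response
has the same transform, and so does the real part. -/
theorem RHTwo.exists_isImpulseResponse {G : RatFunc ℝ} (h : RHTwo G) :
    ∃ g : ℝ → ℝ, IsImpulseResponse G g := by
  obtain ⟨g, hg1, hg2, hg3⟩ := exists_causal_of_mem_fractionSpan h.mem_fractionSpan
  refine ⟨fun t => (g t).re, hg1.re, fun t ht => by simp [hg2 t ht], fun s hs => ?_⟩
  have h1 := hg3 ⟨s, hs⟩
  have h2 := hg3 ⟨conj s, by simpa using hs⟩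
  simp only at h1 h2
  have hc : ∫ t in Set.Ioi (0 : ℝ), conj (g t) * Complex.exp (-s * t) = evalC G s := by
    have h3 := congrArg conj h2
    rw [← integral_conj, evalC_conj, Complex.conj_conj] at h3
    rw [← h3]
    congr 1
    ext t
    rw [map_mul, ← Complex.exp_conj]
    simp
  have hc1 : MemLp (fun t => conj (g t)) 2 volume := by
    refine hg1.of_le (Complex.continuous_conj.comp_aestronglyMeasurable hg1.1)
      (Eventually.of_forall fun t => by simp)
  have e : ∀ t : ℝ, ((g t).re : ℂ) * Complex.exp (-s * t) =
      (1 / 2) * (g t * Complex.exp (-s * t) + conj (g t) * Complex.exp (-s * t)) := fun t => by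
    rw [Complex.re_eq_add_conj]; ring
  simp only [e]
  rw [integral_const_mul, integral_add (integrableOn_mul_exp hg1 hs) (integrableOn_mul_exp hc1 hs),
    h1, hc]
  ring

end Existence

/-! ### Mean squares of stationary outputs as `H₂` norms -/

section MeanSquare

variable {Ω : Type*} [MeasurableSpace Ω] {μ : Measure Ω}
  {W V : Lp ℝ 2 (volume : Measure ℝ) →ₗ[ℝ] Lp ℝ 2 μ} {c d : ℝ}

theorem IsWhiteNoise.integral_sq (hW : IsWhiteNoise μ c W) (φ : Lp ℝ 2 (volume : Measure ℝ)) :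
    ∫ x, (W φ x) ^ 2 ∂μ = c ^ 2 * ‖φ‖ ^ 2 := by
  have hm : AEMeasurable (W φ) μ := (Lp.aestronglyMeasurable _).aemeasurable
  have h1 := integral_map hm (f := fun y : ℝ => y ^ 2) (by fun_prop)
  rw [← h1, hW φ]
  have h2 := variance_fun_id_gaussianReal (μ := 0) (v := Real.toNNReal (c ^ 2 * ‖φ‖ ^ 2))
  rw [variance_eq_integral (by fun_prop), integral_id_gaussianReal] at h2
  simp only [sub_zero] at h2
  rw [h2, Real.coe_toNNReal _ (by positivity)]

theorem lintegral_add_sq (hW : IsWhiteNoise μ c W) (hV : IsWhiteNoise μ d V)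
    (hWV : Uncorrelated W V) (φ ψ : Lp ℝ 2 (volume : Measure ℝ)) :
    ∫⁻ x, ENNReal.ofReal ((W φ x + V ψ x) ^ 2) ∂μ =
      ENNReal.ofReal (c ^ 2 * ‖φ‖ ^ 2 + d ^ 2 * ‖ψ‖ ^ 2) := by
  have m1 := Lp.memLp (W φ)
  have m2 := Lp.memLp (V ψ)
  have i1 : Integrable (fun x => (W φ x) ^ 2) μ := (memLp_two_iff_integrable_sq m1.1).1 m1
  have i2 : Integrable (fun x => (V ψ x) ^ 2) μ := (memLp_two_iff_integrable_sq m2.1).1 m2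
  have i3 : Integrable (fun x => 2 * (W φ x * V ψ x)) μ := (m1.integrable_mul m2).const_mul 2
  have e : ∀ x, (W φ x + V ψ x) ^ 2 = (W φ x) ^ 2 + (V ψ x) ^ 2 + 2 * (W φ x * V ψ x) :=
    fun x => by ring
  have i12 : Integrable (fun x => (W φ x) ^ 2 + (V ψ x) ^ 2) μ := i1.add i2
  rw [← ofReal_integral_eq_lintegral_ofReal]
  · simp only [e]
    rw [integral_add i12 i3, integral_add i1 i2, integral_const_mul, hWV φ ψ,
      hW.integral_sq, hV.integral_sq]
    simp
  · simp only [e]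
    exact i12.add i3
  · exact Eventually.of_forall fun x => by positivity

theorem IsImpulseResponse.norm_shift_sq {G : RatFunc ℝ} {g : ℝ → ℝ} (h : IsImpulseResponse G g)
    (t : ℝ) : ‖(h.memLp_shift t).toLp‖ ^ 2 = normSqTwo G := by
  rw [norm_toLp_sq, ← h.integral_sq]
  simp only [Real.norm_eq_abs, sq_abs]
  exact integral_sub_left_eq_self (fun τ => g τ ^ 2) volume t

/-- Every admissible pair of impulse responses yields the same value, by Plancherel, and partial
fractions show that a pair exists; so the infimum is this value. -/
theorem meanSquare_eq (hW : IsWhiteNoise μ c W) (hV : IsWhiteNoise μ d V)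
    (hWV : Uncorrelated W V) {G G' : RatFunc ℝ} (h : RHTwo G) (h' : RHTwo G') (t : ℝ) :
    meanSquare W V G G' t = ENNReal.ofReal (c ^ 2 * normSqTwo G + d ^ 2 * normSqTwo G') := by
  obtain ⟨g, hg⟩ := h.exists_isImpulseResponse
  obtain ⟨g', hg'⟩ := h'.exists_isImpulseResponse
  have key : ∀ {f f' : ℝ → ℝ} (hf : IsImpulseResponse G f) (hf' : IsImpulseResponse G' f'),
      ∫⁻ x, ENNReal.ofReal ((output W hf t x + output V hf' t x) ^ 2) ∂μ =
        ENNReal.ofReal (c ^ 2 * normSqTwo G + d ^ 2 * normSqTwo G') := fun hf hf' => by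
    rw [output, output, lintegral_add_sq hW hV hWV, hf.norm_shift_sq, hf'.norm_shift_sq]
  refine le_antisymm ?_ ?_
  · exact (iInf_le_of_le g <| iInf_le_of_le g' <| iInf_le_of_le hg <| iInf_le_of_le hg' <|
      (key hg hg').le)
  · exact le_iInf fun f => le_iInf fun f' => le_iInf fun hf => le_iInf fun hf' => (key hf hf').ge

/-- An infimum over the empty set is `⊤`, so finiteness supplies impulse responses. -/
theorem rhTwo_of_meanSquare_ne_top {G G' : RatFunc ℝ} {t : ℝ} (h : meanSquare W V G G' t ≠ ⊤) :
    RHTwo G ∧ RHTwo G' := by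
  by_contra hcon
  apply h
  simp only [meanSquare, iInf_eq_top]
  intro g g' hg hg'
  exact absurd ⟨hg.rhTwo, hg'.rhTwo⟩ hcon

end MeanSquare

/-! ### The integral of `log |1 + w² x²| / x²` -/

section LogIntegral

theorem abs_log_norm_one_add_le {z : ℂ} (hz : ‖z‖ ≤ 1 / 2) : |Real.log ‖1 + z‖| ≤ 3 / 2 * ‖z‖ := by
  rw [← Complex.log_re]
  exact (Complex.abs_re_le_norm _).trans (Complex.norm_log_one_add_half_le_self hz)

/-- Near `0` the logarithm is `O(x²)`; on a compact range the singularities of the logarithm of a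
meromorphic function are integrable; at infinity the logarithm is `O(x^{1/2})`. -/
theorem integrableOn_log_norm (w : ℂ) :
    IntegrableOn (fun x : ℝ => Real.log ‖1 + w ^ 2 * (x : ℂ) ^ 2‖ / x ^ 2) (Set.Ioi 0) := by
  rcases eq_or_ne w 0 with rfl | hw
  · simp
  have hw0 : 0 < ‖w‖ := norm_pos_iff.2 hw
  -- Below `δ` one has `|w x| ≤ 1/2`, so the linear bound on the logarithm holds; beyond `R` one has
  -- `|w x| ≥ 2`, so the logarithm is nonnegative.
  set δ := 1 / (2 * ‖w‖) with hδ
  have hδ0 : 0 < δ := by positivity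
  set R := max 1 (max δ (2 / ‖w‖)) with hR
  have hR1 : 1 ≤ R := le_max_left _ _
  have hδR : δ ≤ R := (le_max_left _ _).trans (le_max_right _ _)
  have hwR : 2 / ‖w‖ ≤ R := (le_max_right _ _).trans (le_max_right _ _)
  have hmeas : Measurable fun x : ℝ => Real.log ‖1 + w ^ 2 * (x : ℂ) ^ 2‖ / x ^ 2 := by fun_prop
  have hnorm : ∀ x : ℝ, 0 < x → ‖w ^ 2 * (x : ℂ) ^ 2‖ = ‖w‖ ^ 2 * x ^ 2 := fun x hx => by
    rw [norm_mul, norm_pow, norm_pow, Complex.norm_real, Real.norm_of_nonneg hx.le]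
  have h1 : IntegrableOn (fun x : ℝ => Real.log ‖1 + w ^ 2 * (x : ℂ) ^ 2‖ / x ^ 2)
      (Set.Ioc 0 δ) := by
    refine Measure.integrableOn_of_bounded (M := 3 / 2 * ‖w‖ ^ 2) (by simp)
      hmeas.aestronglyMeasurable ?_
    refine (ae_restrict_iff' measurableSet_Ioc).2 (Eventually.of_forall fun x hx => ?_)
    have hx0 := hx.1
    have hz : ‖w ^ 2 * (x : ℂ) ^ 2‖ ≤ 1 / 2 := by
      rw [hnorm x hx0, ← mul_pow]
      have : ‖w‖ * x ≤ 1 / 2 := by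
        calc ‖w‖ * x ≤ ‖w‖ * δ := mul_le_mul_of_nonneg_left hx.2 hw0.le
          _ = 1 / 2 := by rw [hδ]; field_simp
      have h0 : 0 ≤ ‖w‖ * x := by positivity
      nlinarith
    have := abs_log_norm_one_add_le hz
    rw [hnorm x hx0] at this
    rw [norm_div, Real.norm_eq_abs, norm_pow, Real.norm_of_nonneg hx0.le,
      div_le_iff₀ (by positivity)]
    linarith
  have h2 : IntegrableOn (fun x : ℝ => Real.log ‖1 + w ^ 2 * (x : ℂ) ^ 2‖ / x ^ 2)
      (Set.Ioc δ R) := by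
    have hm : MeromorphicOn (fun x : ℝ => 1 + w ^ 2 * (x : ℂ) ^ 2) (Set.uIcc δ R) := by
      intro x _
      apply AnalyticAt.meromorphicAt
      have : AnalyticAt ℝ (fun x : ℝ => (x : ℂ)) x := Complex.ofRealCLM.analyticAt x
      fun_prop
    have hi := hm.intervalIntegrable_log_norm
    have hc : ContinuousOn (fun x : ℝ => (x ^ 2)⁻¹) (Set.uIcc δ R) := by
      rw [Set.uIcc_of_le hδR]
      refine ContinuousOn.inv₀ (by fun_prop) fun x hx => ?_
      have : 0 < x := hδ0.trans_le hx.1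
      positivity
    have := hi.mul_continuousOn hc
    rw [intervalIntegrable_iff_integrableOn_Ioc_of_le hδR] at this
    exact this
  have h3 : IntegrableOn (fun x : ℝ => Real.log ‖1 + w ^ 2 * (x : ℂ) ^ 2‖ / x ^ 2)
      (Set.Ioi R) := by
    have hI := (integrableOn_Ioi_rpow_of_lt (a := -(3 / 2)) (c := R) (by norm_num)
      (by linarith)).const_mul (4 * (1 + ‖w‖ ^ 2) ^ (1 / 4 : ℝ))
    refine Integrable.mono' hI hmeas.aestronglyMeasurable ?_
    refine (ae_restrict_iff' measurableSet_Ioi).2 (Eventually.of_forall fun x hx => ?_)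
    have hxR : R < x := hx
    have hx1 : 1 < x := hR1.trans_lt hxR
    have hx0 : 0 < x := by linarith
    have hlow : 1 ≤ ‖1 + w ^ 2 * (x : ℂ) ^ 2‖ := by
      have h5 := norm_sub_norm_le (w ^ 2 * (x : ℂ) ^ 2) (-1)
      rw [sub_neg_eq_add, add_comm, norm_neg, norm_one, hnorm x hx0, ← mul_pow] at h5
      have h6 : 2 ≤ ‖w‖ * x := by
        have := mul_le_mul_of_nonneg_left (hwR.trans hxR.le) hw0.le
        rwa [mul_div_cancel₀ _ hw0.ne'] at this
      nlinarith
    have hup : ‖1 + w ^ 2 * (x : ℂ) ^ 2‖ ≤ (1 + ‖w‖ ^ 2) * x ^ 2 := by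
      have h5 := norm_add_le 1 (w ^ 2 * (x : ℂ) ^ 2)
      rw [norm_one, hnorm x hx0] at h5
      nlinarith
    have hlog := Real.log_le_rpow_div (norm_nonneg (1 + w ^ 2 * (x : ℂ) ^ 2))
      (by norm_num : (0 : ℝ) < 1 / 4)
    have hlog2 : ‖1 + w ^ 2 * (x : ℂ) ^ 2‖ ^ (1 / 4 : ℝ) ≤
        (1 + ‖w‖ ^ 2) ^ (1 / 4 : ℝ) * x ^ (1 / 2 : ℝ) := by
      refine (Real.rpow_le_rpow (norm_nonneg _) hup (by norm_num)).trans_eq ?_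
      rw [Real.mul_rpow (by positivity) (by positivity), ← Real.rpow_natCast x 2,
        ← Real.rpow_mul hx0.le]
      norm_num
    rw [norm_div, Real.norm_of_nonneg (Real.log_nonneg hlow), norm_pow,
      Real.norm_of_nonneg hx0.le, div_le_iff₀ (by positivity)]
    have hx32 : x ^ (-(3 / 2) : ℝ) * x ^ 2 = x ^ (1 / 2 : ℝ) := by
      rw [← Real.rpow_natCast x 2, ← Real.rpow_add hx0]; norm_num
    calc _ ≤ _ := hlog
      _ ≤ (1 + ‖w‖ ^ 2) ^ (1 / 4 : ℝ) * x ^ (1 / 2 : ℝ) / (1 / 4) :=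
        div_le_div_of_nonneg_right hlog2 (by norm_num)
      _ = _ := by rw [mul_assoc, hx32]; ring
  have := (h1.union h2).union h3
  rwa [Set.Ioc_union_Ioc_eq_Ioc hδ0.le hδR, Set.Ioc_union_Ioi_eq_Ioi (by linarith)] at this

/-- With `v = iw` the argument factors as `(1 + vx)(1 - vx)`. As `Im v > 0`, both factors stay off
the branch cut for real `x`, so the integral has an explicit antiderivative. It tends to `0` at `0`,
and at infinity the jump `log v - log(-v) = iπ` produces `π Re w`. -/
theorem integral_log_norm_of_re_pos {w : ℂ} (hw : 0 < w.re) :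
    ∫ x in Set.Ioi (0 : ℝ), Real.log ‖1 + w ^ 2 * (x : ℂ) ^ 2‖ / x ^ 2 = Real.pi * w.re := by
  set v := Complex.I * w with hv
  have hvim : 0 < v.im := by simpa [hv] using hw
  have hsp : ∀ x : ℝ, 1 + v * x ∈ Complex.slitPlane := fun x => by
    rcases eq_or_ne x 0 with rfl | hx
    · simp
    · refine Complex.mem_slitPlane_iff.2 (Or.inr ?_)
      simp only [Complex.add_im, Complex.one_im, Complex.mul_im, Complex.ofReal_re,
        Complex.ofReal_im, mul_zero, zero_add]
      exact mul_ne_zero hvim.ne' hx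
  have hsm : ∀ x : ℝ, 1 - v * x ∈ Complex.slitPlane := fun x => by
    have := hsp (-x)
    simpa [sub_eq_add_neg] using this
  -- The antiderivative obtained by integrating `x⁻²` by parts.
  set B : ℝ → ℂ := fun x => -((x : ℂ)⁻¹ * (Complex.log (1 + v * x) + Complex.log (1 - v * x))) -
    v * (Complex.log (1 + v * x) - Complex.log (1 - v * x)) with hB
  have hd1 : ∀ x : ℝ, HasDerivAt (fun x : ℝ => Complex.log (1 + v * x)) (v / (1 + v * x)) x :=
    fun x => by
      have h : HasDerivAt (fun x : ℂ => 1 + v * x) v (x : ℂ) := by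
        simpa using ((hasDerivAt_id (x : ℂ)).const_mul v).const_add 1
      exact (h.clog (hsp x)).comp_ofReal
  have hd2 : ∀ x : ℝ, HasDerivAt (fun x : ℝ => Complex.log (1 - v * x)) (-v / (1 - v * x)) x :=
    fun x => by
      have h : HasDerivAt (fun x : ℂ => 1 - v * x) (-v) (x : ℂ) := by
        simpa using ((hasDerivAt_id (x : ℂ)).const_mul v).const_sub 1
      exact (h.clog (hsm x)).comp_ofReal
  have hre : ∀ x : ℝ, Real.log ‖1 + w ^ 2 * (x : ℂ) ^ 2‖ =
      (Complex.log (1 + v * x) + Complex.log (1 - v * x)).re := fun x => by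
    have e : 1 + w ^ 2 * (x : ℂ) ^ 2 = (1 + v * x) * (1 - v * x) := by
      rw [hv]; linear_combination w ^ 2 * (x : ℂ) ^ 2 * Complex.I_sq
    rw [e, norm_mul, Real.log_mul (norm_ne_zero_iff.2 (Complex.slitPlane_ne_zero (hsp x)))
      (norm_ne_zero_iff.2 (Complex.slitPlane_ne_zero (hsm x))), Complex.add_re, Complex.log_re,
      Complex.log_re]
  have hderiv : ∀ x ∈ Set.Ioi (0 : ℝ), HasDerivAt (fun x => (B x).re)
      (Real.log ‖1 + w ^ 2 * (x : ℂ) ^ 2‖ / x ^ 2) x := fun x hx => by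
    have hx0 : (x : ℂ) ≠ 0 := by exact_mod_cast (ne_of_gt hx : x ≠ 0)
    have hinv : HasDerivAt (fun x : ℝ => (x : ℂ)⁻¹) (-((x : ℂ) ^ 2)⁻¹) x :=
      (hasDerivAt_inv hx0).comp_ofReal
    have h := ((hinv.mul ((hd1 x).add (hd2 x))).neg).sub
      (((hd1 x).sub (hd2 x)).const_mul v)
    have hB' : HasDerivAt B ((Complex.log (1 + v * x) + Complex.log (1 - v * x)) /
        ((x ^ 2 : ℝ) : ℂ)) x := by
      refine HasDerivAt.congr_deriv (f := B) h ?_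
      have a1 := Complex.slitPlane_ne_zero (hsp x)
      have a2 := Complex.slitPlane_ne_zero (hsm x)
      have e1 : v / (1 + v * x) * (1 + v * x) = v := div_mul_cancel₀ _ a1
      have e2 : -v / (1 - v * x) * (1 - v * x) = -v := div_mul_cancel₀ _ a2
      simp only [Pi.add_apply]
      generalize v / (1 + v * x) = p at *
      generalize -v / (1 - v * x) = q at *
      push_cast
      field_simp
      linear_combination -x * e1 - x * e2
    have h2 := (Complex.reCLM.hasFDerivAt.comp_hasDerivAt x hB')
    rw [hre x]
    refine HasDerivAt.congr_deriv (f := fun x => (B x).re) h2 ?_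
    rw [Complex.reCLM_apply, Complex.div_ofReal_re]
  have hcont : ContinuousWithinAt (fun x => (B x).re) (Set.Ici 0) 0 := by
    refine Complex.continuous_re.continuousAt.comp_continuousWithinAt ?_
    rw [← Set.Ioi_insert, continuousWithinAt_insert_self]
    have hs := ((hd1 0).add (hd2 0)).tendsto_slope
    have hs' : Tendsto (fun x : ℝ => (x : ℂ)⁻¹ *
        (Complex.log (1 + v * x) + Complex.log (1 - v * x))) (𝓝[>] 0) (𝓝 0) := by
      have h2 : Tendsto (slope ((fun x : ℝ => Complex.log (1 + v * x)) + fun x : ℝ =>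
          Complex.log (1 - v * x)) 0) (𝓝[≠] 0) (𝓝 0) := by
        convert hs using 2; simp
      refine (h2.mono_left (nhdsWithin_mono _ fun x hx => ne_of_gt hx)).congr fun x => ?_
      simp [slope_def_module, Complex.real_smul, mul_add]
    have h3 : Tendsto (fun x : ℝ => v * (Complex.log (1 + v * x) - Complex.log (1 - v * x)))
        (𝓝[>] 0) (𝓝 0) := by
      have : ContinuousAt
          (fun x : ℝ => v * (Complex.log (1 + v * x) - Complex.log (1 - v * x))) 0 :=
        (((hd1 0).sub (hd2 0)).const_mul v).continuousAt
      simpa using this.tendsto.mono_left nhdsWithin_le_nhds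
    have h4 := hs'.neg.sub h3
    simp only [neg_zero, sub_zero] at h4
    rw [ContinuousWithinAt, hB]
    simpa using h4
  have hlim : Tendsto (fun x => (B x).re) atTop (𝓝 (Real.pi * w.re)) := by
    have hinv : Tendsto (fun x : ℝ => ((x⁻¹ : ℝ) : ℂ)) atTop (𝓝 0) := by
      have := (Complex.continuous_ofReal.tendsto 0).comp tendsto_inv_atTop_zero
      simpa [Function.comp_def] using this
    have hvs : v ∈ Complex.slitPlane := Complex.mem_slitPlane_iff.2 (Or.inr hvim.ne')
    have hvs' : -v ∈ Complex.slitPlane :=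
      Complex.mem_slitPlane_iff.2 (Or.inr (by simpa using hvim.ne'))
    have l1 : Tendsto (fun x : ℝ => Complex.log (((x⁻¹ : ℝ) : ℂ) + v)) atTop
        (𝓝 (Complex.log v)) := by
      have := hinv.add_const v
      rw [zero_add] at this
      exact this.clog hvs
    have l2 : Tendsto (fun x : ℝ => Complex.log (((x⁻¹ : ℝ) : ℂ) + -v)) atTop
        (𝓝 (Complex.log (-v))) := by
      have := hinv.add_const (-v)
      rw [zero_add] at this
      exact this.clog hvs'
    have l3 : Tendsto (fun x : ℝ => ((Real.log x / x : ℝ) : ℂ)) atTop (𝓝 0) := by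
      have h := Real.isLittleO_log_id_atTop.tendsto_div_nhds_zero
      have := (Complex.continuous_ofReal.tendsto 0).comp h
      simpa [Function.comp_def] using this
    have hform : ∀ᶠ x : ℝ in atTop, B x =
        -(2 * ((Real.log x / x : ℝ) : ℂ) + ((x⁻¹ : ℝ) : ℂ) *
          (Complex.log (((x⁻¹ : ℝ) : ℂ) + v) + Complex.log (((x⁻¹ : ℝ) : ℂ) + -v))) -
        v * (Complex.log (((x⁻¹ : ℝ) : ℂ) + v) - Complex.log (((x⁻¹ : ℝ) : ℂ) + -v)) := by
      filter_upwards [eventually_gt_atTop 0] with x hx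
      have hx0 : (x : ℂ) ≠ 0 := by exact_mod_cast hx.ne'
      have key : ∀ u : ℂ, ((x⁻¹ : ℝ) : ℂ) + u ≠ 0 → Complex.log (1 + u * x) =
          Real.log x + Complex.log (((x⁻¹ : ℝ) : ℂ) + u) := fun u hu => by
        rw [← Complex.log_ofReal_mul hx hu]
        congr 1
        push_cast
        field_simp
      have hne : ∀ u : ℂ, u.im ≠ 0 → ((x⁻¹ : ℝ) : ℂ) + u ≠ 0 := fun u hu h => by
        have := congrArg Complex.im h
        simp at this
        exact hu this
      have k1 := key v (hne v hvim.ne')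
      have k2 := key (-v) (hne (-v) (by simpa using hvim.ne'))
      rw [neg_mul, ← sub_eq_add_neg] at k2
      simp only [hB]
      rw [k1, k2]
      push_cast
      field_simp
      ring
    have hB2 : Tendsto B atTop (𝓝 (-(2 * 0 + 0 * (Complex.log v + Complex.log (-v))) -
        v * (Complex.log v - Complex.log (-v)))) := by
      refine Tendsto.congr' (EventuallyEq.symm hform) ?_
      exact (((l3.const_mul 2).add (hinv.mul (l1.add l2))).neg).sub ((l1.sub l2).const_mul v)
    have hval : -v * (Complex.log v - Complex.log (-v)) = Real.pi * w := by
      have h1 : Complex.log v - Complex.log (-v) = Real.pi * Complex.I := by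
        rw [Complex.log, Complex.log, norm_neg, Complex.arg_neg_eq_arg_sub_pi_of_im_pos hvim]
        push_cast
        ring
      rw [h1, hv]
      linear_combination -(Real.pi : ℂ) * w * Complex.I_sq
    have hre2 := (Complex.continuous_re.tendsto _).comp hB2
    have hval' : (-(2 * 0 + 0 * (Complex.log v + Complex.log (-v))) -
        v * (Complex.log v - Complex.log (-v))).re = Real.pi * w.re := by
      rw [show -(2 * 0 + 0 * (Complex.log v + Complex.log (-v))) -
        v * (Complex.log v - Complex.log (-v)) = -v * (Complex.log v - Complex.log (-v)) by ring,
        hval]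
      simp
    rw [hval'] at hre2
    exact hre2
  have h := integral_Ioi_of_hasDerivAt_of_tendsto hcont hderiv (integrableOn_log_norm w) hlim
  rw [h]
  simp [hB]

/-- Now the integrand is singular at `x = 1/b`. The antiderivative is built from `y log y`,
continuous at `y = 0`, so it can be used on each side of the singularity and the two values there
cancel; it vanishes at `0` and at infinity. -/
theorem integral_log_norm_of_re_zero {b : ℝ} (hb : 0 < b) :
    ∫ x in Set.Ioi (0 : ℝ), Real.log ‖1 + (b * Complex.I) ^ 2 * (x : ℂ) ^ 2‖ / x ^ 2 = 0 := by
  have hint := integrableOn_log_norm (b * Complex.I)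
  set A : ℝ → ℝ := fun x => -(x⁻¹ * ((1 - b * x) * Real.log (1 - b * x) +
    (1 + b * x) * Real.log (1 + b * x))) with hA
  have hb1 : 0 < b⁻¹ := by positivity
  have hderiv : ∀ x : ℝ, 0 < x → x ≠ b⁻¹ → HasDerivAt A
      (Real.log ‖1 + (b * Complex.I) ^ 2 * (x : ℂ) ^ 2‖ / x ^ 2) x := fun x hx hxb => by
    have a1 : 1 - b * x ≠ 0 := fun h => hxb (by field_simp; linarith)
    have a2 : 1 + b * x ≠ 0 := by positivity
    have e : Real.log ‖1 + (b * Complex.I) ^ 2 * (x : ℂ) ^ 2‖ =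
        Real.log (1 - b * x) + Real.log (1 + b * x) := by
      rw [← Real.log_mul a1 a2, ← Real.log_abs ((1 - b * x) * (1 + b * x)), ← Real.norm_eq_abs,
        ← Complex.norm_real]
      congr 2
      push_cast
      linear_combination (b : ℂ) ^ 2 * (x : ℂ) ^ 2 * Complex.I_sq
    have d1 : HasDerivAt (fun x => 1 - b * x) (-b) x := by
      simpa using ((hasDerivAt_id x).const_mul b).const_sub 1
    have d2 : HasDerivAt (fun x => 1 + b * x) b x := by
      simpa using ((hasDerivAt_id x).const_mul b).const_add 1
    have h := ((hasDerivAt_inv hx.ne').mul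
      ((d1.mul (d1.log a1)).add (d2.mul (d2.log a2)))).neg
    rw [e]
    refine HasDerivAt.congr_deriv (f := A) h ?_
    simp only [Pi.add_apply, Pi.mul_apply]
    rw [mul_div_cancel₀ _ a1, mul_div_cancel₀ _ a2]
    field_simp
    ring
  have hcpos : ∀ x : ℝ, 0 < x → ContinuousAt A x := fun x hx => by
    have h1 : ContinuousAt (fun x : ℝ => (1 - b * x) * Real.log (1 - b * x)) x :=
      (Real.continuous_mul_log.comp (by fun_prop : Continuous fun x : ℝ => 1 - b * x)).continuousAt
    have h2 : ContinuousAt (fun x : ℝ => (1 + b * x) * Real.log (1 + b * x)) x :=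
      (Real.continuous_mul_log.comp (by fun_prop : Continuous fun x : ℝ => 1 + b * x)).continuousAt
    exact ((continuousAt_inv₀ hx.ne').mul (h1.add h2)).neg
  have hc0 : ContinuousWithinAt A (Set.Ici 0) 0 := by
    rw [← Set.Ioi_insert, continuousWithinAt_insert_self, ContinuousWithinAt]
    have d1 : HasDerivAt (fun x => 1 - b * x) (-b) (0 : ℝ) := by
      simpa using ((hasDerivAt_id (0 : ℝ)).const_mul b).const_sub 1
    have d2 : HasDerivAt (fun x => 1 + b * x) b (0 : ℝ) := by
      simpa using ((hasDerivAt_id (0 : ℝ)).const_mul b).const_add 1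
    have h := ((d1.mul (d1.log (by simp))).add (d2.mul (d2.log (by simp)))).tendsto_slope
    have h2 := (h.mono_left (nhdsWithin_mono _ fun x (hx : x ∈ Set.Ioi (0 : ℝ)) => ne_of_gt hx)).neg
    have hA0 : A 0 = 0 := by simp [hA]
    rw [hA0]
    convert h2 using 2
    · simp [slope_def_module, hA]
    · simp
  have hlim : Tendsto A atTop (𝓝 0) := by
    have hinv : Tendsto (fun x : ℝ => x⁻¹) atTop (𝓝 0) := tendsto_inv_atTop_zero
    have l1 : Tendsto (fun x : ℝ => Real.log (x⁻¹ + b)) atTop (𝓝 (Real.log b)) := by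
      have := hinv.add_const b
      rw [zero_add] at this
      exact this.log hb.ne'
    have l2 : Tendsto (fun x : ℝ => Real.log (x⁻¹ - b)) atTop (𝓝 (Real.log b)) := by
      have := hinv.sub_const b
      rw [zero_sub] at this
      have := this.log (neg_ne_zero.2 hb.ne')
      rwa [Real.log_neg_eq_log] at this
    have l3 : Tendsto (fun x : ℝ => Real.log x / x) atTop (𝓝 0) :=
      Real.isLittleO_log_id_atTop.tendsto_div_nhds_zero
    have hform : ∀ᶠ x : ℝ in atTop, A x = -(2 * (Real.log x / x) + x⁻¹ *
        (Real.log (x⁻¹ - b) + Real.log (x⁻¹ + b))) +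
        b * (Real.log (x⁻¹ - b) - Real.log (x⁻¹ + b)) := by
      filter_upwards [eventually_gt_atTop 0, eventually_gt_atTop b⁻¹] with x hx hxb
      have a1 : x⁻¹ - b ≠ 0 := fun h => by
        rw [sub_eq_zero] at h
        rw [← h, inv_inv] at hxb
        exact lt_irrefl _ hxb
      have a2 : x⁻¹ + b ≠ 0 := by positivity
      have k1 : Real.log (1 - b * x) = Real.log x + Real.log (x⁻¹ - b) := by
        rw [← Real.log_mul hx.ne' a1]; congr 1; field_simp
      have k2 : Real.log (1 + b * x) = Real.log x + Real.log (x⁻¹ + b) := by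
        rw [← Real.log_mul hx.ne' a2]; congr 1; field_simp
      simp only [hA]
      rw [k1, k2]
      field_simp
      ring
    have := (((l3.const_mul 2).add (hinv.mul (l2.add l1))).neg).add ((l2.sub l1).const_mul b)
    refine Tendsto.congr' (EventuallyEq.symm hform) ?_
    simpa using this
  have hI2 : ∫ x in Set.Ioi b⁻¹, Real.log ‖1 + (b * Complex.I) ^ 2 * (x : ℂ) ^ 2‖ / x ^ 2 =
      0 - A b⁻¹ :=
    integral_Ioi_of_hasDerivAt_of_tendsto (hcpos _ hb1).continuousWithinAt
      (fun x hx => hderiv x (hb1.trans hx) (ne_of_gt hx))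
      (hint.mono_set (Set.Ioi_subset_Ioi hb1.le)) hlim
  have hI1 : ∫ x in (0 : ℝ)..b⁻¹, Real.log ‖1 + (b * Complex.I) ^ 2 * (x : ℂ) ^ 2‖ / x ^ 2 =
      A b⁻¹ - A 0 := by
    refine intervalIntegral.integral_eq_sub_of_hasDerivAt_of_le hb1.le ?_
      (fun x hx => hderiv x hx.1 hx.2.ne) ?_
    · intro x hx
      rcases hx.1.eq_or_lt with h | h
      · rw [← h]
        exact hc0.mono Set.Icc_subset_Ici_self
      · exact (hcpos x h).continuousWithinAt
    · rw [intervalIntegrable_iff_integrableOn_Ioc_of_le hb1.le]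
      exact hint.mono_set Set.Ioc_subset_Ioi_self
  have hA0 : A 0 = 0 := by simp [hA]
  rw [← Set.Ioc_union_Ioi_eq_Ioi hb1.le, setIntegral_union Set.Ioc_disjoint_Ioi_same
    measurableSet_Ioi (hint.mono_set Set.Ioc_subset_Ioi_self)
    (hint.mono_set (Set.Ioi_subset_Ioi hb1.le)), hI2, ← intervalIntegral.integral_of_le hb1.le,
    hI1, hA0]
  ring

theorem integral_log_norm {w : ℂ} (hw : 0 ≤ w.re) :
    ∫ x in Set.Ioi (0 : ℝ), Real.log ‖1 + w ^ 2 * (x : ℂ) ^ 2‖ / x ^ 2 = Real.pi * w.re := by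
  rcases hw.eq_or_lt with h | h
  · have e : w = (w.im : ℂ) * Complex.I := by
      apply Complex.ext <;> simp [← h]
    rw [← h, mul_zero]
    rcases lt_trichotomy w.im 0 with h1 | h1 | h1
    · have := integral_log_norm_of_re_zero (b := -w.im) (by linarith)
      rw [e]
      convert this using 7
      push_cast
      ring
    · rw [e, h1]; simp
    · rw [e]
      exact integral_log_norm_of_re_zero h1
  · exact integral_log_norm_of_re_pos h

end LogIntegral

/-! ### The log-gain integral of a minimum phase function -/

section LogGain

theorem ae_one_add_sq_ne_zero (w : ℂ) :
    ∀ᵐ x : ℝ ∂(volume.restrict (Set.Ioi 0)), 1 + w ^ 2 * (x : ℂ) ^ 2 ≠ 0 := by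
  refine ae_restrict_of_ae ?_
  by_cases h : ∃ y : ℝ, 1 + w ^ 2 * (y : ℂ) ^ 2 = 0
  · obtain ⟨y, hy⟩ := h
    have hfin : ({y, -y} : Set ℝ).Finite := by simp
    filter_upwards [compl_mem_ae_iff.2 (hfin.measure_zero volume)] with x hx h0
    apply hx
    have hw : w ^ 2 ≠ 0 := by
      intro h
      rw [h] at hy
      simp at hy
    have : (x : ℂ) ^ 2 = (y : ℂ) ^ 2 :=
      mul_left_cancel₀ hw (by linear_combination h0 - hy)
    have hxy : x ^ 2 = y ^ 2 := by exact_mod_cast this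
    simpa using sq_eq_sq_iff_eq_or_eq_neg.1 hxy
  · push Not at h
    exact Eventually.of_forall h

theorem log_norm_prod (W : Multiset ℂ) (hW : ∀ w ∈ W, 0 ≤ w.re) :
    (∀ᵐ x : ℝ ∂(volume.restrict (Set.Ioi 0)),
      (W.map fun w => 1 + w ^ 2 * (x : ℂ) ^ 2).prod ≠ 0) ∧
    IntegrableOn (fun x : ℝ =>
      Real.log ‖(W.map fun w => 1 + w ^ 2 * (x : ℂ) ^ 2).prod‖ / x ^ 2) (Set.Ioi 0) ∧
    ∫ x in Set.Ioi (0 : ℝ), Real.log ‖(W.map fun w => 1 + w ^ 2 * (x : ℂ) ^ 2).prod‖ / x ^ 2 =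
      Real.pi * W.sum.re := by
  induction W using Multiset.induction_on with
  | empty => simp
  | cons w W ih =>
    obtain ⟨h1, h2, h3⟩ := ih fun v hv => hW v (Multiset.mem_cons_of_mem hv)
    have hw := hW w (Multiset.mem_cons_self w W)
    have h0 := ae_one_add_sq_ne_zero w
    simp only [Multiset.map_cons, Multiset.prod_cons, Multiset.sum_cons]
    have hae : (fun x : ℝ => Real.log ‖(1 + w ^ 2 * (x : ℂ) ^ 2) *
        (W.map fun w => 1 + w ^ 2 * (x : ℂ) ^ 2).prod‖ / x ^ 2)
        =ᵐ[volume.restrict (Set.Ioi 0)] fun x : ℝ => Real.log ‖1 + w ^ 2 * (x : ℂ) ^ 2‖ / x ^ 2 +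
          Real.log ‖(W.map fun w => 1 + w ^ 2 * (x : ℂ) ^ 2).prod‖ / x ^ 2 := by
      filter_upwards [h0, h1] with x hx0 hx1
      rw [norm_mul, Real.log_mul (norm_ne_zero_iff.2 hx0) (norm_ne_zero_iff.2 hx1), add_div]
    refine ⟨?_, ?_, ?_⟩
    · filter_upwards [h0, h1] with x hx0 hx1
      exact mul_ne_zero hx0 hx1
    · exact ((integrableOn_log_norm w).add h2).congr hae.symm
    · rw [integral_congr_ae hae, integral_add (integrableOn_log_norm w) h2, h3,
        integral_log_norm hw, Complex.add_re]
      ring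

theorem hasDerivAt_prod_one_add (W : Multiset ℂ) :
    HasDerivAt (fun s : ℂ => (W.map fun w => 1 + w * s).prod) W.sum 0 := by
  induction W using Multiset.induction_on with
  | empty => simpa using hasDerivAt_const (0 : ℂ) (1 : ℂ)
  | cons w W ih =>
    simp only [Multiset.map_cons, Multiset.prod_cons, Multiset.sum_cons]
    have h : HasDerivAt (fun s : ℂ => 1 + w * s) w 0 := by
      simpa using ((hasDerivAt_id (0 : ℂ)).const_mul w).const_add 1
    refine (h.mul ih).congr_deriv ?_
    simp

/-- The roots `z` enter as `w = -1/z`: then `Re z ≤ 0` becomes `Re w ≥ 0`, and the sum of the `w` is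
the logarithmic derivative of `p` at `0`. -/
theorem aeval_eq_prod_one_add {p : Polynomial ℝ} (h0 : Polynomial.aeval (0 : ℂ) p ≠ 0) (s : ℂ) :
    Polynomial.aeval s p = Polynomial.aeval (0 : ℂ) p *
      (((p.aroots ℂ).map fun z => -z⁻¹).map fun w => 1 + w * s).prod := by
  have hp0 : p ≠ 0 := by rintro rfl; simp at h0
  have hsp := (IsAlgClosed.splits (p.map (algebraMap ℝ ℂ))).eq_prod_roots
  have hev : ∀ s : ℂ, Polynomial.aeval s p =
      (p.map (algebraMap ℝ ℂ)).leadingCoeff * ((p.aroots ℂ).map fun z => s - z).prod := fun s => by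
    rw [← Polynomial.eval_map_algebraMap]
    conv_lhs => rw [hsp]
    rw [Polynomial.eval_mul, Polynomial.eval_C, Polynomial.eval_multiset_prod, Multiset.map_map]
    simp [Polynomial.aroots]
  rw [hev s, hev 0, mul_assoc, Multiset.map_map, ← Multiset.prod_map_mul]
  congr 2
  refine Multiset.map_congr rfl fun z hz => ?_
  have hz0 : z ≠ 0 := by
    rintro rfl
    exact h0 (Polynomial.mem_aroots.1 hz).2
  simp only [Function.comp]
  field_simp
  ring

/-- For real `p` the values at `jx` and `-jx` have the same modulus, and in their product the
factors pair up as `(1 + jwx)(1 - jwx) = 1 + w²x²`. -/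
theorem norm_aeval_axis_sq {p : Polynomial ℝ} (h0 : Polynomial.aeval (0 : ℂ) p ≠ 0) (x : ℝ) :
    ‖Polynomial.aeval (x * Complex.I) p / Polynomial.aeval (0 : ℂ) p‖ ^ 2 =
      ‖(((p.aroots ℂ).map fun z => -z⁻¹).map fun w => 1 + w ^ 2 * (x : ℂ) ^ 2).prod‖ := by
  set W := (p.aroots ℂ).map fun z => -z⁻¹ with hW
  have e1 := aeval_eq_prod_one_add h0 (x * Complex.I)
  have e2 := aeval_eq_prod_one_add h0 (conj ((x : ℂ) * Complex.I))
  rw [← hW] at e1 e2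
  have n1 : ‖Polynomial.aeval (x * Complex.I) p / Polynomial.aeval (0 : ℂ) p‖ =
      ‖(W.map fun w => 1 + w * (x * Complex.I)).prod‖ := by rw [e1, mul_div_cancel_left₀ _ h0]
  have n2 : ‖Polynomial.aeval (x * Complex.I) p / Polynomial.aeval (0 : ℂ) p‖ =
      ‖(W.map fun w => 1 + w * conj ((x : ℂ) * Complex.I)).prod‖ := by
    rw [norm_div, ← Complex.norm_conj (Polynomial.aeval (x * Complex.I) p), ← aeval_conj,
      ← norm_div, e2, mul_div_cancel_left₀ _ h0]
  rw [pow_two]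
  nth_rewrite 1 [n1]
  rw [n2, ← norm_mul, ← Multiset.prod_map_mul]
  congr 3
  ext w
  simp only [map_mul, Complex.conj_ofReal, Complex.conj_I]
  linear_combination -w ^ 2 * (x : ℂ) ^ 2 * Complex.I_sq

theorem log_norm_aeval {p : Polynomial ℝ} (h0 : Polynomial.aeval (0 : ℂ) p ≠ 0)
    (hr : ∀ z : ℂ, Polynomial.aeval z p = 0 → z.re ≤ 0) :
    (∀ᵐ x : ℝ ∂(volume.restrict (Set.Ioi 0)), Polynomial.aeval (x * Complex.I) p ≠ 0) ∧
    IntegrableOn (fun x : ℝ => Real.log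
      ‖Polynomial.aeval (x * Complex.I) p / Polynomial.aeval (0 : ℂ) p‖ / x ^ 2) (Set.Ioi 0) ∧
    ∫ x in Set.Ioi (0 : ℝ), Real.log
      ‖Polynomial.aeval (x * Complex.I) p / Polynomial.aeval (0 : ℂ) p‖ / x ^ 2 =
      Real.pi / 2 * ((p.aroots ℂ).map fun z => -z⁻¹).sum.re := by
  have hW : ∀ w ∈ (p.aroots ℂ).map fun z => -z⁻¹, 0 ≤ w.re := by
    intro w hw
    obtain ⟨z, hz, rfl⟩ := Multiset.mem_map.1 hw
    have := hr z (Polynomial.mem_aroots.1 hz).2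
    rw [Complex.neg_re, Complex.inv_re, ← neg_div]
    exact div_nonneg (by linarith) (Complex.normSq_nonneg z)
  obtain ⟨h1, h2, h3⟩ := log_norm_prod _ hW
  have e : ∀ x : ℝ, Real.log
      ‖Polynomial.aeval (x * Complex.I) p / Polynomial.aeval (0 : ℂ) p‖ / x ^ 2 =
      1 / 2 * (Real.log ‖(((p.aroots ℂ).map fun z => -z⁻¹).map fun w =>
        1 + w ^ 2 * (x : ℂ) ^ 2).prod‖ / x ^ 2) := fun x => by
    rw [← norm_aeval_axis_sq h0, Real.log_pow]
    push_cast
    ring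
  refine ⟨?_, ?_, ?_⟩
  · filter_upwards [h1] with x hx h
    apply hx
    have := norm_aeval_axis_sq h0 x
    rw [h] at this
    simpa using this.symm
  · simp only [e]
    exact h2.const_mul _
  · simp only [e]
    rw [integral_const_mul, h3]
    ring

theorem hasDerivAt_aeval_zero {p : Polynomial ℝ} (h0 : Polynomial.aeval (0 : ℂ) p ≠ 0) :
    HasDerivAt (fun s : ℂ => Polynomial.aeval s p)
      (Polynomial.aeval (0 : ℂ) p * ((p.aroots ℂ).map fun z => -z⁻¹).sum) 0 := by
  have h := (hasDerivAt_prod_one_add ((p.aroots ℂ).map fun z => -z⁻¹)).const_mul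
    (Polynomial.aeval (0 : ℂ) p)
  refine h.congr_of_eventuallyEq (Eventually.of_forall fun s => ?_)
  exact aeval_eq_prod_one_add h0 s

/-- The log-gain integral of a minimum phase function. -/
theorem integral_logGain {f : RatFunc ℝ} (hf : IsMinimumPhase f) (h0 : evalC f 0 ≠ 0) :
    IntegrableOn (logGain f) (Set.Ioi 0) ∧
    ∫ x in Set.Ioi (0 : ℝ), logGain f x = Real.pi / 2 * (deriv (evalC f) 0 / evalC f 0).re := by
  have hd0 : Polynomial.aeval (0 : ℂ) f.denom ≠ 0 := hf.1.2 0 (by simp)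
  have hn0 : Polynomial.aeval (0 : ℂ) f.num ≠ 0 := by
    intro h
    rw [evalC_eq, h, zero_div] at h0
    exact h0 rfl
  obtain ⟨n1, n2, n3⟩ := log_norm_aeval hn0 (fun z hz => by
    by_contra! h
    exact hf.2 z h (by rw [evalC_eq, hz, zero_div]))
  obtain ⟨d1, d2, d3⟩ := log_norm_aeval hd0 (fun z hz => by
    by_contra! h
    exact hf.1.2 z h.le hz)
  have hae : logGain f =ᵐ[volume.restrict (Set.Ioi 0)] fun x : ℝ =>
      Real.log ‖Polynomial.aeval (x * Complex.I) f.num / Polynomial.aeval (0 : ℂ) f.num‖ / x ^ 2 -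
      Real.log ‖Polynomial.aeval (x * Complex.I) f.denom /
        Polynomial.aeval (0 : ℂ) f.denom‖ / x ^ 2 := by
    filter_upwards [n1, d1] with x hx1 hx2
    rw [logGain, ← sub_div, ← Real.log_div (norm_ne_zero_iff.2 (div_ne_zero hx1 hn0))
      (norm_ne_zero_iff.2 (div_ne_zero hx2 hd0)), ← norm_div, evalC_eq, evalC_eq]
    congr 3
    field_simp
  refine ⟨(n2.sub d2).congr hae.symm, ?_⟩
  rw [integral_congr_ae hae, integral_sub n2 d2, n3, d3]
  set a := Polynomial.aeval (0 : ℂ) f.num with ha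
  set b := Polynomial.aeval (0 : ℂ) f.denom with hb
  have hder : HasDerivAt (evalC f) ((a * ((f.num.aroots ℂ).map fun z => -z⁻¹).sum * b -
      a * (b * ((f.denom.aroots ℂ).map fun z => -z⁻¹).sum)) / b ^ 2) 0 :=
    (hasDerivAt_aeval_zero hn0).div (hasDerivAt_aeval_zero hd0) hd0
  rw [hder.deriv, evalC_eq, ← ha, ← hb, ← mul_sub, ← Complex.sub_re]
  congr 2
  generalize ((f.num.aroots ℂ).map fun z => -z⁻¹).sum = u
  generalize ((f.denom.aroots ℂ).map fun z => -z⁻¹).sum = v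
  field_simp

end LogGain

/-! ### Density of multiples of an outer function in `H₂` -/

section Approximation

theorem ae_aeval_axis_ne_zero {p : Polynomial ℝ} (hp : p ≠ 0) :
    ∀ᵐ ω : ℝ, Polynomial.aeval ((ω : ℂ) * Complex.I) p ≠ 0 := by
  have hinj : Function.Injective fun ω : ℝ => (ω : ℂ) * Complex.I := fun x y h => by
    have := mul_right_cancel₀ Complex.I_ne_zero h
    exact_mod_cast this
  have hfin : ((fun ω : ℝ => (ω : ℂ) * Complex.I) ⁻¹' ((p.aroots ℂ).toFinset : Set ℂ)).Finite :=
    (Finset.finite_toSet _).preimage hinj.injOn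
  filter_upwards [compl_mem_ae_iff.2 (hfin.measure_zero volume)] with ω hω h0
  exact hω (by simp [hp, h0])

/-- Moving to the right increases the distance to every root in the closed left half-plane. This
makes the approximate inverses below uniformly bounded after multiplication by `G`. -/
theorem norm_prod_sub_le (S : Multiset ℂ) (hS : ∀ z ∈ S, z.re ≤ 0) {s : ℂ} (hs : 0 ≤ s.re)
    {η : ℝ} (hη : 0 ≤ η) :
    ‖(S.map fun z => s - z).prod‖ ≤ ‖(S.map fun z => s + η - z).prod‖ := by
  induction S using Multiset.induction_on with
  | empty => simp
  | cons z S ih =>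
    have ih' := ih fun v hv => hS v (Multiset.mem_cons_of_mem hv)
    have hz := hS z (Multiset.mem_cons_self z S)
    simp only [Multiset.map_cons, Multiset.prod_cons, norm_mul]
    refine mul_le_mul ?_ ih' (norm_nonneg _) (norm_nonneg _)
    refine (sq_le_sq₀ (norm_nonneg _) (norm_nonneg _)).1 ?_
    rw [← Complex.normSq_eq_norm_sq, ← Complex.normSq_eq_norm_sq, Complex.normSq_apply,
      Complex.normSq_apply]
    simp only [Complex.sub_re, Complex.sub_im, Complex.add_re, Complex.add_im, Complex.ofReal_re,
      Complex.ofReal_im, add_zero]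
    nlinarith

theorem norm_aeval_le_shift {p : Polynomial ℝ} (hp : ∀ z : ℂ, 0 < z.re → Polynomial.aeval z p ≠ 0)
    {s : ℂ} (hs : 0 ≤ s.re) {η : ℝ} (hη : 0 ≤ η) :
    ‖Polynomial.aeval s p‖ ≤ ‖Polynomial.aeval (s + η) p‖ := by
  have hsp := (IsAlgClosed.splits (p.map (algebraMap ℝ ℂ))).eq_prod_roots
  have hev : ∀ s : ℂ, Polynomial.aeval s p =
      (p.map (algebraMap ℝ ℂ)).leadingCoeff * ((p.aroots ℂ).map fun z => s - z).prod := fun s => by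
    rw [← Polynomial.eval_map_algebraMap]
    conv_lhs => rw [hsp]
    rw [Polynomial.eval_mul, Polynomial.eval_C, Polynomial.eval_multiset_prod, Multiset.map_map]
    simp [Polynomial.aroots]
  rw [hev s, hev (s + η), norm_mul, norm_mul]
  refine mul_le_mul_of_nonneg_left (norm_prod_sub_le _ (fun z hz => ?_) hs hη) (norm_nonneg _)
  by_contra! h
  exact hp z h (Polynomial.mem_aroots.1 hz).2

theorem IsMinimumPhase.ne_zero {G : RatFunc ℝ} (h : IsMinimumPhase G) : G ≠ 0 := by
  rintro rfl
  exact h.2 1 (by simp) (by simp)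

theorem IsMinimumPhase.num_ne {G : RatFunc ℝ} (h : IsMinimumPhase G) {s : ℂ} (hs : 0 < s.re) :
    Polynomial.aeval s G.num ≠ 0 := fun h0 => h.2 s hs (by rw [evalC_eq, h0, zero_div])

/-- The denominator `G.num(s + η) (1 + η s)ᵐ` of an approximate inverse of `G`. -/
noncomputable def shiftedDenom (G : RatFunc ℝ) (η : ℝ) : Polynomial ℝ :=
  G.num.comp (Polynomial.X + Polynomial.C η) *
    (Polynomial.C η * Polynomial.X + Polynomial.C 1) ^ G.denom.natDegree

theorem aeval_shiftedDenom (G : RatFunc ℝ) (η : ℝ) (s : ℂ) :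
    Polynomial.aeval s (shiftedDenom G η) =
      Polynomial.aeval (s + η) G.num * (η * s + 1) ^ G.denom.natDegree := by
  simp [shiftedDenom, Polynomial.aeval_comp]

theorem one_le_norm_add_one {η : ℝ} (hη : 0 ≤ η) {s : ℂ} (hs : 0 ≤ s.re) :
    1 ≤ ‖(η : ℂ) * s + 1‖ := by
  have := (le_abs_self _).trans (Complex.abs_re_le_norm ((η : ℂ) * s + 1))
  simp at this
  nlinarith

theorem norm_div_shiftedDenom_le {G : RatFunc ℝ} (hG : IsMinimumPhase G) {η : ℝ} (hη : 0 < η)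
    {s : ℂ} (hs : 0 ≤ s.re) :
    ‖Polynomial.aeval s G.num / Polynomial.aeval s (shiftedDenom G η)‖ ≤ 1 := by
  have h1 : 0 < ‖Polynomial.aeval (s + η) G.num‖ :=
    norm_pos_iff.2 (hG.num_ne (by simp; linarith))
  rw [aeval_shiftedDenom, norm_div, norm_mul, norm_pow]
  have h2 := one_le_pow₀ (n := G.denom.natDegree) (one_le_norm_add_one hη.le hs)
  refine div_le_one_of_le₀ ?_ (by positivity)
  exact (norm_aeval_le_shift (fun z hz => hG.num_ne hz) hs hη.le).trans
    (le_mul_of_one_le_right h1.le h2)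

theorem shiftedDenom_ne {G : RatFunc ℝ} (hG : IsMinimumPhase G) {η : ℝ} (hη : 0 < η)
    {s : ℂ} (hs : 0 ≤ s.re) : Polynomial.aeval s (shiftedDenom G η) ≠ 0 := by
  rw [aeval_shiftedDenom]
  refine mul_ne_zero (hG.num_ne (by simp; linarith)) (pow_ne_zero _ ?_)
  exact norm_pos_iff.1 (one_pos.trans_le (one_le_norm_add_one hη.le hs))

/-- The shift by `η` moves the zeros of `G` off the imaginary axis, and the factor `(1 + ηs)ᵐ`, with
`m` the degree of the denominator, makes the quotient proper. -/
theorem rhInf_approxInv {G : RatFunc ℝ} (hG : IsMinimumPhase G) {η : ℝ} (hη : 0 < η) :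
    RHInf (algebraMap (Polynomial ℝ) (RatFunc ℝ) G.denom /
      algebraMap (Polynomial ℝ) (RatFunc ℝ) (shiftedDenom G η)) := by
  refine rhInf_div (fun s hs => shiftedDenom_ne hG hη hs) ?_
  have h1 : (G.num.comp (Polynomial.X + Polynomial.C η)).degree ≥ 0 := by
    refine Polynomial.zero_le_degree_iff.2 fun h => ?_
    have h2 := hG.num_ne (s := 1 + η) (by simp; linarith)
    apply h2
    have := Polynomial.aeval_comp (A := ℂ) (p := G.num) (q := Polynomial.X + Polynomial.C η)
      (x := 1)
    rw [h] at this
    simpa using this.symm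
  rw [shiftedDenom, Polynomial.degree_mul, Polynomial.degree_pow, Polynomial.degree_linear hη.ne',
    Polynomial.degree_eq_natDegree G.denom_ne_zero]
  simpa using add_le_add_left h1 (G.denom.natDegree : WithBot ℕ)

/-- Multiples of a minimum phase function are dense in `H₂`. -/
theorem exists_normSqTwo_sub_mul_lt {G g : RatFunc ℝ} (hG : IsMinimumPhase G) (hg : RHTwo g)
    {δ : ℝ} (hδ : 0 < δ) : ∃ R, RHTwo R ∧ normSqTwo (g - G * R) < δ := by
  set a : ℕ → ℝ := fun n => 1 / ((n : ℝ) + 1) with ha_def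
  have ha : ∀ n, 0 < a n := fun n => by positivity
  have ha0 : Tendsto a atTop (𝓝 0) := tendsto_one_div_add_atTop_nhds_zero_nat
  set T : ℕ → RatFunc ℝ := fun n => algebraMap (Polynomial ℝ) (RatFunc ℝ) G.denom /
      algebraMap (Polynomial ℝ) (RatFunc ℝ) (shiftedDenom G (a n)) with hT
  have hTi : ∀ n, RHInf (T n) := fun n => rhInf_approxInv hG (ha n)
  -- With `R = g Tₙ` the error is `g` times `1 - G Tₙ`. The second factor has modulus at most `2` on
  -- the axis and tends to `0` off the finitely many axis zeros of the numerator, so dominated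
  -- convergence applies.
  have hev : ∀ n, ∀ ω : ℝ, evalC (g - G * (g * T n)) (ω * Complex.I) =
      evalC g (ω * Complex.I) * (1 - Polynomial.aeval ((ω : ℂ) * Complex.I) G.num /
        Polynomial.aeval ((ω : ℂ) * Complex.I) (shiftedDenom G (a n))) := fun n ω => by
    have hs : 0 ≤ ((ω : ℂ) * Complex.I).re := by simp
    rw [hg.rhInf.evalC_sub (hG.1.mul (hg.rhInf.mul (hTi n))) hs,
      hG.1.evalC_mul (hg.rhInf.mul (hTi n)) hs, hg.rhInf.evalC_mul (hTi n) hs,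
      evalC_div_of_ne_zero _ _ (shiftedDenom_ne hG (ha n) hs), evalC_eq G]
    have := hG.1.2 _ hs
    have := shiftedDenom_ne hG (ha n) hs
    field_simp
  have hcont : ∀ n, Continuous fun ω : ℝ => evalC (g - G * (g * T n)) (ω * Complex.I) :=
    fun n => (hg.rhInf.sub (hG.1.mul (hg.rhInf.mul (hTi n)))).continuous_axis
  have hlim : Tendsto (fun n => ∫ ω : ℝ, ‖evalC (g - G * (g * T n)) (ω * Complex.I)‖ ^ 2) atTop
      (𝓝 (∫ _ω : ℝ, (0 : ℝ))) := by
    refine tendsto_integral_of_dominated_convergence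
      (fun ω : ℝ => 4 * ‖evalC g (ω * Complex.I)‖ ^ 2)
      (fun n => ((hcont n).norm.pow 2).aestronglyMeasurable)
      (hg.integrable_norm_sq.const_mul 4) (fun n => Eventually.of_forall fun ω => ?_) ?_
    · rw [Real.norm_of_nonneg (by positivity), hev n ω, norm_mul, mul_pow, mul_comm]
      refine mul_le_mul_of_nonneg_right ?_ (by positivity)
      have h1 := norm_div_shiftedDenom_le hG (ha n) (s := (ω : ℂ) * Complex.I) (by simp)
      have h2 := norm_sub_le 1 (Polynomial.aeval ((ω : ℂ) * Complex.I) G.num /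
        Polynomial.aeval ((ω : ℂ) * Complex.I) (shiftedDenom G (a n)))
      rw [norm_one] at h2
      have h3 := pow_le_pow_left₀ (norm_nonneg _) (h2.trans (by linarith : _ ≤ (2 : ℝ))) 2
      linarith
    · filter_upwards [ae_aeval_axis_ne_zero (RatFunc.num_ne_zero hG.ne_zero)] with ω hω
      have hden : Tendsto (fun n => Polynomial.aeval ((ω : ℂ) * Complex.I)
          (shiftedDenom G (a n))) atTop (𝓝 (Polynomial.aeval ((ω : ℂ) * Complex.I) G.num)) := by
        simp only [aeval_shiftedDenom]
        have hc : Continuous fun η : ℝ => Polynomial.aeval ((ω : ℂ) * Complex.I + η) G.num *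
            ((η : ℂ) * ((ω : ℂ) * Complex.I) + 1) ^ G.denom.natDegree := by
          have := Polynomial.continuous_aeval (A := ℂ) G.num
          fun_prop
        have := (hc.tendsto 0).comp ha0
        simpa [Function.comp_def] using this
      have h1 := (tendsto_const_nhds (x := Polynomial.aeval ((ω : ℂ) * Complex.I) G.num)).div
        hden hω
      rw [div_self hω] at h1
      have h2 := ((h1.const_sub 1).const_mul (evalC g (ω * Complex.I))).norm.pow 2
      simp only [hev]
      simpa using h2
  rw [integral_zero] at hlim
  have hlim2 := hlim.const_mul ((2 * Real.pi)⁻¹)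
  rw [mul_zero] at hlim2
  obtain ⟨n, hn⟩ := (hlim2.eventually_lt_const hδ).exists
  exact ⟨g * T n, hg.mul_right (hTi n), hn⟩

end Approximation

/-! ### Completion of the square for the tracking cost -/

section Reference

/-- The product rules for `evalC` are available only on the closed right half-plane, and `0` lies on
its boundary; derivatives are compared along the ray `t ≥ 0`. -/
theorem deriv_eq_of_eq_on_nonneg {f h : ℂ → ℂ} {f' h' : ℂ} (hf : HasDerivAt f f' 0)
    (hh : HasDerivAt h h' 0) (heq : ∀ t : ℝ, 0 ≤ t → f t = h t) : f' = h' := by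
  have h1 : HasDerivWithinAt (fun t : ℝ => f t) f' (Set.Ici 0) 0 :=
    (HasDerivAt.comp_ofReal (z := 0) (by simpa using hf)).hasDerivWithinAt
  have h2 : HasDerivWithinAt (fun t : ℝ => h t) h' (Set.Ici 0) 0 :=
    (HasDerivAt.comp_ofReal (z := 0) (by simpa using hh)).hasDerivWithinAt
  have h3 : HasDerivWithinAt (fun t : ℝ => f t) h' (Set.Ici 0) 0 :=
    h2.congr (fun t ht => heq t ht) (heq 0 le_rfl)
  exact (uniqueDiffWithinAt_Ici (0 : ℝ)).eq_deriv _ h1 h3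

theorem RHInf.hasDerivAt_zero {G : RatFunc ℝ} (h : RHInf G) :
    HasDerivAt (evalC G) (deriv (evalC G) 0) 0 :=
  (h.differentiableAt (by simp)).hasDerivAt

theorem RHTwo.evalC_div_X_zero {G : RatFunc ℝ} (h : RHTwo (G / RatFunc.X)) :
    evalC (G / RatFunc.X) 0 = deriv (evalC G) 0 := by
  have h1 := h.rhInf.hasDerivAt_zero.mul (hasDerivAt_id (0 : ℂ))
  have h2 := deriv_eq_of_eq_on_nonneg h.rhInf_of_div_X.hasDerivAt_zero h1
    (fun t ht => h.evalC_div_X (by simpa using ht))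
  rw [h2]
  simp

theorem RHTwo.norm_sq_div_X {G : RatFunc ℝ} (h : RHTwo (G / RatFunc.X)) {ω : ℝ} (hω : ω ≠ 0) :
    ‖evalC (G / RatFunc.X) (ω * Complex.I)‖ ^ 2 = ‖evalC G (ω * Complex.I)‖ ^ 2 / ω ^ 2 := by
  rw [h.evalC_div_X (s := ω * Complex.I) (by simp), norm_mul, norm_mul, Complex.norm_I, mul_one,
    mul_pow, Complex.norm_real, Real.norm_eq_abs, sq_abs]
  field_simp

variable {N B Θo Q : RatFunc ℝ} {ε : ℝ}

/-- The reference part of the performance index, by completion of the square. -/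
theorem reference_cost_eq (hN : RHInf N) (hB : RHInf B) (hΘ : RHInf Θo) (hQ : RHInf Q)
    (haxis : ∀ ω : ℝ, ‖evalC Θo (ω * Complex.I)‖ ^ 2 =
      (1 - ε) * ‖evalC N (ω * Complex.I)‖ ^ 2 + ε * ‖evalC B (ω * Complex.I)‖ ^ 2)
    (hΘ0 : evalC Θo 0 ≠ 0) (hB0 : evalC B 0 = 0) (hNQ : evalC N 0 * evalC Q 0 = 1) :
    RHTwo ((1 - N * Q) / RatFunc.X) ∧ RHTwo (B * Q / RatFunc.X) ∧
    RHTwo ((Θo * Q - RatFunc.C (evalZero Θo / evalZero N)) / RatFunc.X) ∧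
    (1 - ε) * normSqTwo ((1 - N * Q) / RatFunc.X) + ε * normSqTwo (B * Q / RatFunc.X) =
      normSqTwo ((Θo * Q - RatFunc.C (evalZero Θo / evalZero N)) / RatFunc.X) +
      (1 - ε) * (deriv (evalC Θo) 0 / evalC Θo 0 - deriv (evalC N) 0 / evalC N 0).re := by
  have hz : (0 : ℝ) ≤ (0 : ℂ).re := by simp
  have hN0 : evalC N 0 ≠ 0 := left_ne_zero_of_mul_eq_one hNQ
  have hN0r : evalZero N ≠ 0 := by
    rw [evalC_zero_eq] at hN0
    exact_mod_cast hN0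
  set c := evalZero Θo / evalZero N with hc
  have hcN : c * evalZero N = evalZero Θo := div_mul_cancel₀ _ hN0r
  -- The spectral identity at `ω = 0`, where `B` drops out.
  have hc2 : c ^ 2 = 1 - ε := by
    have h := haxis 0
    simp only [Complex.ofReal_zero, zero_mul, hB0, norm_zero] at h
    rw [evalC_zero_eq, evalC_zero_eq, Complex.norm_real, Complex.norm_real, Real.norm_eq_abs,
      Real.norm_eq_abs, sq_abs, sq_abs, ← hcN] at h
    have h2 : evalZero N ^ 2 ≠ 0 := pow_ne_zero 2 hN0r
    apply mul_right_cancel₀ h2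
    linarith
  have hC := RHInf.const c
  have r1 : RHTwo ((1 - N * Q) / RatFunc.X) := by
    refine rhTwo_div_X (RHInf.one.sub (hN.mul hQ)) ?_
    rw [RHInf.one.evalC_sub (hN.mul hQ) hz, hN.evalC_mul hQ hz, hNQ]
    simp
  have r2 : RHTwo (B * Q / RatFunc.X) := by
    refine rhTwo_div_X (hB.mul hQ) ?_
    rw [hB.evalC_mul hQ hz, hB0, zero_mul]
  have hcN' : (c : ℂ) * evalC N 0 = evalC Θo 0 := by
    rw [evalC_zero_eq, evalC_zero_eq, ← hcN]; push_cast; ring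
  have hΘQ : evalC Θo 0 * evalC Q 0 = c := by
    rw [← hcN', mul_assoc, hNQ, mul_one]
  have r3 : RHTwo ((Θo * Q - RatFunc.C c) / RatFunc.X) := by
    refine rhTwo_div_X ((hΘ.mul hQ).sub hC) ?_
    rw [(hΘ.mul hQ).evalC_sub hC hz, hΘ.evalC_mul hQ hz, hΘQ, evalC_C, sub_self]
  refine ⟨r1, r2, r3, ?_⟩
  -- Half of what remains after completing the square is `Re g`. The choice of `c` makes `g(0) = c²
  -- - (1 - ε) = 0`, so division by `ω²` is harmless.
  set g := RatFunc.C c * (Θo * Q) - RatFunc.C (1 - ε) * (N * Q) with hg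
  have hgi : RHInf g := (hC.mul (hΘ.mul hQ)).sub ((RHInf.const (1 - ε)).mul (hN.mul hQ))
  have hgev : ∀ s : ℂ, 0 ≤ s.re → evalC g s =
      c * (evalC Θo s * evalC Q s) - ((1 - ε : ℝ) : ℂ) * (evalC N s * evalC Q s) := fun s hs => by
    rw [hg, (hC.mul (hΘ.mul hQ)).evalC_sub ((RHInf.const (1 - ε)).mul (hN.mul hQ)) hs,
      hC.evalC_mul (hΘ.mul hQ) hs, (RHInf.const (1 - ε)).evalC_mul (hN.mul hQ) hs,
      hΘ.evalC_mul hQ hs, hN.evalC_mul hQ hs, evalC_C, evalC_C]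
  have hg0 : evalC g 0 = 0 := by
    rw [hgev 0 hz, hNQ, hΘQ, ← hc2]
    push_cast
    ring
  obtain ⟨gI, gV⟩ := integral_re_div_sq hgi hg0
  have hgder : evalC (g / RatFunc.X) 0 = (1 - ε : ℝ) *
      (deriv (evalC Θo) 0 / evalC Θo 0 - deriv (evalC N) 0 / evalC N 0) := by
    rw [(rhTwo_div_X hgi hg0).evalC_div_X_zero]
    have d1 := ((hΘ.hasDerivAt_zero.mul hQ.hasDerivAt_zero).const_mul (c : ℂ)).sub
      ((hN.hasDerivAt_zero.mul hQ.hasDerivAt_zero).const_mul ((1 - ε : ℝ) : ℂ))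
    have d2 := deriv_eq_of_eq_on_nonneg hgi.hasDerivAt_zero d1
      (fun t ht => hgev t (by simpa using ht))
    rw [d2]
    -- In `g'(0)` the terms with `Q'(0)` have coefficient `c Θ_o(0) - (1-ε) N(0) = 0`, so the value
    -- is independent of `Q`.
    have hc0 : (c : ℂ) ≠ 0 := fun h => hΘ0 (by rw [← hcN', h, zero_mul])
    have hQ0 : evalC Q 0 = (evalC N 0)⁻¹ := eq_inv_of_mul_eq_one_right hNQ
    rw [hQ0, ← hcN', ← hc2]
    push_cast
    field_simp
    ring
  have hae : (fun ω : ℝ => (1 - ε) * ‖evalC ((1 - N * Q) / RatFunc.X) (ω * Complex.I)‖ ^ 2 +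
      ε * ‖evalC (B * Q / RatFunc.X) (ω * Complex.I)‖ ^ 2) =ᵐ[volume] fun ω : ℝ =>
      ‖evalC ((Θo * Q - RatFunc.C c) / RatFunc.X) (ω * Complex.I)‖ ^ 2 +
        2 * ((evalC g (ω * Complex.I)).re / ω ^ 2) := by
    filter_upwards [compl_mem_ae_iff.2 (measure_singleton (0 : ℝ))] with ω hω
    have hω0 : ω ≠ 0 := by simpa using hω
    have hs : 0 ≤ ((ω : ℂ) * Complex.I).re := by simp
    rw [r1.norm_sq_div_X hω0, r2.norm_sq_div_X hω0, r3.norm_sq_div_X hω0,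
      RHInf.one.evalC_sub (hN.mul hQ) hs, hN.evalC_mul hQ hs, hB.evalC_mul hQ hs,
      (hΘ.mul hQ).evalC_sub hC hs, hΘ.evalC_mul hQ hs, hgev _ hs, evalC_one, evalC_C]
    have hax := haxis ω
    set θ := evalC Θo (ω * Complex.I)
    set n := evalC N (ω * Complex.I)
    set b := evalC B (ω * Complex.I)
    set q := evalC Q (ω * Complex.I)
    have key : (1 - ε) * ‖1 - n * q‖ ^ 2 + ε * ‖b * q‖ ^ 2 = ‖θ * q - c‖ ^ 2 +
        2 * (c * (θ * q) - ((1 - ε : ℝ) : ℂ) * (n * q)).re := by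
      have e1 : ‖1 - n * q‖ ^ 2 = 1 - 2 * (n * q).re + ‖n * q‖ ^ 2 := by
        simp only [← Complex.normSq_eq_norm_sq, Complex.normSq_apply, Complex.sub_re,
          Complex.sub_im, Complex.one_re, Complex.one_im]
        ring
      have e2 : ‖θ * q - c‖ ^ 2 = c ^ 2 - 2 * c * (θ * q).re + ‖θ * q‖ ^ 2 := by
        simp only [← Complex.normSq_eq_norm_sq, Complex.normSq_apply, Complex.sub_re,
          Complex.sub_im, Complex.ofReal_re, Complex.ofReal_im]
        ring
      rw [e1, e2, Complex.sub_re, Complex.re_ofReal_mul, Complex.re_ofReal_mul, norm_mul n,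
        norm_mul b, norm_mul θ, mul_pow, mul_pow, mul_pow, hax, hc2]
      ring
    rw [← mul_div_assoc, ← mul_div_assoc, ← mul_div_assoc, ← add_div, ← add_div, key]
  have hint := integral_congr_ae hae
  rw [integral_add (r1.integrable_norm_sq.const_mul _) (r2.integrable_norm_sq.const_mul _),
    integral_add r3.integrable_norm_sq (gI.const_mul 2), integral_const_mul, integral_const_mul,
    integral_const_mul, gV, hgder, Complex.re_ofReal_mul] at hint
  unfold normSqTwo
  have hpi : Real.pi ≠ 0 := Real.pi_ne_zero
  generalize (∫ ω : ℝ, ‖evalC ((1 - N * Q) / RatFunc.X) (ω * Complex.I)‖ ^ 2) = I1 at *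
  generalize (∫ ω : ℝ, ‖evalC (B * Q / RatFunc.X) (ω * Complex.I)‖ ^ 2) = I2 at *
  generalize (∫ ω : ℝ, ‖evalC ((Θo * Q - RatFunc.C c) / RatFunc.X) (ω * Complex.I)‖ ^ 2) = I3 at *
  generalize (deriv (evalC Θo) 0 / evalC Θo 0 - deriv (evalC N) 0 / evalC N 0).re = ℓ at *
  field_simp
  linarith

/-- The form `Q = 1/N(0) + s/(s+1) R` builds in the constraint at `0` and leaves `R` free; dividing
by `s` turns the problem into approximation by multiples of the outer function `Θ_o / (s + 1)`. -/
theorem exists_reference_approx (hΘ : IsMinimumPhase Θo) (hN0 : evalC N 0 ≠ 0)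
    {δ : ℝ} (hδ : 0 < δ) :
    ∃ Q, RHInf Q ∧ evalC N 0 * evalC Q 0 = 1 ∧
      normSqTwo ((Θo * Q - RatFunc.C (evalZero Θo / evalZero N)) / RatFunc.X) < δ := by
  have hz : (0 : ℝ) ≤ (0 : ℂ).re := by simp
  have hN0r : evalZero N ≠ 0 := by
    rw [evalC_zero_eq] at hN0
    exact_mod_cast hN0
  set q := (evalZero N)⁻¹ with hq
  set c := evalZero Θo / evalZero N with hc
  have hg : RHTwo ((RatFunc.C c - Θo * RatFunc.C q) / RatFunc.X) := by
    refine rhTwo_div_X ((RHInf.const c).sub (hΘ.1.mul (RHInf.const q))) ?_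
    rw [(RHInf.const c).evalC_sub (hΘ.1.mul (RHInf.const q)) hz,
      hΘ.1.evalC_mul (RHInf.const q) hz, evalC_C, evalC_C, evalC_zero_eq, hc, hq]
    push_cast
    ring
  have hG : IsMinimumPhase (Θo * (RatFunc.X + 1)⁻¹) := by
    refine ⟨hΘ.1.mul rhInf_inv_X_add_one, fun s hs => ?_⟩
    rw [hΘ.1.evalC_mul rhInf_inv_X_add_one hs.le, evalC_inv_X_add_one hs.le]
    exact mul_ne_zero (hΘ.2 s hs) (inv_ne_zero (add_one_ne hs.le))
  obtain ⟨R, hR', hRδ⟩ := exists_normSqTwo_sub_mul_lt hG hg hδ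
  have hR := hR'.rhInf
  refine ⟨RatFunc.C q + RatFunc.X / (RatFunc.X + 1) * R,
    (RHInf.const q).add (rhInf_X_div_X_add_one.mul hR), ?_, ?_⟩
  · rw [(RHInf.const q).evalC_add (rhInf_X_div_X_add_one.mul hR) hz,
      rhInf_X_div_X_add_one.evalC_mul hR hz, evalC_X_div_X_add_one hz, evalC_C, evalC_zero_eq, hq]
    push_cast
    have : (evalZero N : ℂ) ≠ 0 := by exact_mod_cast hN0r
    simp [this]
  · have hi : RHInf ((RatFunc.C c - Θo * RatFunc.C q) / RatFunc.X - Θo * (RatFunc.X + 1)⁻¹ * R) :=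
      hg.rhInf.sub (hG.1.mul hR)
    rw [← normSqTwo_neg _ hi] at hRδ
    convert hRδ using 2
    have h1 := RatFunc.X_ne_zero (K := ℝ)
    have h2 := X_add_one_ne_zero
    field_simp
    ring

end Reference

/-! ### Multisets of zeros in the open right half-plane -/

section Zeros

open Classical in
/-- The roots of a real polynomial in the open right half-plane, with multiplicity. -/
noncomputable def rhpRoots (p : Polynomial ℝ) : Multiset ℂ :=
  (p.aroots ℂ).filter (fun s => 0 < s.re)

theorem mem_rhpRoots {p : Polynomial ℝ} (hp : p ≠ 0) {z : ℂ} :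
    z ∈ rhpRoots p ↔ Polynomial.aeval z p = 0 ∧ 0 < z.re := by
  simp [rhpRoots, hp]

theorem rhpRoots_mul {p q : Polynomial ℝ} (hp : p ≠ 0) (hq : q ≠ 0) :
    rhpRoots (p * q) = rhpRoots p + rhpRoots q := by
  simp [rhpRoots, Polynomial.aroots_mul (mul_ne_zero hp hq)]

theorem nmpZeros_eq (G : RatFunc ℝ) : nmpZeros G = rhpRoots G.num := rfl

theorem rhpRoots_eq_zero {p : Polynomial ℝ} (h : ∀ s : ℂ, 0 < s.re → Polynomial.aeval s p ≠ 0) :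
    rhpRoots p = 0 := by
  rw [rhpRoots, Multiset.filter_eq_nil]
  intro z hz hre
  exact h z hre (Polynomial.mem_aroots.1 hz).2

theorem RHInf.rhpRoots_denom {G : RatFunc ℝ} (h : RHInf G) : rhpRoots G.denom = 0 :=
  rhpRoots_eq_zero fun s hs => h.2 s hs.le

/-- Count roots in `num * (denominators) = (numerators) * denom`; stable denominators contribute
none, so cancellation in the fraction is harmless. -/
theorem RHInf.nmpZeros_mul {G G' : RatFunc ℝ} (h : RHInf G) (h' : RHInf G') (h0 : G ≠ 0)
    (h0' : G' ≠ 0) : nmpZeros (G * G') = nmpZeros G + nmpZeros G' := by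
  have e := RatFunc.num_denom_mul G G'
  have hn := RatFunc.num_ne_zero (mul_ne_zero h0 h0')
  have e2 := congrArg rhpRoots e
  rw [rhpRoots_mul hn (mul_ne_zero G.denom_ne_zero G'.denom_ne_zero),
    rhpRoots_mul G.denom_ne_zero G'.denom_ne_zero,
    rhpRoots_mul (mul_ne_zero (RatFunc.num_ne_zero h0) (RatFunc.num_ne_zero h0'))
      (G * G').denom_ne_zero,
    rhpRoots_mul (RatFunc.num_ne_zero h0) (RatFunc.num_ne_zero h0'), h.rhpRoots_denom,
    h'.rhpRoots_denom, (h.mul h').rhpRoots_denom] at e2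
  simpa [nmpZeros_eq] using e2

theorem RHInf.nmpZeros_eq_zero_of_mul_eq_one {U V : RatFunc ℝ} (hU : RHInf U) (hV : RHInf V)
    (h : U * V = 1) : nmpZeros U = 0 := by
  have h1 := hU.nmpZeros_mul hV (left_ne_zero_of_mul_eq_one h) (right_ne_zero_of_mul_eq_one h)
  rw [h] at h1
  have h2 : nmpZeros (1 : RatFunc ℝ) = 0 := by simp [nmpZeros]
  rw [h2] at h1
  exact (add_eq_zero.1 h1.symm).1

theorem RHInf.evalC_eq_zero_iff_mem {G : RatFunc ℝ} (h : RHInf G) (h0 : G ≠ 0) {z : ℂ}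
    (hz : 0 < z.re) : evalC G z = 0 ↔ z ∈ nmpZeros G := by
  rw [nmpZeros_eq, mem_rhpRoots (RatFunc.num_ne_zero h0), Tracking.evalC_eq, div_eq_zero_iff]
  have := h.2 z hz.le
  tauto

theorem nmpZeros_re_pos {G : RatFunc ℝ} {z : ℂ} (hz : z ∈ nmpZeros G) : 0 < z.re := by
  classical
  exact (Multiset.mem_filter.1 hz).2

theorem nmpZeros_conj {G : RatFunc ℝ} {z : ℂ} (hz : z ∈ nmpZeros G) : conj z ∈ nmpZeros G := by
  have h0 : G.num ≠ 0 := by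
    intro h
    rw [nmpZeros_eq, h] at hz
    simp [rhpRoots] at hz
  rw [nmpZeros_eq, mem_rhpRoots h0] at hz ⊢
  rw [aeval_conj, hz.1]
  simpa using hz.2

end Zeros

/-! ### Real allpass factors -/

section AllPass

variable {Z : Finset ℂ}

/-- Conjugation permutes the factors, so the coefficients are real. -/
theorem exists_real_prod (hconj : ∀ z ∈ Z, conj z ∈ Z) :
    ∃ A : Polynomial ℝ, A.map (algebraMap ℝ ℂ) = ∏ z ∈ Z, (Polynomial.X - Polynomial.C z) := by
  have hinv : (∏ z ∈ Z, (Polynomial.X - Polynomial.C z)).map (starRingEnd ℂ) =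
      ∏ z ∈ Z, (Polynomial.X - Polynomial.C z) := by
    rw [Polynomial.map_prod]
    refine Finset.prod_nbij' (fun z => conj z) (fun z => conj z) hconj hconj (by simp) (by simp)
      fun z _ => by simp
  have hl : (∏ z ∈ Z, (Polynomial.X - Polynomial.C z)) ∈ Polynomial.lifts (algebraMap ℝ ℂ) := by
    rw [Polynomial.lifts_iff_coeff_lifts]
    intro n
    have := congrArg (fun p => Polynomial.coeff p n) hinv
    simp only [Polynomial.coeff_map] at this
    obtain ⟨r, hr⟩ := Complex.conj_eq_iff_real.1 this
    exact ⟨r, hr.symm⟩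
  exact hl

/-- Real polynomials with the roots `z` and `-z̄`, for `z` in `Z`. -/
structure AllPassPair (Z : Finset ℂ) (A At : Polynomial ℝ) : Prop where
  num_eq : A.map (algebraMap ℝ ℂ) = ∏ z ∈ Z, (Polynomial.X - Polynomial.C z)
  den_eq : At.map (algebraMap ℝ ℂ) = ∏ z ∈ Z, (Polynomial.X + Polynomial.C (conj z))

theorem exists_allPassPair (hconj : ∀ z ∈ Z, conj z ∈ Z) : ∃ A At, AllPassPair Z A At := by
  obtain ⟨A, hA⟩ := exists_real_prod hconj
  obtain ⟨B, hB⟩ := exists_real_prod (Z := Z.image fun z => -conj z) (by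
    intro z hz
    obtain ⟨y, hy, rfl⟩ := Finset.mem_image.1 hz
    exact Finset.mem_image.2 ⟨conj y, hconj y hy, by simp⟩)
  refine ⟨A, B, hA, ?_⟩
  rw [hB, Finset.prod_image fun x _ y _ h => (starRingEnd ℂ).injective (neg_injective h)]
  simp

namespace AllPassPair

variable {A At : Polynomial ℝ} (h : AllPassPair Z A At)

include h

theorem aeval_num (s : ℂ) : Polynomial.aeval s A = ∏ z ∈ Z, (s - z) := by
  rw [← Polynomial.eval_map_algebraMap, h.num_eq, Polynomial.eval_prod]
  simp

theorem aeval_den (s : ℂ) : Polynomial.aeval s At = ∏ z ∈ Z, (s + conj z) := by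
  rw [← Polynomial.eval_map_algebraMap, h.den_eq, Polynomial.eval_prod]
  simp

theorem monic_num : A.Monic := by
  refine Polynomial.monic_of_injective (algebraMap ℝ ℂ).injective ?_
  rw [h.num_eq]
  exact Polynomial.monic_prod_of_monic _ _ fun z _ => Polynomial.monic_X_sub_C z

theorem degree_num : A.degree = Z.card := by
  rw [← Polynomial.degree_map A (algebraMap ℝ ℂ), h.num_eq, Polynomial.degree_prod]
  simp

theorem degree_den : At.degree = Z.card := by
  rw [← Polynomial.degree_map At (algebraMap ℝ ℂ), h.den_eq, Polynomial.degree_prod]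
  simp

theorem den_ne (hre : ∀ z ∈ Z, 0 < z.re) {s : ℂ} (hs : 0 ≤ s.re) : Polynomial.aeval s At ≠ 0 := by
  rw [h.aeval_den, Finset.prod_ne_zero_iff]
  exact fun z hz => add_ne_zero_of_re hs (by simpa using hre z hz)

theorem num_ne_zero : A ≠ 0 := h.monic_num.ne_zero

theorem num_axis_ne (hre : ∀ z ∈ Z, 0 < z.re) (ω : ℝ) :
    Polynomial.aeval ((ω : ℂ) * Complex.I) A ≠ 0 := by
  rw [h.aeval_num, Finset.prod_ne_zero_iff]
  intro z hz h0
  have := congrArg Complex.re h0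
  have := hre z hz
  simp at *
  linarith

theorem rhInf (hre : ∀ z ∈ Z, 0 < z.re) : RHInf (ρ A / ρ At) :=
  rhInf_div (fun _ hs => h.den_ne hre hs) (by rw [h.degree_num, h.degree_den])

theorem evalC_eq (hre : ∀ z ∈ Z, 0 < z.re) {s : ℂ} (hs : 0 ≤ s.re) :
    evalC (ρ A / ρ At) s = Polynomial.aeval s A / Polynomial.aeval s At :=
  evalC_div_of_ne_zero _ _ (h.den_ne hre hs)

theorem norm_num_eq (ω : ℝ) : ‖Polynomial.aeval ((ω : ℂ) * Complex.I) A‖ =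
    ‖Polynomial.aeval ((ω : ℂ) * Complex.I) At‖ := by
  rw [h.aeval_num, h.aeval_den, norm_prod, norm_prod]
  refine Finset.prod_congr rfl fun z _ => ?_
  rw [← Complex.norm_conj, ← norm_neg]
  congr 1
  simp [add_comm]

/-- A stable function vanishing on `Z` is divisible by the allpass factor. -/
theorem exists_factor {G : RatFunc ℝ} (hG : RHInf G)
    (hre : ∀ z ∈ Z, 0 < z.re) (hv : ∀ z ∈ Z, evalC G z = 0) :
    ∃ p, G.num = A * p ∧ RHInf (ρ (p * At) / ρ G.denom) ∧
      G = ρ A / ρ At * (ρ (p * At) / ρ G.denom) := by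
  have hdvd : A ∣ G.num := by
    rw [← Polynomial.map_dvd_map' (algebraMap ℝ ℂ), h.num_eq]
    refine Finset.prod_dvd_of_coprime (fun x _ y _ hxy => ?_) fun z hz => ?_
    · exact Polynomial.isCoprime_X_sub_C_of_isUnit_sub (sub_ne_zero.2 hxy).isUnit
    · rw [Polynomial.dvd_iff_isRoot, Polynomial.IsRoot, Polynomial.eval_map_algebraMap]
      have := hv z hz
      rw [Tracking.evalC_eq, div_eq_zero_iff] at this
      exact this.resolve_right (hG.2 z (hre z hz).le)
  obtain ⟨p, hp⟩ := hdvd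
  refine ⟨p, hp, rhInf_div hG.2 ?_, ?_⟩
  · rw [Polynomial.degree_mul, h.degree_den, ← h.degree_num, add_comm, ← Polynomial.degree_mul, ← hp]
    exact hG.degree_le
  · conv_lhs => rw [← RatFunc.num_div_denom G, hp]
    have h1 : ρ At ≠ 0 := by
      have : At ≠ 0 := by
        rintro rfl
        exact h.den_ne hre (s := 0) (by simp) (by simp)
      simpa using this
    have h2 : ρ G.denom ≠ 0 := by simpa using G.denom_ne_zero
    rw [map_mul, map_mul]
    field_simp

theorem exists_factor_minimumPhase {G : RatFunc ℝ} (hG : RHInf G) (h0 : G ≠ 0)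
    (hZ : nmpZeros G = Z.val) :
    ∃ Gm, IsMinimumPhase Gm ∧ G = ρ A / ρ At * Gm := by
  have hre : ∀ z ∈ Z, 0 < z.re := fun z hz => nmpZeros_re_pos (G := G) (by rw [hZ]; exact hz)
  obtain ⟨p, hp, hi, he⟩ := h.exists_factor hG hre fun z hz =>
    (hG.evalC_eq_zero_iff_mem h0 (hre z hz)).2 (by rw [hZ]; exact hz)
  refine ⟨_, ⟨hi, fun s hs hz => ?_⟩, he⟩
  have hn := RatFunc.num_ne_zero h0
  have hp0 : p ≠ 0 := by rintro rfl; simp [hn] at hp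
  rw [evalC_div_of_ne_zero _ _ (hG.2 s hs.le), div_eq_zero_iff, map_mul] at hz
  have hps : Polynomial.aeval s p = 0 :=
    (mul_eq_zero.1 (hz.resolve_right (hG.2 s hs.le))).resolve_right (h.den_ne hre hs.le)
  have hr : rhpRoots A = Z.val := by
    classical
    rw [rhpRoots, Polynomial.aroots, h.num_eq, Polynomial.roots_prod_X_sub_C,
      Multiset.filter_eq_self]
    exact fun z hz => hre z hz
  have := hZ
  rw [nmpZeros_eq, hp, rhpRoots_mul h.num_ne_zero hp0, hr] at this
  have hpz : rhpRoots p = 0 := by simpa using this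
  have hm : s ∈ rhpRoots p := (mem_rhpRoots hp0).2 ⟨hps, hs⟩
  rw [hpz] at hm
  simp at hm

theorem exists_factor_rhTwo {G : RatFunc ℝ} (hG : RHTwo G)
    (hre : ∀ z ∈ Z, 0 < z.re) (hv : ∀ z ∈ Z, evalC G z = 0) :
    ∃ G', RHTwo G' ∧ G = ρ A / ρ At * G' := by
  obtain ⟨p, -, hi, he⟩ := h.exists_factor (G := G * (RatFunc.X + 1)) hG hre fun z hz => by
    have h1 := hG.evalC_eq (hre z hz).le
    rw [hv z hz, eq_comm, div_eq_zero_iff] at h1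
    exact h1.resolve_right (add_one_ne (hre z hz).le)
  set G' := ρ (p * At) / ρ (G * (RatFunc.X + 1)).denom
  refine ⟨G' * (RatFunc.X + 1)⁻¹, ?_, ?_⟩
  · rw [RHTwo, mul_assoc, inv_mul_cancel₀ X_add_one_ne_zero, mul_one]
    exact hi
  · rw [← mul_assoc, ← he, mul_assoc, mul_inv_cancel₀ X_add_one_ne_zero, mul_one]

end AllPassPair

end AllPass

theorem rhTwo_div {p q : Polynomial ℝ} (hq : ∀ s : ℂ, 0 ≤ s.re → Polynomial.aeval s q ≠ 0)
    (hdeg : p.degree < q.degree) : RHTwo (ρ p / ρ q) := by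
  have e : ρ p / ρ q * (RatFunc.X + 1) = ρ (p * (Polynomial.X + 1)) / ρ q := by
    rw [map_mul, ← X_add_one_eq, mul_div_right_comm]
  rw [RHTwo, e]
  refine rhInf_div hq ?_
  rw [show (Polynomial.X + 1 : Polynomial ℝ) = Polynomial.X + Polynomial.C 1 by simp,
    Polynomial.degree_mul, Polynomial.degree_X_add_C]
  rcases eq_or_ne p 0 with rfl | hp
  · simp
  · have hq0 : q ≠ 0 := fun h0 => hq 0 le_rfl (by simp [h0])
    rw [Polynomial.degree_eq_natDegree hp, Polynomial.degree_eq_natDegree hq0] at *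
    exact_mod_cast hdeg

/-! ### Interpolation, Szegő kernels and the noise cost -/

section Noise

variable {Z : Finset ℂ} {A At : Polynomial ℝ}

theorem AllPassPair.num_eq_zero_iff (h : AllPassPair Z A At) {s : ℂ} :
    Polynomial.aeval s A = 0 ↔ s ∈ Z := by
  rw [h.aeval_num, Finset.prod_eq_zero_iff]
  simp [sub_eq_zero]

/-- A stable function is interpolated on `Z` by a strictly proper function with denominator
`At`. -/
theorem AllPassPair.exists_interpolant (h : AllPassPair Z A At) (hre : ∀ z ∈ Z, 0 < z.re)
    {G : RatFunc ℝ} (hG : RHInf G) :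
    ∃ β : Polynomial ℝ, β.degree < A.degree ∧
      ∀ z ∈ Z, Polynomial.aeval z β = evalC G z * Polynomial.aeval z At := by
  -- In `a A + b G.denom = 1` the polynomial `b` inverts the denominator on `Z`; reduction modulo
  -- `A` keeps the values on `Z` and lowers the degree.
  have hc : IsCoprime A G.denom := by
    rw [Polynomial.isCoprime_iff_aeval_ne_zero_of_isAlgClosed ℝ ℂ]
    intro s
    by_cases hs : s ∈ Z
    · exact Or.inr (hG.2 s (hre s hs).le)
    · exact Or.inl (mt h.num_eq_zero_iff.1 hs)
  obtain ⟨a, b, hab⟩ := hc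
  refine ⟨(G.num * At * b) %ₘ A, Polynomial.degree_modByMonic_lt _ h.monic_num, fun z hz => ?_⟩
  have h0 := h.num_eq_zero_iff.2 hz
  have h1 := congrArg (Polynomial.aeval z) (Polynomial.modByMonic_add_div (G.num * At * b) A)
  have h2 := congrArg (Polynomial.aeval z) hab
  have h3 := hG.2 z (hre z hz).le
  simp only [map_add, map_mul, h0, zero_mul, add_zero, mul_zero, zero_add, map_one] at h1 h2
  rw [h1, Tracking.evalC_eq, eq_div_of_mul_eq h3 h2]
  ring

theorem aeval_comp_neg (p : Polynomial ℝ) (s : ℂ) :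
    Polynomial.aeval s (p.comp (-Polynomial.X)) = Polynomial.aeval (-s) p := by
  simp [Polynomial.aeval_comp]

theorem degree_comp_neg (p : Polynomial ℝ) : (p.comp (-Polynomial.X)).degree = p.degree := by
  simp

theorem aeval_neg_axis (p : Polynomial ℝ) (ω : ℝ) :
    Polynomial.aeval (-((ω : ℂ) * Complex.I)) p = conj (Polynomial.aeval ((ω : ℂ) * Complex.I) p) := by
  rw [← aeval_conj]
  simp

/-- The para-Hermitian conjugate of the strictly proper antistable function `β / A`. -/
noncomputable def reflection (β A : Polynomial ℝ) : RatFunc ℝ :=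
  ρ (β.comp (-Polynomial.X)) / ρ (A.comp (-Polynomial.X))

theorem AllPassPair.comp_neg_ne (h : AllPassPair Z A At) (hre : ∀ z ∈ Z, 0 < z.re) {s : ℂ}
    (hs : 0 ≤ s.re) : Polynomial.aeval s (A.comp (-Polynomial.X)) ≠ 0 := by
  rw [aeval_comp_neg]
  intro h0
  have := hre _ (h.num_eq_zero_iff.1 h0)
  simp only [Complex.neg_re] at this
  linarith

theorem AllPassPair.rhTwo_reflection (h : AllPassPair Z A At) (hre : ∀ z ∈ Z, 0 < z.re)
    {β : Polynomial ℝ} (hβ : β.degree < A.degree) : RHTwo (reflection β A) :=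
  rhTwo_div (fun _ hs => h.comp_neg_ne hre hs) (by rwa [degree_comp_neg, degree_comp_neg])

theorem AllPassPair.evalC_reflection (h : AllPassPair Z A At) (hre : ∀ z ∈ Z, 0 < z.re)
    (β : Polynomial ℝ) (ω : ℝ) :
    evalC (reflection β A) (ω * Complex.I) =
      conj (Polynomial.aeval ((ω : ℂ) * Complex.I) β / Polynomial.aeval ((ω : ℂ) * Complex.I) A) := by
  rw [reflection, evalC_div_of_ne_zero _ _ (h.comp_neg_ne hre (by simp)), aeval_comp_neg,
    aeval_comp_neg, aeval_neg_axis, aeval_neg_axis, map_div₀]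

/-- The residues of `β / A`. -/
noncomputable def residueAt (Z : Finset ℂ) (β : Polynomial ℝ) (z : ℂ) : ℂ :=
  Lagrange.nodalWeight Z id z * Polynomial.aeval z β

/-- Lagrange interpolation at `Z` reproduces `β`, since its degree is below the number of nodes;
dividing by the nodal polynomial leaves simple fractions. -/
theorem AllPassPair.partial_fractions (h : AllPassPair Z A At) {β : Polynomial ℝ}
    (hβ : β.degree < A.degree) {s : ℂ} (hs : s ∉ Z) :
    Polynomial.aeval s β / Polynomial.aeval s A = ∑ z ∈ Z, residueAt Z β z * (s - z)⁻¹ := by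
  have h1 := Lagrange.eq_interpolate (s := Z) (v := id) (f := β.map (algebraMap ℝ ℂ))
    Function.injective_id.injOn (by rwa [Polynomial.degree_map, ← h.degree_num])
  have h2 := congrArg (Polynomial.eval s) h1
  rw [Lagrange.eval_interpolate_not_at_node _ (by rintro z hz rfl; exact hs hz),
    Lagrange.eval_nodal] at h2
  simp only [Polynomial.eval_map_algebraMap, id] at h2
  rw [div_eq_iff (mt h.num_eq_zero_iff.1 hs), h2, h.aeval_num, mul_comm]
  congr 1
  exact Finset.sum_congr rfl fun z _ => by simp only [residueAt]; ring

/-- Expand the square in simple fractions; each cross integral is an entry of the Gram matrix of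
Szegő kernels. -/
theorem AllPassPair.normSqTwo_reflection (h : AllPassPair Z A At) (hre : ∀ z ∈ Z, 0 < z.re)
    {β : Polynomial ℝ} (hβ : β.degree < A.degree) :
    (normSqTwo (reflection β A) : ℂ) = ∑ z ∈ Z, ∑ z' ∈ Z,
      conj (residueAt Z β z) * residueAt Z β z' / (conj z + z') := by
  have hpt : ∀ ω : ℝ, ((‖evalC (reflection β A) (ω * Complex.I)‖ ^ 2 : ℝ) : ℂ) =
      ∑ z ∈ Z, ∑ z' ∈ Z, conj (residueAt Z β z) * residueAt Z β z' *
        ((ω * Complex.I + conj z)⁻¹ * (-(ω * Complex.I) + z')⁻¹) := by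
    intro ω
    have hω : ((ω : ℂ) * Complex.I) ∉ Z := fun hm => by simpa using hre _ hm
    rw [h.evalC_reflection hre, Complex.norm_conj, ← Complex.normSq_eq_norm_sq,
      Complex.normSq_eq_conj_mul_self, h.partial_fractions hβ hω, map_sum, Finset.sum_mul_sum]
    refine Finset.sum_congr rfl fun z hz => Finset.sum_congr rfl fun z' _ => ?_
    have e1 : conj ((ω : ℂ) * Complex.I - z)⁻¹ = -(ω * Complex.I + conj z)⁻¹ := by
      rw [map_inv₀, ← inv_neg]
      congr 1
      simp
      ring
    have e2 : ((ω : ℂ) * Complex.I - z')⁻¹ = -(-(ω * Complex.I) + z')⁻¹ := by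
      rw [← inv_neg]
      congr 1
      ring
    rw [map_mul, e1, e2]
    ring
  have hs : ∀ z ∈ Z, ∀ z' ∈ Z, _ := fun z hz z' hz' =>
    integral_szego (p := conj z) (q := z') (by simpa using hre z hz) (hre z' hz')
  rw [normSqTwo, Complex.ofReal_mul, ← integral_complex_ofReal]
  simp_rw [hpt]
  rw [integral_finsetSum _ fun z hz => integrable_finsetSum _ fun z' hz' =>
    (hs z hz z' hz').1.const_mul _, Finset.mul_sum]
  refine Finset.sum_congr rfl fun z hz => ?_
  rw [integral_finsetSum _ fun z' hz' => (hs z hz z' hz').1.const_mul _, Finset.mul_sum]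
  refine Finset.sum_congr rfl fun z' hz' => ?_
  rw [integral_const_mul, (hs z hz z' hz').2]
  have hpi : (Real.pi : ℂ) ≠ 0 := by exact_mod_cast Real.pi_ne_zero
  push_cast
  field_simp

/-- The nodes are distinct, so the pole is simple; removing its factor leaves the Lagrange nodal
weight, which matches `residueAt`. -/
theorem simpleResidue_allpassHat (c : ℂ) {z : ℂ} (hz : z ∈ Z) :
    simpleResidue (fun s => c * (allpassHat Z s)⁻¹) z =
      Lagrange.nodalWeight Z id z * (c * ∏ k ∈ Z, (z + conj k)) := by
  refine Tendsto.limUnder_eq ?_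
  have hcont : ContinuousAt (fun s : ℂ =>
      (∏ k ∈ Z.erase z, (s - k))⁻¹ * (c * ∏ k ∈ Z, (s + conj k))) z := by
    refine ContinuousAt.mul (ContinuousAt.inv₀ (by fun_prop) ?_) (by fun_prop)
    rw [Finset.prod_ne_zero_iff]
    exact fun k hk => sub_ne_zero.2 (Finset.ne_of_mem_erase hk).symm
  have hval : Lagrange.nodalWeight Z id z * (c * ∏ k ∈ Z, (z + conj k)) =
      (∏ k ∈ Z.erase z, (z - k))⁻¹ * (c * ∏ k ∈ Z, (z + conj k)) := by
    rw [Lagrange.nodalWeight, Finset.prod_inv_distrib]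
    rfl
  rw [hval]
  refine (hcont.tendsto.mono_left nhdsWithin_le_nhds).congr' ?_
  filter_upwards [self_mem_nhdsWithin] with s hs
  have hs' : s - z ≠ 0 := sub_ne_zero.2 hs
  rw [allpassHat, Finset.prod_div_distrib, inv_div, ← Finset.mul_prod_erase Z (fun k => s - k) hz]
  rw [div_eq_mul_inv, mul_inv]
  field_simp

/-- Orthogonal splitting of a strictly proper stable function into its interpolant on `Z` and a
remainder divisible by the allpass factor. -/
theorem AllPassPair.normSqTwo_split (h : AllPassPair Z A At) (hre : ∀ z ∈ Z, 0 < z.re)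
    {β : Polynomial ℝ} (hβ : β.degree < A.degree) {g : RatFunc ℝ} (hg : RHTwo g) :
    RHTwo (ρ β / ρ At + ρ A / ρ At * g) ∧
      normSqTwo (ρ β / ρ At + ρ A / ρ At * g) = normSqTwo (reflection β A) + normSqTwo g := by
  have hb : RHTwo (ρ β / ρ At) :=
    rhTwo_div (fun _ hs => h.den_ne hre hs) (by rwa [h.degree_den, ← h.degree_num])
  have hLg : RHTwo (ρ A / ρ At * g) := hg.mul_left (h.rhInf hre)
  refine ⟨hb.add hLg, ?_⟩
  have hB := h.rhTwo_reflection hre hβ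
  have hpt : ∀ ω : ℝ, ‖evalC (ρ β / ρ At + ρ A / ρ At * g) (ω * Complex.I)‖ ^ 2 =
      ‖evalC (reflection β A) (ω * Complex.I)‖ ^ 2 + ‖evalC g (ω * Complex.I)‖ ^ 2 +
        2 * (evalC g (ω * Complex.I) * evalC (reflection β A) (ω * Complex.I)).re := by
    intro ω
    have hs : (0 : ℝ) ≤ ((ω : ℂ) * Complex.I).re := by simp
    have hA := h.num_axis_ne hre ω
    have hAt := h.den_ne hre hs
    rw [hb.rhInf.evalC_add hLg.rhInf hs, (h.rhInf hre).evalC_mul hg.rhInf hs, h.evalC_eq hre hs,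
      evalC_div_of_ne_zero _ _ hAt, h.evalC_reflection hre]
    set a := Polynomial.aeval ((ω : ℂ) * Complex.I) A
    set a' := Polynomial.aeval ((ω : ℂ) * Complex.I) At
    set b := Polynomial.aeval ((ω : ℂ) * Complex.I) β
    set x := evalC g (ω * Complex.I)
    -- The unimodular factor `a / a'` can be dropped. What remains is `g` plus the antistable `β /
    -- A`, and the cross term is the real part of a product of two `H₂` functions, with integral
    -- zero.
    have e : b / a' + a / a' * x = a / a' * (b / a + x) := by field_simp
    have hn : ‖a / a'‖ = 1 := by
      rw [norm_div, h.norm_num_eq, div_self (norm_ne_zero_iff.2 hAt)]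
    rw [e, norm_mul, hn, one_mul, Complex.norm_conj, ← Complex.normSq_eq_norm_sq,
      Complex.normSq_add, Complex.normSq_eq_norm_sq, Complex.normSq_eq_norm_sq]
    congr 2
    rw [← Complex.conj_re, map_mul, Complex.conj_conj, mul_comm]
  have hi := hg.integrable_mul hB
  have h0 : ∫ ω : ℝ, (evalC g (ω * Complex.I) * evalC (reflection β A) (ω * Complex.I)).re = 0 := by
    have := integral_re hi
    simp only [RCLike.re_eq_complex_re] at this
    rw [this, hg.integral_mul hB, Complex.zero_re]
  have hi' := hi.re
  simp only [RCLike.re_eq_complex_re] at hi'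
  rw [normSqTwo, normSqTwo, normSqTwo]
  simp_rw [hpt]
  have hs := hB.integrable_norm_sq.add hg.integrable_norm_sq
  simp only [Pi.add_def] at hs
  rw [integral_add hs (hi'.const_mul 2),
    integral_add hB.integrable_norm_sq hg.integrable_norm_sq, integral_const_mul, h0]
  ring

/-- The optimal noise rejection cost: the infimum of the two-norm of `G (Xt - R Nt)` over the
stable `R` is determined by the values at the nonminimum phase zeros of `Nt`. -/
theorem exists_noise_cost {G Nt Xt R₀ : RatFunc ℝ} (hG : IsMinimumPhase G) (hNt : RHInf Nt)
    (hXt : RHInf Xt) (hNt0 : Nt ≠ 0) (hZ : nmpZeros Nt = Z.val) (hR₀ : RHInf R₀)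
    (hφ : RHTwo (G * (Xt - R₀ * Nt))) {v : ℂ → ℂ}
    (hv : ∀ z ∈ Z, v z = evalC G z * evalC Xt z) :
    ∃ S : ℝ, 0 ≤ S ∧
      (S : ℂ) = ∑ z ∈ Z, ∑ z' ∈ Z,
        conj (simpleResidue (fun s => v z * (allpassHat Z s)⁻¹) z) *
          simpleResidue (fun s => v z' * (allpassHat Z s)⁻¹) z' / (conj z + z') ∧
      (∀ R, RHInf R → RHTwo (G * (Xt - R * Nt)) → S ≤ normSqTwo (G * (Xt - R * Nt))) ∧
      ∀ δ > 0, ∃ R, RHInf R ∧ RHTwo (G * (Xt - R * Nt)) ∧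
        normSqTwo (G * (Xt - R * Nt)) < S + δ := by
  have hre : ∀ z ∈ Z, 0 < z.re := fun z hz => nmpZeros_re_pos (G := Nt) (by rw [hZ]; exact hz)
  obtain ⟨A, At, h⟩ := exists_allPassPair (Z := Z) fun z hz => by
    have := nmpZeros_conj (G := Nt) (z := z) (by rw [hZ]; exact hz)
    rw [hZ] at this
    exact this
  obtain ⟨Ntm, hNtm, hNtL⟩ := h.exists_factor_minimumPhase hNt hNt0 hZ
  -- The term with `R` carries the factor `Nt`, which vanishes on `Z`; one interpolant thus serves
  -- every `R`.
  have hval : ∀ R, RHInf R → ∀ z ∈ Z, evalC (G * (Xt - R * Nt)) z = v z := by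
    intro R hR z hz
    have hz0 := (hre z hz).le
    rw [hG.1.evalC_mul (hXt.sub (hR.mul hNt)) hz0, hXt.evalC_sub (hR.mul hNt) hz0,
      hR.evalC_mul hNt hz0, (hNt.evalC_eq_zero_iff_mem hNt0 (hre z hz)).2 (by rw [hZ]; exact hz),
      hv z hz]
    ring
  obtain ⟨β, hβ, hβv⟩ := h.exists_interpolant hre hφ.rhInf
  have hβv' : ∀ z ∈ Z, Polynomial.aeval z β = v z * Polynomial.aeval z At := fun z hz => by
    rw [hβv z hz, hval _ hR₀ z hz]
  have hb : RHTwo (ρ β / ρ At) :=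
    rhTwo_div (fun _ hs => h.den_ne hre hs) (by rwa [h.degree_den, ← h.degree_num])
  have hrem : ∀ R, RHInf R → RHTwo (G * (Xt - R * Nt)) →
      ∃ g, RHTwo g ∧ G * (Xt - R * Nt) = ρ β / ρ At + ρ A / ρ At * g := by
    intro R hR hRT
    obtain ⟨g, hg, he⟩ := h.exists_factor_rhTwo (hRT.sub hb) hre fun z hz => by
      rw [hRT.rhInf.evalC_sub hb.rhInf (hre z hz).le, hval R hR z hz,
        evalC_div_of_ne_zero _ _ (h.den_ne hre (hre z hz).le), hβv' z hz,
        mul_div_cancel_right₀ _ (h.den_ne hre (hre z hz).le), sub_self]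
    exact ⟨g, hg, by rw [← he]; ring⟩
  refine ⟨normSqTwo (reflection β A), normSqTwo_nonneg _, ?_, fun R hR hRT => ?_, fun δ hδ => ?_⟩
  · rw [h.normSqTwo_reflection hre hβ]
    have hr : ∀ z ∈ Z, residueAt Z β z = simpleResidue (fun s => v z * (allpassHat Z s)⁻¹) z :=
      fun z hz => by rw [residueAt, simpleResidue_allpassHat _ hz, hβv' z hz, h.aeval_den]
    exact Finset.sum_congr rfl fun z hz => Finset.sum_congr rfl fun z' hz' => by
      rw [hr z hz, hr z' hz']
  · obtain ⟨g, hg, he⟩ := hrem R hR hRT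
    rw [he, (h.normSqTwo_split hre hβ hg).2]
    linarith [normSqTwo_nonneg g]
  · obtain ⟨g, hg, he⟩ := hrem R₀ hR₀ hφ
    have hGN : IsMinimumPhase (G * Ntm) := ⟨hG.1.mul hNtm.1, fun s hs => by
      rw [hG.1.evalC_mul hNtm.1 hs.le]
      exact mul_ne_zero (hG.2 s hs) (hNtm.2 s hs)⟩
    -- Changing `R₀` by `R₁` changes `g` by `G Ntm R₁`, and `G Ntm` is outer, so the remainder can
    -- be made arbitrarily small.
    obtain ⟨R₁, hR₁, hlt⟩ := exists_normSqTwo_sub_mul_lt hGN hg hδ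
    have hg' : RHTwo (g - G * Ntm * R₁) := hg.sub (hR₁.mul_left hGN.1)
    have e : G * (Xt - (R₀ + R₁) * Nt) = ρ β / ρ At + ρ A / ρ At * (g - G * Ntm * R₁) := by
      have : G * (Xt - (R₀ + R₁) * Nt) = G * (Xt - R₀ * Nt) - G * R₁ * Nt := by ring
      rw [this, he, hNtL]
      ring
    obtain ⟨h1, h2⟩ := h.normSqTwo_split hre hβ hg'
    refine ⟨R₀ + R₁, hR₀.add hR₁.rhInf, ?_, ?_⟩
    · rw [e]; exact h1
    · rw [e, h2]; linarith

end Noise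

/-! ### Coprime factorizations and the closed loop -/

section Factorization

variable {P F N N₀ M Nt Mt X Y Xt Yt : RatFunc ℝ}

/-- Count multiplicities in `P M = N₀`: numerator and denominator of `P` have no common root, and
neither do `M` and `N₀` in the right half-plane, so zeros must match zeros and poles match zeros of
`M`. -/
theorem nmpZeros_eq_of_eq_div (hN₀ : RHInf N₀) (hM : RHInf M) (hP0 : P ≠ 0) (hP : P = N₀ / M)
    (hdisj : ∀ s : ℂ, 0 < s.re → evalC M s = 0 → evalC N₀ s ≠ 0) : nmpZeros N₀ = nmpZeros P := by
  classical
  have hM0 : M ≠ 0 := by rintro rfl; simp [hP] at hP0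
  have hN0 : N₀ ≠ 0 := by rintro rfl; simp [hP] at hP0
  have hPM : P * M = N₀ := by rw [hP, div_mul_cancel₀ _ hM0]
  have e := RatFunc.num_denom_mul P M
  rw [hPM] at e
  have hPn := RatFunc.num_ne_zero hP0
  have hMn := RatFunc.num_ne_zero hM0
  have hNn := RatFunc.num_ne_zero hN0
  have e2 := congrArg rhpRoots e
  rw [rhpRoots_mul hNn (mul_ne_zero P.denom_ne_zero M.denom_ne_zero),
    rhpRoots_mul P.denom_ne_zero M.denom_ne_zero,
    rhpRoots_mul (mul_ne_zero hPn hMn) N₀.denom_ne_zero, rhpRoots_mul hPn hMn,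
    hM.rhpRoots_denom, hN₀.rhpRoots_denom, add_zero, add_zero] at e2
  rw [nmpZeros_eq, nmpZeros_eq]
  ext z
  have e3 := congrArg (Multiset.count z) e2
  rw [Multiset.count_add, Multiset.count_add] at e3
  have h1 : Multiset.count z (rhpRoots P.num) = 0 ∨ Multiset.count z (rhpRoots P.denom) = 0 := by
    rw [Multiset.count_eq_zero, Multiset.count_eq_zero, mem_rhpRoots hPn,
      mem_rhpRoots P.denom_ne_zero]
    have := (Polynomial.isCoprime_iff_aeval_ne_zero_of_isAlgClosed ℝ ℂ _ _).1
      (RatFunc.isCoprime_num_denom P) z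
    tauto
  have h2 : Multiset.count z (rhpRoots M.num) = 0 ∨ Multiset.count z (rhpRoots N₀.num) = 0 := by
    rw [Multiset.count_eq_zero, Multiset.count_eq_zero]
    by_contra! hc
    have hz := nmpZeros_re_pos (G := M) hc.1
    exact hdisj z hz ((hM.evalC_eq_zero_iff_mem hM0 hz).2 hc.1)
      ((hN₀.evalC_eq_zero_iff_mem hN0 hz).2 hc.2)
  omega

namespace IsCoprimeFactorization

variable (h : IsCoprimeFactorization P F N N₀ M Nt Mt X Y Xt Yt)

include h

theorem bezout_entries : Xt * M - Yt * N = 1 ∧ Nt * M = Mt * N ∧ Mt * X - Nt * Y = 1 ∧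
    Xt * Y = Yt * X := by
  have hb := h.bezout
  have h00 := congrFun (congrFun hb 0) 0
  have h01 := congrFun (congrFun hb 0) 1
  have h10 := congrFun (congrFun hb 1) 0
  have h11 := congrFun (congrFun hb 1) 1
  simp [Matrix.mul_apply, Fin.sum_univ_two] at h00 h01 h10 h11
  refine ⟨by linear_combination h00, by linear_combination -h10, by linear_combination h11,
    by linear_combination h01⟩

theorem evalC_bezout {s : ℂ} (hs : 0 ≤ s.re) :
    evalC Xt s * evalC M s - evalC Yt s * evalC N s = 1 := by
  rw [← h.stable_Xt.evalC_mul h.stable_M hs, ← h.stable_Yt.evalC_mul h.stable_N hs,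
    ← (h.stable_Xt.mul h.stable_M).evalC_sub (h.stable_Yt.mul h.stable_N) hs,
    h.bezout_entries.1, evalC_one]

theorem denominator_ne_zero (hP0 : P ≠ 0) : M ≠ 0 := by
  rintro rfl
  exact hP0 (by simp [h.plant_eq])

theorem numerator_eq (hP0 : P ≠ 0) : N = N₀ * F := by
  have hM0 := h.denominator_ne_zero hP0
  have e := h.right_eq
  rw [h.plant_eq] at e
  field_simp at e
  exact e.symm

/-- The determinants of the two Bezout matrices are mutually inverse units of the stable ring, and
`N` is `Nt` times one of them. -/
theorem nmpZeros_left (hP0 : P ≠ 0) (hF0 : F ≠ 0) : nmpZeros Nt = nmpZeros N ∧ Nt ≠ 0 := by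
  obtain ⟨h1, h2, h3, h4⟩ := h.bezout_entries
  have hd : RHInf (M * X - N * Y) :=
    (h.stable_M.mul h.stable_X).sub (h.stable_N.mul h.stable_Y)
  have hd' : RHInf (Xt * Mt - Yt * Nt) :=
    (h.stable_Xt.mul h.stable_Mt).sub (h.stable_Yt.mul h.stable_Nt)
  have hu : (M * X - N * Y) * (Xt * Mt - Yt * Nt) = 1 := by
    linear_combination h1 + (Xt * M - Yt * N) * (h3) - (N * Mt - M * Nt) * h4
  have hN : Nt * (M * X - N * Y) = N := by linear_combination X * h2 + N * h3
  have hN0 : N ≠ 0 := by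
    rw [h.numerator_eq hP0]
    refine mul_ne_zero ?_ hF0
    rintro rfl
    exact hP0 (by simp [h.plant_eq])
  have hNt0 : Nt ≠ 0 := by rintro rfl; simp at hN; exact hN0 hN.symm
  refine ⟨?_, hNt0⟩
  rw [← hN, h.stable_Nt.nmpZeros_mul hd hNt0 (left_ne_zero_of_mul_eq_one hu),
    hd.nmpZeros_eq_zero_of_mul_eq_one hd' hu, add_zero]

theorem nmpZeros_numerator (hP0 : P ≠ 0) (hF0 : F ≠ 0) (hF : RHInf F) :
    nmpZeros N = nmpZeros P + nmpZeros F := by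
  have hN₀0 : N₀ ≠ 0 := by
    rintro rfl
    exact hP0 (by simp [h.plant_eq])
  rw [h.numerator_eq hP0, h.stable_N₀.nmpZeros_mul hF hN₀0 hF0,
    nmpZeros_eq_of_eq_div h.stable_N₀ h.stable_M hP0 h.plant_eq]
  intro s hs hM hN
  have hb := h.evalC_bezout hs.le
  rw [h.numerator_eq hP0, h.stable_N₀.evalC_mul hF hs.le, hM, hN] at hb
  simp at hb

/-- In `N₀ sᵏ = M P_o` the left side vanishes at `0` and `P_o` does not, so `M` must absorb the
integrator. -/
theorem evalC_denominator_zero {Po : RatFunc ℝ} {k : ℕ} (hk : 1 ≤ k) (hP : P = Po / RatFunc.X ^ k)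
    (hPo0 : Po.num.eval 0 ≠ 0) (hP0 : P ≠ 0) : evalC M 0 = 0 := by
  have hM0 := h.denominator_ne_zero hP0
  have hX : (RatFunc.X : RatFunc ℝ) ^ k ≠ 0 := pow_ne_zero _ RatFunc.X_ne_zero
  have e : N₀ * RatFunc.X ^ k = M * Po := by
    have := h.plant_eq
    rw [hP, div_eq_div_iff hX hM0] at this
    rw [← this, mul_comm]
  have e' : N₀.num * Polynomial.X ^ k * (M.denom * Po.denom) = M.num * Po.num * N₀.denom := by
    refine (IsFractionRing.injective (Polynomial ℝ) (RatFunc ℝ)) ?_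
    rw [← RatFunc.algebraMap_X] at e
    have d1 : ρ N₀.denom ≠ 0 := by simpa using N₀.denom_ne_zero
    have d2 : ρ M.denom ≠ 0 := by simpa using M.denom_ne_zero
    have d3 : ρ Po.denom ≠ 0 := by simpa using Po.denom_ne_zero
    have n1 := RatFunc.num_div_denom N₀
    have n2 := RatFunc.num_div_denom M
    have n3 := RatFunc.num_div_denom Po
    rw [div_eq_iff d1] at n1
    rw [div_eq_iff d2] at n2
    rw [div_eq_iff d3] at n3
    simp only [map_mul, map_pow]
    rw [n1, n2, n3]
    linear_combination (ρ N₀.denom * ρ M.denom * ρ Po.denom) * e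
  have e0 := congrArg (Polynomial.eval 0) e'
  simp only [Polynomial.eval_mul, Polynomial.eval_pow, Polynomial.eval_X,
    zero_pow (Nat.one_le_iff_ne_zero.1 hk), mul_zero, zero_mul] at e0
  have hd : N₀.denom.eval 0 ≠ 0 := by
    have := h.stable_N₀.2 0 le_rfl
    intro h0
    apply this
    rw [← Complex.ofReal_zero, aeval_ofReal, h0, Complex.ofReal_zero]
  have hn : M.num.eval 0 = 0 := by
    rcases mul_eq_zero.1 e0.symm with h1 | h1
    · exact (mul_eq_zero.1 h1).resolve_right hPo0
    · exact absurd h1 hd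
  rw [Tracking.evalC_eq, ← Complex.ofReal_zero, aeval_ofReal, hn]
  simp

/-- Every stable parameter gives a compensator, as the plant is strictly proper. -/
theorem compensator_denominator_ne_zero {Po : RatFunc ℝ} {k : ℕ} (hk : 1 ≤ k)
    (hP : P = Po / RatFunc.X ^ k) (hPo : IsProper Po) (hP0 : P ≠ 0) (hF : RHInf F)
    {R : RatFunc ℝ} (hR : RHInf R) : Xt - R * Nt ≠ 0 := by
  intro h0
  obtain ⟨h1, h2, -, -⟩ := h.bezout_entries
  have hM0 := h.denominator_ne_zero hP0
  have hX : (RatFunc.X : RatFunc ℝ) ^ k ≠ 0 := pow_ne_zero _ RatFunc.X_ne_zero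
  have hV : RHInf (F * M * (R * Mt - Yt)) :=
    (hF.mul h.stable_M).mul ((hR.mul h.stable_Mt).sub h.stable_Yt)
  -- If `Xt = R Nt`, Bezout would make `N` invertible in the stable ring. Then `P_o` times a proper
  -- function would equal `sᵏ`, impossible by degree as `k ≥ 1`.
  have hu : N * (R * Mt - Yt) = 1 := by linear_combination h1 - M * h0 - R * h2
  have hN : N = P * (F * M) := by
    have := h.right_eq
    rw [eq_div_iff hM0] at this
    rw [← this, mul_assoc]
  have e : Po * (F * M * (R * Mt - Yt)) = RatFunc.X ^ k := by
    rw [hN, hP] at hu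
    field_simp at hu
    linear_combination hu
  have hl := left_ne_zero_of_mul (e ▸ hX)
  have hr := right_ne_zero_of_mul (e ▸ hX)
  have hdeg := congrArg RatFunc.intDegree e
  have hprop : ∀ {G : RatFunc ℝ}, IsProper G → G.intDegree ≤ 0 := fun {G} hG => by
    rw [RatFunc.intDegree, sub_nonpos]
    exact_mod_cast hG
  have hXk : (RatFunc.X ^ k : RatFunc ℝ).intDegree = k := by
    rw [← RatFunc.algebraMap_X, ← map_pow, RatFunc.intDegree_polynomial]
    simp
  rw [RatFunc.intDegree_mul hl hr, hXk] at hdeg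
  have := hprop hPo
  have := hprop hV.1
  omega

/-- The sensitivity function of the loop. -/
theorem sensitivity_eq (hP0 : P ≠ 0) {R : RatFunc ℝ} (hD : Xt - R * Nt ≠ 0) :
    (1 - P * F * ((Yt - R * Mt) / (Xt - R * Nt)))⁻¹ = M * (Xt - R * Nt) := by
  obtain ⟨h1, h2, -, -⟩ := h.bezout_entries
  have hM0 := h.denominator_ne_zero hP0
  rw [h.right_eq]
  refine inv_eq_of_mul_eq_one_right ?_
  field_simp
  linear_combination h1 - R * h2

section Performance

variable {Ω : Type*} [MeasurableSpace Ω] {μ : Measure Ω}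
  (w n : Lp ℝ 2 (volume : Measure ℝ) →ₗ[ℝ] Lp ℝ 2 μ)

theorem performance_eq (hP0 : P ≠ 0) {Q R : RatFunc ℝ} (hD : Xt - R * Nt ≠ 0) (ε : ℝ)
    (H : RatFunc ℝ) (t : ℝ) :
    performance w n ε P F H (Q / (Xt - R * Nt), (Yt - R * Mt) / (Xt - R * Nt)) t =
      ENNReal.ofReal (1 - ε) *
          meanSquare w n ((1 - N * Q) / RatFunc.X) (-(N₀ * (H * (Xt - R * Nt)))) t +
        ENNReal.ofReal ε *
          meanSquare w n (F * M * Q / RatFunc.X) (M * (H * (Xt - R * Nt))) t := by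
  have hM0 := h.denominator_ne_zero hP0
  have hs := h.sensitivity_eq hP0 hD
  have hs' : (1 - F * ((Yt - R * Mt) / (Xt - R * Nt)) * P)⁻¹ = M * (Xt - R * Nt) := by
    rw [← hs]; ring
  rw [performance]
  simp only [hs, hs']
  have e1 : M * (Xt - R * Nt) * (P * F * (Q / (Xt - R * Nt))) = N * Q := by
    rw [h.right_eq]; field_simp
  have e2 : M * (Xt - R * Nt) * (P * H) = N₀ * (H * (Xt - R * Nt)) := by
    rw [h.plant_eq]; field_simp
  have e3 : M * (Xt - R * Nt) * (F * (Q / (Xt - R * Nt))) = F * M * Q := by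
    field_simp
  have e4 : M * (Xt - R * Nt) * H = M * (H * (Xt - R * Nt)) := by ring
  rw [e1, e2, e3, e4]

end Performance

end IsCoprimeFactorization

end Factorization

/-! ### Spectral factors on the imaginary axis -/

section InnerOuter

theorem IsMinimumPhasePart.norm_axis {G Gm : RatFunc ℝ} (h : IsMinimumPhasePart G Gm) (ω : ℝ) :
    ‖evalC G (ω * Complex.I)‖ = ‖evalC Gm (ω * Complex.I)‖ := by
  rw [h.2 _ (by simp), norm_mul]
  suffices hp : ‖((nmpZeros G).map fun z =>
      conj z / z * ((z - ω * Complex.I) / (conj z + ω * Complex.I))).prod‖ = 1 by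
    rw [hp, one_mul]
  rw [← normHom_apply, map_multiset_prod, Multiset.map_map]
  refine Multiset.prod_eq_one fun x hx => ?_
  obtain ⟨z, hz, rfl⟩ := Multiset.mem_map.1 hx
  have hre := nmpZeros_re_pos hz
  have hz0 : z ≠ 0 := fun h0 => by simp [h0] at hre
  have h1 : ‖z - ω * Complex.I‖ = ‖conj z + ω * Complex.I‖ := by
    rw [← Complex.norm_conj]
    simp
  have h2 : conj z + (ω : ℂ) * Complex.I ≠ 0 := by
    rw [add_comm]
    exact add_ne_zero_of_re (by simp) (by simpa using hre)
  simp only [Function.comp_apply, normHom_apply, norm_mul, norm_div, Complex.norm_conj]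
  rw [h1, div_self (norm_ne_zero_iff.2 hz0), div_self (norm_ne_zero_iff.2 h2), one_mul]

/-- The inner column is an isometry on the axis, and allpass factors have modulus one there, so
minimum phase parts may be replaced by the original functions. -/
theorem IsInnerOuter.norm_axis {G G' Gm Gm' θ₁ θ₂ θo : RatFunc ℝ} {ε : ℝ}
    (hε : ε ∈ Set.Icc (0 : ℝ) 1) (hG : IsMinimumPhasePart G Gm) (hG' : IsMinimumPhasePart G' Gm')
    (h : IsInnerOuter (RatFunc.C √(1 - ε) * Gm) (RatFunc.C √ε * Gm') θ₁ θ₂ θo) (ω : ℝ) :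
    ‖evalC θo (ω * Complex.I)‖ ^ 2 =
      (1 - ε) * ‖evalC G (ω * Complex.I)‖ ^ 2 + ε * ‖evalC G' (ω * Complex.I)‖ ^ 2 := by
  have hs : (0 : ℝ) ≤ ((ω : ℂ) * Complex.I).re := by simp
  have h1 := congrArg (fun g => ‖evalC g (ω * Complex.I)‖ ^ 2) h.fst_eq
  have h2 := congrArg (fun g => ‖evalC g (ω * Complex.I)‖ ^ 2) h.snd_eq
  simp only [(RHInf.const _).evalC_mul hG.1.1 hs, (RHInf.const _).evalC_mul hG'.1.1 hs,
    h.inner_stable₁.evalC_mul h.outer.1 hs, h.inner_stable₂.evalC_mul h.outer.1 hs, evalC_C,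
    norm_mul, mul_pow, Complex.norm_real, Real.norm_eq_abs, sq_abs, Real.sq_sqrt hε.1,
    Real.sq_sqrt (sub_nonneg.2 hε.2)] at h1 h2
  rw [hG.norm_axis, hG'.norm_axis, h1, h2, ← add_mul, h.inner_isometry, one_mul]

end InnerOuter

/-! ### Strict properness read off from moduli on the axis -/

section StrictlyProper

theorem RHInf.exists_rhTwo_sub_C {G : RatFunc ℝ} (h : RHInf G) : ∃ c : ℝ, RHTwo (G - RatFunc.C c) := by
  set n := G.denom.natDegree
  have hd : G.denom.coeff n ≠ 0 := by
    simpa [n] using G.denom_ne_zero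
  have hq : ρ G.denom ≠ 0 := by simpa using G.denom_ne_zero
  refine ⟨G.num.coeff n / G.denom.coeff n, ?_⟩
  set c := G.num.coeff n / G.denom.coeff n
  have e : G - RatFunc.C c = ρ (G.num - Polynomial.C c * G.denom) / ρ G.denom := by
    rw [map_sub, map_mul, sub_div, RatFunc.num_div_denom, mul_div_cancel_right₀ _ hq,
      RatFunc.algebraMap_C]
  rw [e]
  refine rhTwo_div h.2 ?_
  rw [Polynomial.degree_eq_natDegree G.denom_ne_zero, Polynomial.degree_lt_iff_coeff_zero]
  intro m hm
  rcases hm.eq_or_lt with rfl | hm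
  · rw [Polynomial.coeff_sub, Polynomial.coeff_C_mul, div_mul_cancel₀ _ hd, sub_self]
  · have h1 := h.1
    rw [IsProper] at h1
    simp [Polynomial.coeff_eq_zero_of_natDegree_lt hm,
      Polynomial.coeff_eq_zero_of_natDegree_lt (h1.trans_lt hm)]

theorem RHTwo.tendsto_axis {G : RatFunc ℝ} (h : RHTwo G) :
    Tendsto (fun ω : ℝ => evalC G (ω * Complex.I)) atTop (𝓝 0) := by
  obtain ⟨C, hC, hb⟩ := h.exists_bound
  refine squeeze_zero_norm' ?_ (tendsto_const_nhds.div_atTop tendsto_id (a := C))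
  filter_upwards [eventually_gt_atTop (0 : ℝ)] with ω hω
  refine (hb _ (by simp)).trans (div_le_div_of_nonneg_left hC.le hω ?_)
  have := Complex.abs_im_le_norm ((ω : ℂ) * Complex.I + 1)
  simpa using (le_abs_self _).trans this

/-- A stable proper function has a limit along the axis, and strict properness means that it is
zero. The criterion involves only the modulus, so strict properness passes through weighted
identities such as the one for `Δ_o`. -/
theorem RHInf.rhTwo_iff_tendsto {G : RatFunc ℝ} (h : RHInf G) :
    RHTwo G ↔ Tendsto (fun ω : ℝ => ‖evalC G (ω * Complex.I)‖ ^ 2) atTop (𝓝 0) := by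
  refine ⟨fun h2 => by simpa using h2.tendsto_axis.norm.pow 2, fun ht => ?_⟩
  obtain ⟨c, hc⟩ := h.exists_rhTwo_sub_C
  have h1 : Tendsto (fun ω : ℝ => evalC G (ω * Complex.I)) atTop (𝓝 (c : ℂ)) := by
    have := hc.tendsto_axis.add_const (c : ℂ)
    rw [zero_add] at this
    refine this.congr fun ω => ?_
    rw [h.evalC_sub (RHInf.const c) (by simp), evalC_C]
    ring
  have h2 := tendsto_nhds_unique ht (h1.norm.pow 2)
  have hc0 : c = 0 := by simpa using h2.symm
  simpa [hc0] using hc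

theorem rhTwo_of_weighted {G₁ G₂ G : RatFunc ℝ} {a b : ℝ} (ha : 0 < a) (hb : 0 ≤ b)
    (h₁ : RHInf G₁) (hG : RHTwo G) (h : ∀ ω : ℝ, ‖evalC G (ω * Complex.I)‖ ^ 2 =
      a * ‖evalC G₁ (ω * Complex.I)‖ ^ 2 + b * ‖evalC G₂ (ω * Complex.I)‖ ^ 2) : RHTwo G₁ := by
  rw [h₁.rhTwo_iff_tendsto]
  have ht := ((hG.rhInf.rhTwo_iff_tendsto).1 hG).const_mul a⁻¹
  rw [mul_zero] at ht
  refine squeeze_zero (fun ω => by positivity) (fun ω => ?_) ht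
  rw [h ω, mul_add, inv_mul_cancel_left₀ ha.ne']
  exact le_add_of_nonneg_right (by positivity)

theorem RHInf.rhTwo_of_weighted {G₁ G₂ G : RatFunc ℝ} {a b : ℝ} (hG : RHInf G)
    (h₁ : a ≠ 0 → RHTwo G₁) (h₂ : b ≠ 0 → RHTwo G₂)
    (h : ∀ ω : ℝ, ‖evalC G (ω * Complex.I)‖ ^ 2 =
      a * ‖evalC G₁ (ω * Complex.I)‖ ^ 2 + b * ‖evalC G₂ (ω * Complex.I)‖ ^ 2) : RHTwo G := by
  rw [hG.rhTwo_iff_tendsto]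
  have key : ∀ {c : ℝ} {K : RatFunc ℝ}, (c ≠ 0 → RHTwo K) →
      Tendsto (fun ω : ℝ => c * ‖evalC K (ω * Complex.I)‖ ^ 2) atTop (𝓝 0) := by
    intro c K hK
    rcases eq_or_ne c 0 with rfl | hc
    · simp
    · simpa using (((hK hc).rhInf.rhTwo_iff_tendsto).1 (hK hc)).const_mul c
  simpa [h] using (key h₁).add (key h₂)

theorem normSqTwo_weighted {G₁ G₂ G : RatFunc ℝ} {a b : ℝ}
    (h₁ : a ≠ 0 → RHTwo G₁) (h₂ : b ≠ 0 → RHTwo G₂)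
    (h : ∀ ω : ℝ, ‖evalC G (ω * Complex.I)‖ ^ 2 =
      a * ‖evalC G₁ (ω * Complex.I)‖ ^ 2 + b * ‖evalC G₂ (ω * Complex.I)‖ ^ 2) :
    a * normSqTwo G₁ + b * normSqTwo G₂ = normSqTwo G := by
  have key : ∀ {c : ℝ} {K : RatFunc ℝ}, (c ≠ 0 → RHTwo K) →
      Integrable (fun ω : ℝ => c * ‖evalC K (ω * Complex.I)‖ ^ 2) := by
    intro c K hK
    rcases eq_or_ne c 0 with rfl | hc
    · simp
    · exact (hK hc).integrable_norm_sq.const_mul c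
  rw [normSqTwo, normSqTwo, normSqTwo]
  simp_rw [h]
  rw [integral_add (key h₁) (key h₂), integral_const_mul, integral_const_mul]
  ring

end StrictlyProper

/-! ### The optimal tracking cost -/

section Reference

theorem hasDerivAt_prod_of_eq_one {Z : Finset ℂ} {f : ℂ → ℂ → ℂ} {f' : ℂ → ℂ}
    (h : ∀ z ∈ Z, HasDerivAt (f z) (f' z) 0) (h1 : ∀ z ∈ Z, f z 0 = 1) :
    HasDerivAt (fun s => ∏ z ∈ Z, f z s) (∑ z ∈ Z, f' z) 0 := by
  refine (HasDerivAt.fun_finsetProd h).congr_deriv (Finset.sum_congr rfl fun z _ => ?_)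
  rw [Finset.prod_eq_one fun k hk => h1 k (Finset.mem_of_mem_erase hk), one_smul]

/-- The normalization makes each factor equal to `1` at `0`, so the derivative of the product is the
sum of the terms `-1/z - 1/z̄ = -2 Re z / |z|²`. -/
theorem hasDerivAt_allpass {Z : Finset ℂ} (hre : ∀ z ∈ Z, 0 < z.re) :
    HasDerivAt (fun s => ∏ z ∈ Z, conj z / z * ((z - s) / (conj z + s)))
      (-2 * ((∑ z ∈ Z, z.re / ‖z‖ ^ 2 : ℝ) : ℂ)) 0 := by
  have hz0 : ∀ z ∈ Z, z ≠ 0 := fun z hz h0 => by simpa [h0] using hre z hz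
  have hc0 : ∀ z ∈ Z, conj z ≠ 0 := fun z hz => by simpa using hz0 z hz
  have key := hasDerivAt_prod_of_eq_one (Z := Z)
    (f := fun z s => conj z / z * ((z - s) / (conj z + s)))
    (f' := fun z => -2 * ((z.re / ‖z‖ ^ 2 : ℝ) : ℂ)) (fun z hz => ?_) (fun z hz => ?_)
  · refine key.congr_deriv ?_
    rw [← Finset.mul_sum, Complex.ofReal_sum]
  · have h1 : HasDerivAt (fun s : ℂ => z - s) (-1) 0 := by
      simpa using (hasDerivAt_id (0 : ℂ)).const_sub z
    have h2 : HasDerivAt (fun s : ℂ => conj z + s) 1 0 := by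
      simpa using (hasDerivAt_id (0 : ℂ)).const_add (conj z)
    have h3 := (h1.div h2 (by simpa using hz0 z hz)).const_mul (conj z / z)
    refine h3.congr_deriv ?_
    have e : (z.re : ℂ) = (z + conj z) / 2 := by
      rw [Complex.add_conj]; push_cast; ring
    have e2 : ((‖z‖ ^ 2 : ℝ) : ℂ) = z * conj z := by
      rw [Complex.mul_conj, Complex.normSq_eq_norm_sq]
    have := hz0 z hz
    have := hc0 z hz
    rw [Complex.ofReal_div, e, e2, add_zero, sub_zero]
    field_simp
    ring
  · have := hz0 z hz
    have := hc0 z hz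
    simp only [sub_zero, add_zero]
    field_simp

end Reference

section Reference

variable {N B Nm Bm Θ₁ Θ₂ Θo : RatFunc ℝ} {ε σ : ℝ} {Z : Finset ℂ}

/-- Since `√(1-ε) N_m = Θ₁ Θ_o`, the function `f` is a nonzero constant times `Θ₁`, hence stable,
and it inherits the absence of zeros from `N_m`. The last identity is the logarithmic derivative at
`0` of `f Θ_o L_N = κ N`. -/
theorem fFun_properties (hε : ε < 1) (hσ : 0 < σ) (hN : RHInf N) (hNm : IsMinimumPhasePart N Nm)
    (hΘ : IsInnerOuter (RatFunc.C √(1 - ε) * Nm) (RatFunc.C √ε * Bm) Θ₁ Θ₂ Θo)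
    (hN0 : evalC N 0 ≠ 0) (hZ : nmpZeros N = Z.val) :
    IsMinimumPhase (fFun ε σ Nm Θo) ∧ evalC (fFun ε σ Nm Θo) 0 ≠ 0 ∧ evalC Θo 0 ≠ 0 ∧
      (deriv (evalC Θo) 0 / evalC Θo 0 - deriv (evalC N) 0 / evalC N 0).re =
        2 * (∑ z ∈ Z, z.re / ‖z‖ ^ 2) -
          (deriv (evalC (fFun ε σ Nm Θo)) 0 / evalC (fFun ε σ Nm Θo) 0).re := by
  have hs : √(1 - ε) ≠ 0 := (Real.sqrt_pos.2 (by linarith)).ne'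
  have hΘo0 : Θo ≠ 0 := hΘ.outer.ne_zero
  have hf : ∀ s : ℂ, 0 ≤ s.re → √(1 - ε) * evalC Nm s = evalC Θ₁ s * evalC Θo s := by
    intro s hs
    rw [← hΘ.inner_stable₁.evalC_mul hΘ.outer.1 hs, ← hΘ.fst_eq,
      (RHInf.const _).evalC_mul hNm.1.1 hs, evalC_C]
  have hNm0 : evalC Nm 0 ≠ 0 := by
    intro h0
    exact hN0 (by rw [hNm.2 0 le_rfl, h0, mul_zero])
  have hprod : evalC Θ₁ 0 * evalC Θo 0 ≠ 0 := by
    rw [← hf 0 le_rfl]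
    exact mul_ne_zero (by exact_mod_cast hs) hNm0
  have hΘ0 := right_ne_zero_of_mul hprod
  set κ : ℝ := (1 - ε) * σ ^ 2 * ((evalZero Θo)⁻¹ * evalZero Nm) with hκ
  have hκ0 : κ ≠ 0 := by
    rw [evalC_zero_eq] at hΘ0 hNm0
    have h1 : evalZero Θo ≠ 0 := by exact_mod_cast hΘ0
    have h2 : evalZero Nm ≠ 0 := by exact_mod_cast hNm0
    have h3 : 1 - ε ≠ 0 := by linarith
    positivity
  have hfe : fFun ε σ Nm Θo = RatFunc.C (κ / √(1 - ε)) * Θ₁ := by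
    have hC : (RatFunc.C √(1 - ε) : RatFunc ℝ) ≠ 0 := by
      simpa using hs
    have e : Nm = (RatFunc.C √(1 - ε))⁻¹ * (Θ₁ * Θo) := by
      rw [← hΘ.fst_eq, inv_mul_cancel_left₀ hC]
    rw [fFun, hκ, map_div₀, map_mul RatFunc.C ((1 - ε) * σ ^ 2)]
    generalize RatFunc.C ((1 - ε) * σ ^ 2) = a
    generalize RatFunc.C ((evalZero Θo)⁻¹ * evalZero Nm) = b
    rw [e]
    field_simp
  have hfi : RHInf (fFun ε σ Nm Θo) := by
    rw [hfe]
    exact (RHInf.const _).mul hΘ.inner_stable₁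
  have hfv : ∀ s : ℂ, 0 ≤ s.re →
      evalC (fFun ε σ Nm Θo) s * evalC Θo s = κ * evalC Nm s := by
    intro s hs'
    rw [hfe, (RHInf.const _).evalC_mul hΘ.inner_stable₁ hs', evalC_C, mul_assoc, ← hf s hs']
    have : (√(1 - ε) : ℂ) ≠ 0 := by exact_mod_cast hs
    push_cast
    field_simp
  have hκc : (κ : ℂ) ≠ 0 := by exact_mod_cast hκ0
  have hf0 : evalC (fFun ε σ Nm Θo) 0 ≠ 0 := by
    refine left_ne_zero_of_mul (b := evalC Θo 0) ?_
    rw [hfv 0 le_rfl]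
    exact mul_ne_zero hκc hNm0
  refine ⟨⟨hfi, fun s hs' => ?_⟩, hf0, hΘ0, ?_⟩
  · refine left_ne_zero_of_mul (b := evalC Θo s) ?_
    rw [hfv s hs'.le]
    exact mul_ne_zero hκc (hNm.1.2 s hs')
  have hre : ∀ z ∈ Z, 0 < z.re := fun z hz => nmpZeros_re_pos (G := N) (by rw [hZ]; exact hz)
  set f := fFun ε σ Nm Θo
  have hL := hasDerivAt_allpass hre
  have hL0 : (∏ z ∈ Z, conj z / z * ((z - 0) / (conj z + 0))) = 1 :=
    Finset.prod_eq_one fun z hz => by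
      have h1 : z ≠ 0 := fun h0 => by simpa [h0] using hre z hz
      have h2 : conj z ≠ 0 := by simpa using h1
      simp only [sub_zero, add_zero]
      field_simp
  have hNf : ∀ s : ℂ, 0 ≤ s.re → evalC f s * evalC Θo s *
      (∏ z ∈ Z, conj z / z * ((z - s) / (conj z + s))) = κ * evalC N s := by
    intro s hs'
    rw [hfv s hs', hNm.2 s hs', hZ]
    change _ = _ * ((∏ z ∈ Z, conj z / z * ((z - s) / (conj z + s))) * _)
    ring
  have hd := deriv_eq_of_eq_on_nonneg
    ((hfi.hasDerivAt_zero.mul hΘ.outer.1.hasDerivAt_zero).mul hL)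
    (hN.hasDerivAt_zero.const_mul (κ : ℂ)) fun t ht => hNf t (by simpa using ht)
  have h0 := hNf 0 le_rfl
  simp only [Pi.mul_apply] at hd
  rw [hL0, mul_one] at h0 hd
  set S : ℝ := ∑ z ∈ Z, z.re / ‖z‖ ^ 2
  have hmain : deriv (evalC Θo) 0 / evalC Θo 0 - deriv (evalC N) 0 / evalC N 0 =
      ((2 * S : ℝ) : ℂ) - deriv (evalC f) 0 / evalC f 0 := by
    have hNe : deriv (evalC N) 0 / evalC N 0 =
        (κ * deriv (evalC N) 0) / (evalC f 0 * evalC Θo 0) := by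
      rw [h0]; field_simp
    rw [hNe, ← hd]
    push_cast
    field_simp
    ring
  rw [hmain, Complex.sub_re, Complex.ofReal_re]

/-- The optimal tracking cost with respect to the parameter `Q`. -/
theorem exists_reference_cost (hε : ε ∈ Set.Icc (0 : ℝ) 1) (hσ : 0 < σ) (hN : RHInf N)
    (hB : RHInf B) (hNm : IsMinimumPhasePart N Nm) (hBm : IsMinimumPhasePart B Bm)
    (hΘ : IsInnerOuter (RatFunc.C √(1 - ε) * Nm) (RatFunc.C √ε * Bm) Θ₁ Θ₂ Θo)
    (hN0 : evalC N 0 ≠ 0) (hB0 : evalC B 0 = 0) (hZ : nmpZeros N = Z.val) :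
    IntegrableOn (logGain (fFun ε σ Nm Θo)) (Set.Ioi 0) ∧
    ∃ L : ℝ, L = 2 * (1 - ε) * ((∑ z ∈ Z, z.re / ‖z‖ ^ 2)
          + ((nmpZeros (fFun ε σ Nm Θo)).map (fun s => s.re / ‖s‖ ^ 2)).sum
          - 1 / Real.pi * ∫ ω in Set.Ioi (0 : ℝ), logGain (fFun ε σ Nm Θo) ω) ∧
      (∀ Q, RHInf Q → (1 - ε ≠ 0 → RHTwo ((1 - N * Q) / RatFunc.X)) →
        L ≤ (1 - ε) * normSqTwo ((1 - N * Q) / RatFunc.X) +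
          ε * normSqTwo (B * Q / RatFunc.X)) ∧
      ∀ δ > 0, ∃ Q, RHInf Q ∧ (1 - ε ≠ 0 → RHTwo ((1 - N * Q) / RatFunc.X)) ∧
        RHTwo (B * Q / RatFunc.X) ∧
        (1 - ε) * normSqTwo ((1 - N * Q) / RatFunc.X) +
          ε * normSqTwo (B * Q / RatFunc.X) < L + δ := by
  rcases hε.2.eq_or_lt with rfl | hε1
  -- For `ε = 1` tracking has no weight: `Q = 0` costs nothing. Here `f = 0`, and the conventions `0
  -- / 0 = 0` and `log 0 = 0` make the log-gain vanish.
  · have hf : fFun 1 σ Nm Θo = 0 := by simp [fFun]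
    have hg : logGain (0 : RatFunc ℝ) = fun _ => 0 := by
      funext ω
      simp [logGain]
    rw [hf, hg]
    refine ⟨integrableOn_zero, 0, by simp, fun Q _ _ => ?_, fun δ hδ => ⟨0, RHInf.zero, by simp, ?_, ?_⟩⟩
    · simpa using normSqTwo_nonneg _
    · simpa using RHTwo.zero
    · simpa [normSqTwo] using hδ
  · obtain ⟨hf, hf0, hΘ0, hder⟩ := fFun_properties (Bm := Bm) (σ := σ) hε1 hσ hN hNm hΘ hN0 hZ
    obtain ⟨hint, hval⟩ := integral_logGain hf hf0
    have haxis := IsInnerOuter.norm_axis hε hNm hBm hΘ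
    have hε' : 1 - ε ≠ 0 := by linarith
    -- The sum over the zeros of `f` in the stated formula is therefore empty.
    have hz : nmpZeros (fFun ε σ Nm Θo) = 0 := by
      refine Multiset.eq_zero_of_forall_notMem fun z hz => ?_
      have hre := nmpZeros_re_pos hz
      exact hf.2 z hre ((hf.1.evalC_eq_zero_iff_mem hf.ne_zero hre).2 hz)
    refine ⟨hint, (1 - ε) * (deriv (evalC Θo) 0 / evalC Θo 0 -
      deriv (evalC N) 0 / evalC N 0).re, ?_, fun Q hQ hQT => ?_, fun δ hδ => ?_⟩
    · rw [hder, hval, hz]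
      have := Real.pi_ne_zero
      simp only [Multiset.map_zero, Multiset.sum_zero]
      field_simp
      ring
    · have hNQ : evalC N 0 * evalC Q 0 = 1 := by
        have := (hQT hε').evalC_div_X (s := 0) le_rfl
        rw [mul_zero, RHInf.one.evalC_sub (hN.mul hQ) le_rfl, hN.evalC_mul hQ le_rfl, evalC_one,
          sub_eq_zero] at this
        exact this.symm
      obtain ⟨-, -, -, h4⟩ := reference_cost_eq hN hB hΘ.outer.1 hQ haxis hΘ0 hB0 hNQ
      rw [h4]
      exact le_add_of_nonneg_left (normSqTwo_nonneg _)
    · obtain ⟨Q, hQ, hNQ, hlt⟩ := exists_reference_approx hΘ.outer hN0 hδ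
      obtain ⟨h1, h2, -, h4⟩ := reference_cost_eq hN hB hΘ.outer.1 hQ haxis hΘ0 hB0 hNQ
      exact ⟨Q, hQ, fun _ => h1, h2, by rw [h4]; linarith⟩

end Reference

/-! ### Splitting the performance index -/

section Performance

variable {Ω : Type*} [MeasurableSpace Ω] {μ : Measure Ω}
  {w n : Lp ℝ 2 (volume : Measure ℝ) →ₗ[ℝ] Lp ℝ 2 μ} {c d : ℝ}

/-- A signal of weight zero may have infinite power, because `0 * ⊤ = 0`; hence the conditional
hypothesis. -/
theorem weighted_meanSquare_eq (hw : IsWhiteNoise μ c w) (hn : IsWhiteNoise μ d n)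
    (hwn : Uncorrelated w n) {a : ℝ} (ha : 0 ≤ a) {G G' : RatFunc ℝ}
    (h : a ≠ 0 → RHTwo G ∧ RHTwo G') (t : ℝ) :
    ENNReal.ofReal a * meanSquare w n G G' t =
      ENNReal.ofReal (a * (c ^ 2 * normSqTwo G + d ^ 2 * normSqTwo G')) := by
  rcases eq_or_ne a 0 with rfl | ha'
  · simp
  · rw [meanSquare_eq hw hn hwn (h ha').1 (h ha').2, ENNReal.ofReal_mul ha]

theorem rhTwo_of_weighted_meanSquare_ne_top {a : ℝ} (ha : 0 ≤ a) {G G' : RatFunc ℝ} {t : ℝ}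
    (h : ENNReal.ofReal a * meanSquare w n G G' t ≠ ⊤) (ha' : a ≠ 0) : RHTwo G ∧ RHTwo G' := by
  refine rhTwo_of_meanSquare_ne_top (W := w) (V := n) (t := t) fun htop => h ?_
  rw [htop, ENNReal.mul_top]
  simpa using lt_of_le_of_ne ha ha'.symm

end Performance

section Performance

variable {Ω : Type*} [MeasurableSpace Ω] {μ : Measure Ω}
  {w n : Lp ℝ 2 (volume : Measure ℝ) →ₗ[ℝ] Lp ℝ 2 μ} {ε σ γ : ℝ}
  {P F H N N₀ M Nt Mt X Y Xt Yt Δo : RatFunc ℝ}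

theorem norm_axis_mul {a b : ℝ} {D : RatFunc ℝ} (hN₀ : RHInf N₀) (hM : RHInf M)
    (hΔo : RHInf Δo) (hD : RHInf D)
    (haxis : ∀ ω : ℝ, ‖evalC Δo (ω * Complex.I)‖ ^ 2 =
      a * ‖evalC N₀ (ω * Complex.I)‖ ^ 2 + b * ‖evalC M (ω * Complex.I)‖ ^ 2) (ω : ℝ) :
    ‖evalC (Δo * D) (ω * Complex.I)‖ ^ 2 =
      a * ‖evalC (N₀ * D) (ω * Complex.I)‖ ^ 2 + b * ‖evalC (M * D) (ω * Complex.I)‖ ^ 2 := by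
  have hs : (0 : ℝ) ≤ ((ω : ℂ) * Complex.I).re := by simp
  rw [hΔo.evalC_mul hD hs, hN₀.evalC_mul hD hs, hM.evalC_mul hD hs, norm_mul, norm_mul, norm_mul,
    mul_pow, mul_pow, mul_pow, haxis]
  ring

/-- A finite performance index splits into a tracking part, which depends on the parameter `Q`, and
a noise part, which depends on the parameter `R`. -/
theorem performance_split (hε : ε ∈ Set.Icc (0 : ℝ) 1)
    (hw : IsWhiteNoise μ σ w) (hn : IsWhiteNoise μ γ n) (hwn : Uncorrelated w n)
    (hcop : IsCoprimeFactorization P F N N₀ M Nt Mt X Y Xt Yt) (hP0 : P ≠ 0) (hH : RHInf H)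
    (hΔo : RHInf Δo)
    (haxis : ∀ ω : ℝ, ‖evalC Δo (ω * Complex.I)‖ ^ 2 =
      (1 - ε) * ‖evalC N₀ (ω * Complex.I)‖ ^ 2 + ε * ‖evalC M (ω * Complex.I)‖ ^ 2)
    {Q R : RatFunc ℝ} (hR : RHInf R) (hD : Xt - R * Nt ≠ 0)
    (hQ₁ : 1 - ε ≠ 0 → RHTwo ((1 - N * Q) / RatFunc.X))
    (hQ₂ : ε ≠ 0 → RHTwo (F * M * Q / RatFunc.X))
    (hRT : RHTwo (Δo * H * (Xt - R * Nt))) (t : ℝ) :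
    performance w n ε P F H (Q / (Xt - R * Nt), (Yt - R * Mt) / (Xt - R * Nt)) t =
      ENNReal.ofReal (σ ^ 2 * ((1 - ε) * normSqTwo ((1 - N * Q) / RatFunc.X) +
          ε * normSqTwo (F * M * Q / RatFunc.X)) +
        γ ^ 2 * normSqTwo (Δo * H * (Xt - R * Nt))) := by
  have hHD : RHInf (H * (Xt - R * Nt)) :=
    hH.mul (hcop.stable_Xt.sub (hR.mul hcop.stable_Nt))
  have hax := norm_axis_mul hcop.stable_N₀ hcop.stable_M hΔo hHD haxis
  rw [mul_assoc Δo H] at hRT ⊢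
  have hε' : 0 ≤ 1 - ε := sub_nonneg.2 hε.2
  have h1 : 1 - ε ≠ 0 → RHTwo (N₀ * (H * (Xt - R * Nt))) := fun h0 =>
    rhTwo_of_weighted (lt_of_le_of_ne hε' h0.symm) hε.1 (hcop.stable_N₀.mul hHD) hRT hax
  have h2 : ε ≠ 0 → RHTwo (M * (H * (Xt - R * Nt))) := fun h0 =>
    rhTwo_of_weighted (lt_of_le_of_ne hε.1 h0.symm) hε' (hcop.stable_M.mul hHD) hRT
      fun ω => (hax ω).trans (add_comm _ _)
  rw [hcop.performance_eq w n hP0 hD,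
    weighted_meanSquare_eq hw hn hwn hε' (fun h0 => ⟨hQ₁ h0, (h1 h0).neg⟩),
    weighted_meanSquare_eq hw hn hwn hε.1 (fun h0 => ⟨hQ₂ h0, h2 h0⟩),
    normSqTwo_neg _ (hcop.stable_N₀.mul hHD), ← normSqTwo_weighted h1 h2 hax, ← ENNReal.ofReal_add]
  · congr 1
    ring
  · have := normSqTwo_nonneg ((1 - N * Q) / RatFunc.X)
    have := normSqTwo_nonneg (N₀ * (H * (Xt - R * Nt)))
    positivity
  · have := normSqTwo_nonneg (F * M * Q / RatFunc.X)
    have := normSqTwo_nonneg (M * (H * (Xt - R * Nt)))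
    have := hε.1
    positivity

/-- Finiteness makes each signal of non-zero weight strictly proper; the spectral identity for `Δ_o`
combines the two noise conditions into one on `Δ_o H (X̃ - R Ñ)`. -/
theorem rhTwo_of_performance_ne_top (hε : ε ∈ Set.Icc (0 : ℝ) 1)
    (hcop : IsCoprimeFactorization P F N N₀ M Nt Mt X Y Xt Yt) (hP0 : P ≠ 0) (hH : RHInf H)
    (hΔo : RHInf Δo)
    (haxis : ∀ ω : ℝ, ‖evalC Δo (ω * Complex.I)‖ ^ 2 =
      (1 - ε) * ‖evalC N₀ (ω * Complex.I)‖ ^ 2 + ε * ‖evalC M (ω * Complex.I)‖ ^ 2)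
    {Q R : RatFunc ℝ} (hR : RHInf R) (hD : Xt - R * Nt ≠ 0) {t : ℝ}
    (hfin : performance w n ε P F H (Q / (Xt - R * Nt), (Yt - R * Mt) / (Xt - R * Nt)) t ≠ ⊤) :
    (1 - ε ≠ 0 → RHTwo ((1 - N * Q) / RatFunc.X)) ∧
      (ε ≠ 0 → RHTwo (F * M * Q / RatFunc.X)) ∧ RHTwo (Δo * H * (Xt - R * Nt)) := by
  have hHD : RHInf (H * (Xt - R * Nt)) :=
    hH.mul (hcop.stable_Xt.sub (hR.mul hcop.stable_Nt))
  have hax := norm_axis_mul hcop.stable_N₀ hcop.stable_M hΔo hHD haxis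
  rw [hcop.performance_eq w n hP0 hD, ENNReal.add_ne_top] at hfin
  have h1 := rhTwo_of_weighted_meanSquare_ne_top (sub_nonneg.2 hε.2) hfin.1
  have h2 := rhTwo_of_weighted_meanSquare_ne_top hε.1 hfin.2
  refine ⟨fun h0 => (h1 h0).1, fun h0 => (h2 h0).1, ?_⟩
  rw [mul_assoc]
  exact (hΔo.mul hHD).rhTwo_of_weighted (fun h0 => by simpa using (h1 h0).2.neg)
    (fun h0 => (h2 h0).2) hax

end Performance

end Tracking

/-! ### The optimal performance -/

theorem corollary1 {Ω : Type*} [MeasurableSpace Ω] (μ : Measure Ω) [IsProbabilityMeasure μ]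
    (ε σ γ : ℝ) (hε : ε ∈ Set.Icc (0 : ℝ) 1) (hσ : 0 < σ) (hγ : 0 ≤ γ)
    -- uncorrelated white Gaussian noises with spectral densities `σ²` and `γ²`
    (w n : Lp ℝ 2 (volume : Measure ℝ) →ₗ[ℝ] Lp ℝ 2 μ)
    (hw : Tracking.IsWhiteNoise μ σ w) (hn : Tracking.IsWhiteNoise μ γ n)
    (hwn : Tracking.Uncorrelated w n)
    -- plant `P = P_o / s ^ k` and channel `F`, `H`
    (P F H Po : RatFunc ℝ) (k : ℕ) (hk : 1 ≤ k) (hP : P = Po / RatFunc.X ^ k)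
    (hPo : Tracking.IsProper Po) (hPo0 : Po.num.eval 0 ≠ 0)
    (hF : Tracking.RHInf F) (hH : Tracking.IsMinimumPhase H)
    (hZ : (Tracking.nmpZeros P + Tracking.nmpZeros F).Nodup)
    -- coprime factorizations and double Bezout identity
    (N N₀ M Nt Mt X Y Xt Yt : RatFunc ℝ)
    (hcop : Tracking.IsCoprimeFactorization P F N N₀ M Nt Mt X Y Xt Yt)
    -- minimum phase parts and inner-outer factorizations
    (Nm CFM N₀m Mm : RatFunc ℝ)
    (hNm : Tracking.IsMinimumPhasePart N Nm)
    (hCFM : Tracking.IsMinimumPhasePart (F * M) CFM)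
    (hN₀m : Tracking.IsMinimumPhasePart N₀ N₀m)
    (hMm : Tracking.IsMinimumPhasePart M Mm)
    (Θ₁ Θ₂ Θo : RatFunc ℝ)
    (hΘ : Tracking.IsInnerOuter (RatFunc.C √(1 - ε) * Nm) (RatFunc.C √ε * CFM) Θ₁ Θ₂ Θo)
    (Δ₁ Δ₂ Δo : RatFunc ℝ)
    (hΔ : Tracking.IsInnerOuter (RatFunc.C √(1 - ε) * N₀m) (RatFunc.C √ε * Mm) Δ₁ Δ₂ Δo)
    (t : ℝ)
    -- some stabilizing compensator has a finite performance index
    (hfin : ∃ K ∈ Tracking.stabilizing Nt Mt Xt Yt,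
      Tracking.performance w n ε P F H K t ≠ ⊤) :
    let f := Tracking.fFun ε σ Nm Θo
    let Z := (Tracking.nmpZeros P + Tracking.nmpZeros F).toFinset
    let r := Tracking.rTilde Δo M H Z
    IntegrableOn (Tracking.logGain f) (Set.Ioi 0) ∧
    ((Tracking.optimalPerformance w n ε P F H
        (Tracking.stabilizing Nt Mt Xt Yt) t).toReal : ℂ) =
      ((2 * (1 - ε) * σ ^ 2 *
        ((∑ z ∈ Z, z.re / ‖z‖ ^ 2)
          + ((Tracking.nmpZeros f).map (fun s => s.re / ‖s‖ ^ 2)).sum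
          - 1 / Real.pi * ∫ ω in Set.Ioi (0 : ℝ), Tracking.logGain f ω) : ℝ) : ℂ)
      + (γ : ℂ) ^ 2 * ∑ z ∈ Z, ∑ z' ∈ Z, conj (r z) * r z' / (conj z + z') := by
  classical
  intro f Z r
  have hPo' : Po ≠ 0 := by
    rintro rfl
    simp at hPo0
  have hP0 : P ≠ 0 := by
    rw [hP]
    exact div_ne_zero hPo' (pow_ne_zero _ RatFunc.X_ne_zero)
  -- The zero function has no minimum phase part: its multiset of zeros is empty by convention, so
  -- the part would itself vanish.
  have hF0 : F ≠ 0 := by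
    rintro rfl
    have h2 := hCFM.1.2 1 (by simp)
    have h3 := hCFM.2 1 (by simp)
    simp only [zero_mul, Tracking.evalC_zero, Tracking.nmpZeros, RatFunc.num_zero,
      Polynomial.aroots_zero, Multiset.filter_zero, Multiset.map_zero, Multiset.prod_zero,
      one_mul] at h3
    exact h2 h3.symm
  have hZN : Tracking.nmpZeros N = Z.val := by
    rw [hcop.nmpZeros_numerator hP0 hF0 hF]
    exact (Multiset.dedup_eq_self.2 hZ).symm
  obtain ⟨hNtZ, hNt0⟩ := hcop.nmpZeros_left hP0 hF0
  rw [hZN] at hNtZ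
  have hM0 := hcop.evalC_denominator_zero hk hP hPo0 hP0
  have hN0 : Tracking.evalC N 0 ≠ 0 := fun h0 => by
    have := hcop.evalC_bezout (s := 0) le_rfl
    rw [hM0, h0] at this
    simp at this
  have hN_ne : N ≠ 0 := by
    rintro rfl
    simp at hN0
  have hD : ∀ {R}, Tracking.RHInf R → Xt - R * Nt ≠ 0 := fun hR =>
    hcop.compensator_denominator_ne_zero hk hP hPo hP0 hF hR
  have haxis := Tracking.IsInnerOuter.norm_axis hε hN₀m hMm hΔ
  have hB0 : Tracking.evalC (F * M) 0 = 0 := by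
    rw [hF.evalC_mul hcop.stable_M le_rfl, hM0, mul_zero]
  obtain ⟨hint, L, hL, hLlow, hLapp⟩ := Tracking.exists_reference_cost hε hσ hcop.stable_N
    (hF.mul hcop.stable_M) hNm hCFM hΘ hN0 hB0 hZN
  obtain ⟨K₀, ⟨Q₀, R₀, hQ₀, hR₀, hD₀, rfl⟩, hfin₀⟩ := hfin
  -- The compensator of finite cost supplies an `R₀` with `Δ_o H (X̃ - R₀ Ñ)` strictly proper, the
  -- starting point for the noise optimization.
  obtain ⟨-, -, hφ⟩ := Tracking.rhTwo_of_performance_ne_top hε hcop hP0 hH.1 hΔ.outer.1 haxis hR₀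
    hD₀ hfin₀
  have hG : Tracking.IsMinimumPhase (Δo * H) := ⟨hΔ.outer.1.mul hH.1, fun s hs => by
    rw [hΔ.outer.1.evalC_mul hH.1 hs.le]
    exact mul_ne_zero (hΔ.outer.2 s hs) (hH.2 s hs)⟩
  obtain ⟨S, hS0, hS, hSlow, hSapp⟩ := Tracking.exists_noise_cost hG hcop.stable_Nt hcop.stable_Xt
    hNt0 hNtZ hR₀ hφ
    (v := fun z => Tracking.evalC Δo z * (Tracking.evalC M z)⁻¹ * Tracking.evalC H z) (by
      intro z hz
      have hre : 0 < z.re := Tracking.nmpZeros_re_pos (G := N) (by rw [hZN]; exact hz)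
      -- At a zero of `N` the identity reads `X̃ M = 1`, which turns `X̃(z)` into `M(z)⁻¹`.
      have hb := hcop.evalC_bezout hre.le
      rw [(hcop.stable_N.evalC_eq_zero_iff_mem hN_ne hre).2 (by rw [hZN]; exact hz), mul_zero,
        sub_zero] at hb
      rw [hΔ.outer.1.evalC_mul hH.1 hre.le, eq_inv_of_mul_eq_one_left hb]
      ring)
  have hL0 : 0 ≤ L := by
    refine le_of_forall_pos_lt_add fun δ hδ => ?_
    obtain ⟨Q, -, -, -, hlt⟩ := hLapp δ hδ
    have h1 := Tracking.normSqTwo_nonneg ((1 - N * Q) / RatFunc.X)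
    have h2 := Tracking.normSqTwo_nonneg (F * M * Q / RatFunc.X)
    exact (add_nonneg (mul_nonneg (sub_nonneg.2 hε.2) h1) (mul_nonneg hε.1 h2)).trans_lt hlt
  have hopt : Tracking.optimalPerformance w n ε P F H (Tracking.stabilizing Nt Mt Xt Yt) t =
      ENNReal.ofReal (σ ^ 2 * L + γ ^ 2 * S) := by
    refine le_antisymm ?_ ?_
    · refine ENNReal.le_of_forall_pos_le_add fun δ hδ _ => ?_
      -- The same tolerance in `Q` and in `R`, scaled so that the weighted errors add up to `δ`.
      have hc : 0 < δ / (σ ^ 2 + γ ^ 2) := by positivity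
      obtain ⟨Q, hQ, hQ₁, hQ₂, hQlt⟩ := hLapp _ hc
      obtain ⟨R, hR, hRT, hRlt⟩ := hSapp _ hc
      refine (iInf₂_le _ ⟨Q, R, hQ, hR, hD hR, rfl⟩).trans ?_
      rw [Tracking.performance_split hε hw hn hwn hcop hP0 hH.1 hΔ.outer.1 haxis hR (hD hR) hQ₁
        (fun _ => hQ₂) hRT, ← ENNReal.ofReal_coe_nnreal, ← ENNReal.ofReal_add (by positivity) δ.coe_nonneg]
      refine ENNReal.ofReal_le_ofReal ?_
      have h1 := mul_le_mul_of_nonneg_left hQlt.le (sq_nonneg σ)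
      have h2 := mul_le_mul_of_nonneg_left hRlt.le (sq_nonneg γ)
      have h3 : σ ^ 2 * (δ / (σ ^ 2 + γ ^ 2)) + γ ^ 2 * (δ / (σ ^ 2 + γ ^ 2)) = (δ : ℝ) := by
        field_simp
      linarith
    · refine le_iInf₂ fun K hK => ?_
      obtain ⟨Q, R, hQ, hR, hDR, rfl⟩ := hK
      by_cases htop : Tracking.performance w n ε P F H
          (Q / (Xt - R * Nt), (Yt - R * Mt) / (Xt - R * Nt)) t = ⊤
      · rw [htop]
        exact le_top
      obtain ⟨hQ₁, hQ₂, hRT⟩ := Tracking.rhTwo_of_performance_ne_top hε hcop hP0 hH.1 hΔ.outer.1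
        haxis hR hDR htop
      rw [Tracking.performance_split hε hw hn hwn hcop hP0 hH.1 hΔ.outer.1 haxis hR hDR hQ₁ hQ₂ hRT]
      exact ENNReal.ofReal_le_ofReal (add_le_add
        (mul_le_mul_of_nonneg_left (hLlow Q hQ hQ₁) (sq_nonneg σ))
        (mul_le_mul_of_nonneg_left (hSlow R hR hRT) (sq_nonneg γ)))
  refine ⟨hint, ?_⟩
  rw [hopt, ENNReal.toReal_ofReal (by positivity), Complex.ofReal_add, Complex.ofReal_mul _ S, hS,
    Complex.ofReal_pow]
  congr 1
  rw [hL]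
  push_cast
  ring
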